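/- Let $d\in\{2,3\}$ and let $\Omega\subset\mathbb R^d$ be a bounded open set that equals the interior of its closure (for instance a bounded Lipschitz polygon or polyhedron). Let $\sigma\in\mathbb R$ and $k\in\mathbb N$. Then there is a constant $C>0$, depending only on $d,\Omega,\sigma,k$ (in particular independent of the mesh and its size $h$), such that the following holds. Let $\mathcal T_h$ be a conforming simplicial mesh of $\overline\Omega$ that is shape regular with constant $\sigma$, i.e. every $T\in\mathcal T_h$ contains a ball of some radius $r\ge 0$ with $h_T\le 2\sigma r$, where $h_T=\operatorname{diam}T$. Let $\mathbf W_h\subset H^1(\Omega)^d$ and $Q_h\subset L^2_0(\Omega)$ be linear spaces of functions that are polynomials of degree at most $k$ on each element, and put $\mathbf V_h=\mathbf W_h\cap H^1_0(\Omega)^d$. Let $E\mathbf g_h\in\mathbf W_h$, with trace $\mathbf g_h$ on $\Gamma=\partial\Omega$ (equality of boundary values meaning that the difference belongs to $H^1_0(\Omega)^d$, the closure of $C_c^\infty(\Omega)^d$). Let $(\mathbf u(h),p(h))\in H^1(\Omega)^d\times L^2_0(\Omega)$ be a weak solution of the Stokes problem $$-\Delta\mathbf u(h)+\nabla p(h)=0,\quad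 \operatorname{div}\mathbf u(h)=0\ \text{ in }\Omega,\qquad \mathbf u(h)=\mathbf g_h\ \text{ on }\Gamma,$$ and let $(\mathbf u_h,p_h)\in\mathbf W_h\times Q_h$ satisfy $\mathbf u_h=\mathbf g_h$ on $\Gamma$ and $$(\nabla\mathbf u_h,\nabla\mathbf v_h)-(\operatorname{div}\mathbf v_h,p_h)=0\quad\forall\,\mathbf v_h\in\mathbf V_h,\qquad (\operatorname{div}\mathbf u_h,q_h)=0\quad\forall\,q_h\in Q_h .$$ For $T\in\mathcal T_h$ define the error indicator $$\eta_T^2=h_T^4\|-\Delta\mathbf u_h+\nabla p_h\|_{0,T}^2+h_T^2\|\operatorname{div}\mathbf u_h\|_{0,T}^2+\frac12\sum_{e\subset T}h_T^3\|\mathbf J_e\|_{0,e}^2,$$ where the differential operators are applied on the element $T$, the sum is over the edges ($d=2$) or faces ($d=3$) $e$ of $T$ that are interior, i.e. $e=T^+\cap T^-$ with two different elements $T^\pm$, and $$\mathbf J_e=\Big(\frac{\partial\mathbf u_h|_{T^+}}{\partial\mathbf n^+}-p_h|_{T^+}\mathbf n^+\Big)+\Big(\frac{\partial\mathbf u_h|_{T^-}}{\partial\mathbf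 n^-}-p_h|_{T^-}\mathbf n^-\Big)$$ with $\mathbf n^\pm$ the exterior unit normal of $T^\pm$ on $e$. Let $\omega_T$ be the interior of the union of all closed elements $T'\in\mathcal T_h$ with $T'\cap T\neq\emptyset$. Then, for every $T\in\mathcal T_h$, $$\eta_T\le C\left(\|\mathbf u(h)-\mathbf u_h\|_{0,\omega_T}+\|p(h)-p_h\|_{-1,\omega_T}\right),$$ where $\|\cdot\|_{0,\omega_T}$ is the $L^2(\omega_T)$ norm and $$\|p\|_{-1,\omega_T}=\sup_{0\ne q\in H^1_0(\omega_T)}\frac{\int_{\omega_T}p\,q}{\|q\|_{1,\omega_T}},\qquad \|q\|_{1,\omega_T}^2=\|q\|_{0,\omega_T}^2+\|\nabla q\|_{0,\omega_T}^2 .$$ -/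

import Mathlib

open MeasureTheory
open scoped ContDiff

noncomputable section

namespace StokesFEM

/-- The Euclidean space `ℝᵈ`. -/
abbrev Space (d : ℕ) : Type := EuclideanSpace ℝ (Fin d)

section Sobolev

variable {d : ℕ}

/-- The `L²(S)` norm (Lebesgue measure) of a scalar or vector valued function. -/
def l2Norm {F : Type*} [NormedAddCommGroup F] (S : Set (Space d)) (f : Space d → F) : ℝ :=
  lpNorm f 2 (volume.restrict S)

/-- `φ ∈ C_c^∞(Ω)`. -/
def IsTestFunction (Ω : Set (Space d)) (φ : Space d → ℝ) : Prop :=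
  ContDiff ℝ ∞ φ ∧ HasCompactSupport φ ∧ tsupport φ ⊆ Ω

/-- `g ∈ L²(Ω)` is the weak `i`-th partial derivative of `u` on the open set `Ω`. -/
def HasWeakPartial (Ω : Set (Space d)) (i : Fin d) (u g : Space d → ℝ) : Prop :=
  MemLp g 2 (volume.restrict Ω) ∧
    ∀ φ : Space d → ℝ, IsTestFunction Ω φ →
      ∫ x in Ω, u x * fderiv ℝ φ x (EuclideanSpace.single i 1) = -∫ x in Ω, g x * φ x

/-- `u ∈ H¹(Ω)`. -/
def MemH1 (Ω : Set (Space d)) (u : Space d → ℝ) : Prop :=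
  MemLp u 2 (volume.restrict Ω) ∧ ∀ i, ∃ g, HasWeakPartial Ω i u g

open Classical in
/-- The weak partial derivative `∂ᵢu` on `Ω` (unique up to null sets; `0` if there is none). -/
def weakPartial (Ω : Set (Space d)) (i : Fin d) (u : Space d → ℝ) : Space d → ℝ :=
  if h : ∃ g, HasWeakPartial Ω i u g then h.choose else 0

/-- The norm of `H¹(Ω)`. -/
def h1Norm (Ω : Set (Space d)) (u : Space d → ℝ) : ℝ :=
  Real.sqrt (l2Norm Ω u ^ 2 + ∑ i, l2Norm Ω (weakPartial Ω i u) ^ 2)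

/-- `u ∈ H¹₀(Ω)`, the closure of `C_c^∞(Ω)` in `H¹(Ω)`. -/
def MemH10 (Ω : Set (Space d)) (u : Space d → ℝ) : Prop :=
  MemH1 Ω u ∧ ∀ ε : ℝ, 0 < ε → ∃ φ, IsTestFunction Ω φ ∧ h1Norm Ω (u - φ) < ε

/-- The norm of `p ∈ L²(Ω)` in `H⁻¹(Ω)`, the dual space of `H¹₀(Ω)` with the full `H¹` norm. -/
def hNegOneNorm (Ω : Set (Space d)) (p : Space d → ℝ) : ℝ :=
  sSup {r : ℝ | ∃ q, MemH10 Ω q ∧ 0 < h1Norm Ω q ∧ r = (∫ x in Ω, p x * q x) / h1Norm Ω q}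

/-- `p ∈ L²₀(Ω)`. -/
def MemL20 (Ω : Set (Space d)) (p : Space d → ℝ) : Prop :=
  MemLp p 2 (volume.restrict Ω) ∧ ∫ x in Ω, p x = 0

/-- The `i`-th component of a vector field. -/
def comp (u : Space d → Space d) (i : Fin d) : Space d → ℝ := fun x => u x i

/-- `u ∈ H¹(Ω)ᵈ`. -/
def VecMemH1 (Ω : Set (Space d)) (u : Space d → Space d) : Prop := ∀ i, MemH1 Ω (comp u i)

/-- `u ∈ H¹₀(Ω)ᵈ`. -/
def VecMemH10 (Ω : Set (Space d)) (u : Space d → Space d) : Prop := ∀ i, MemH10 Ω (comp u i)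

/-- The weak divergence of `u ∈ H¹(Ω)ᵈ`. -/
def weakDiv (Ω : Set (Space d)) (u : Space d → Space d) : Space d → ℝ :=
  fun x => ∑ i, weakPartial Ω i (comp u i) x

/-- The form `(∇u, ∇v)_Ω`. -/
def gradForm (Ω : Set (Space d)) (u v : Space d → Space d) : ℝ :=
  ∑ i, ∑ j, ∫ x in Ω, weakPartial Ω j (comp u i) x * weakPartial Ω j (comp v i) x

/-- The form `(div v, q)_Ω`. -/
def divForm (Ω : Set (Space d)) (v : Space d → Space d) (q : Space d → ℝ) : ℝ :=
  ∫ x in Ω, weakDiv Ω v x * q x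

/-- `(u, p) ∈ H¹(Ω)ᵈ × L²₀(Ω)` is the weak solution of the Stokes problem
`-Δu + ∇p = 0`, `div u = 0` in `Ω`, `u = g` on `∂Ω`, where the boundary datum is the trace
of the field `Eg ∈ H¹(Ω)ᵈ`. -/
structure IsStokesSolution (Ω : Set (Space d)) (Eg u : Space d → Space d)
    (p : Space d → ℝ) : Prop where
  velocity_mem : VecMemH1 Ω u
  pressure_mem : MemL20 Ω p
  boundary : VecMemH10 Ω (u - Eg)
  momentum : ∀ v, VecMemH10 Ω v → gradForm Ω u v - divForm Ω v p = 0
  incompressible : ∀ᵐ x ∂(volume.restrict Ω), weakDiv Ω u x = 0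

end Sobolev

section Mesh

variable {d : ℕ}

/-- The closed simplex with the given vertices. -/
def hull (T : Finset (Space d)) : Set (Space d) := convexHull ℝ (T : Set (Space d))

/-- A conforming simplicial mesh of `Ω ⊆ ℝᵈ`. An element is given by its `d + 1` vertices; two
closed elements meet in the (possibly empty) simplex spanned by their common vertices. -/
structure Mesh (d : ℕ) (Ω : Set (Space d)) where
  elems : Finset (Finset (Space d))
  card_eq : ∀ T ∈ elems, T.card = d + 1
  indep : ∀ T ∈ elems, AffineIndependent ℝ ((↑) : T → Space d)
  conforming : ∀ T ∈ elems, ∀ T' ∈ elems,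
    hull T ∩ hull T' = convexHull ℝ ((T : Set (Space d)) ∩ (T' : Set (Space d)))
  covers : ⋃ T ∈ elems, hull T = closure Ω

/-- The diameter `h_T` of an element. -/
def elemDiam (T : Finset (Space d)) : ℝ := Metric.diam (hull T)

variable {Ω : Set (Space d)}

/-- Shape regularity with constant `σ`: every element `T` contains a ball whose diameter `2r`
satisfies `h_T ≤ σ · 2r`. -/
def Mesh.ShapeRegular (M : Mesh d Ω) (σ : ℝ) : Prop :=
  ∀ T ∈ M.elems, ∃ (c : Space d) (r : ℝ), 0 ≤ r ∧ Metric.closedBall c r ⊆ hull T ∧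
    elemDiam T ≤ σ * (2 * r)

open Classical in
/-- The patch `ω_T`: the (open) region formed by the elements whose closure meets that of `T`. -/
def Mesh.patch (M : Mesh d Ω) (T : Finset (Space d)) : Set (Space d) :=
  interior (⋃ T' ∈ M.elems.filter (fun T' => (hull T' ∩ hull T).Nonempty), hull T')

/-- `e` (a set of `d` vertices) is an interior edge (`d = 2`) or face (`d = 3`) of the mesh:
`e = T⁺ ∩ T⁻` for two different elements `T⁺`, `T⁻`. -/
def Mesh.IsInteriorFace (M : Mesh d Ω) (e : Finset (Space d)) : Prop :=
  e.card = d ∧ ∃ Tp ∈ M.elems, ∃ Tm ∈ M.elems, Tp ≠ Tm ∧ hull Tp ∩ hull Tm = hull e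

open Classical in
/-- The interior edges/faces contained in the closed element `T`. -/
def Mesh.interiorFaces (M : Mesh d Ω) (T : Finset (Space d)) : Finset (Finset (Space d)) :=
  (T.powersetCard d).filter M.IsInteriorFace

/-- `u` is on the interior of every element a polynomial of total degree at most `k`. -/
def Mesh.IsPiecewisePoly (M : Mesh d Ω) (k : ℕ) (u : Space d → ℝ) : Prop :=
  ∀ T ∈ M.elems, ∃ P : MvPolynomial (Fin d) ℝ, P.totalDegree ≤ k ∧
    ∀ x ∈ interior (hull T), u x = MvPolynomial.eval x.ofLp P

open Classical in
/-- The polynomial `u|_T`, for `u` polynomial on the interior of `T`. -/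
def localPoly (T : Finset (Space d)) (u : Space d → ℝ) : MvPolynomial (Fin d) ℝ :=
  if h : ∃ P : MvPolynomial (Fin d) ℝ, ∀ x ∈ interior (hull T), u x = MvPolynomial.eval x.ofLp P
  then h.choose else 0

open Classical in
/-- The exterior unit normal of the simplex `T` on its facet `e`. -/
def outwardNormal (T e : Finset (Space d)) : Space d :=
  if h : ∃ n : Space d, ‖n‖ = 1 ∧ (∀ x ∈ e, ∀ y ∈ e, inner ℝ n (x - y) = 0) ∧
      ∀ x ∈ e, ∀ v ∈ T, v ∉ e → inner ℝ n (v - x) < 0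
  then h.choose else 0

/-- The residual `-Δu_h + ∇p_h` on the element `T`. -/
def elemResidual (T : Finset (Space d)) (uh : Space d → Space d) (ph : Space d → ℝ) :
    Space d → Space d :=
  fun x => WithLp.toLp 2 fun i =>
    -(∑ j, MvPolynomial.eval x.ofLp
        (MvPolynomial.pderiv j (MvPolynomial.pderiv j (localPoly T (comp uh i))))) +
      MvPolynomial.eval x.ofLp (MvPolynomial.pderiv i (localPoly T ph))

/-- The divergence `div u_h` on the element `T`. -/
def elemDiv (T : Finset (Space d)) (uh : Space d → Space d) : Space d → ℝ :=
  fun x => ∑ i, MvPolynomial.eval x.ofLp (MvPolynomial.pderiv i (localPoly T (comp uh i)))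

/-- `∂u_h|_T/∂n - p_h|_T n` on the facet `e` of `T`, with `n` the exterior normal of `T`. -/
def normalFlux (T e : Finset (Space d)) (uh : Space d → Space d) (ph : Space d → ℝ) :
    Space d → Space d :=
  fun x => WithLp.toLp 2 fun i =>
    (∑ j, outwardNormal T e j *
        MvPolynomial.eval x.ofLp (MvPolynomial.pderiv j (localPoly T (comp uh i)))) -
      MvPolynomial.eval x.ofLp (localPoly T ph) * outwardNormal T e i

open Classical in
/-- The jump `J_e`: the sum of the normal fluxes of the two elements that share `e`. -/
def Mesh.jump (M : Mesh d Ω) (e : Finset (Space d)) (uh : Space d → Space d)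
    (ph : Space d → ℝ) : Space d → Space d :=
  fun x => ∑ T ∈ M.elems.filter (fun T => e ⊆ T), normalFlux T e uh ph x

/-- The `L²(e)` norm on an edge/face, with respect to the `(d-1)`-dimensional surface measure. -/
def faceNorm (e : Finset (Space d)) (f : Space d → Space d) : ℝ :=
  lpNorm f 2 ((Measure.euclideanHausdorffMeasure (d - 1)).restrict (hull e))

/-- The local error indicator `η_T`. -/
def Mesh.indicator (M : Mesh d Ω) (T : Finset (Space d)) (uh : Space d → Space d)
    (ph : Space d → ℝ) : ℝ :=
  Real.sqrt (elemDiam T ^ 4 * l2Norm (hull T) (elemResidual T uh ph) ^ 2 +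
    elemDiam T ^ 2 * l2Norm (hull T) (elemDiv T uh) ^ 2 +
    1 / 2 * ∑ e ∈ M.interiorFaces T, elemDiam T ^ 3 * faceNorm e (M.jump e uh ph) ^ 2)

/-- `W ⊆ H¹(Ω)ᵈ` is a velocity space of piecewise polynomials of degree at most `k`. -/
def Mesh.IsVelocitySpace (M : Mesh d Ω) (k : ℕ) (W : Submodule ℝ (Space d → Space d)) : Prop :=
  ∀ v ∈ W, VecMemH1 Ω v ∧ ∀ i, M.IsPiecewisePoly k (comp v i)

/-- `Q ⊆ L²₀(Ω)` is a pressure space of piecewise polynomials of degree at most `k`. -/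
def Mesh.IsPressureSpace (M : Mesh d Ω) (k : ℕ) (Q : Submodule ℝ (Space d → ℝ)) : Prop :=
  ∀ q ∈ Q, MemL20 Ω q ∧ M.IsPiecewisePoly k q

/-- `(u_h, p_h) ∈ W × Q` solves the discrete Stokes problem with boundary values those of
`Eg`; the discrete test velocities are `W ∩ H¹₀(Ω)ᵈ`. -/
structure IsDiscreteSolution (Ω : Set (Space d)) (W : Submodule ℝ (Space d → Space d))
    (Q : Submodule ℝ (Space d → ℝ)) (Eg uh : Space d → Space d) (ph : Space d → ℝ) : Prop where
  velocity_mem : uh ∈ W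
  pressure_mem : ph ∈ Q
  boundary : VecMemH10 Ω (uh - Eg)
  momentum : ∀ v ∈ W, VecMemH10 Ω v → gradForm Ω uh v - divForm Ω v ph = 0
  incompressible : ∀ q ∈ Q, divForm Ω uh q = 0

end Mesh

end StokesFEM

end

open StokesFEM

/-!
The indicator `η_T` is efficient because each of its three parts can be recovered by testing the
Stokes equations with a smooth field supported in the patch of `T`.

For such a field `v`, the residual `(∇u_h, ∇v) - (div v, p_h)` equals
`(u - u_h, Δv) + (p - p_h, div v)` (`IsStokesSolution.residual_eq`): one more integration by parts
has moved all derivatives onto `v`, which is why only `‖u - u_h‖₀` and `‖p - p_h‖₋₁` occur, at the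
price of second derivatives of `v`. On the other hand, integrating by parts elementwise turns the
residual into the sum of the integrals of `(-Δu_h + ∇p_h) · v` over the elements and of `J_e · v`
over the interior faces (`residualOn_eq`). So it suffices to choose `v` as a bubble function times
the polynomial that is to be bounded. For the divergence, `div u = 0` gives
`(div u_h, v) = (u - u_h, ∇v)` for scalar `v`, so that here only first derivatives of `v` occur.

The bubbles live on balls instead of on reference simplices. By shape regularity an element contains
a ball of radius comparable with `h_T`, and a smooth cut-off on it, multiplied by the components of
`-Δu_h + ∇p_h` or by `div u_h`, gives an admissible test field (`exists_interior_bubbles`). Near the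
barycentre of an interior face, its two elements fill the two halves of a ball of radius comparable
with `h_T` (`Mesh.ShapeRegular.mem_hull_of_inner_nonpos`), since the barycentric coordinates vary by
at most a multiple of `1 / h_T`. The bubble on this ball is the cut-off times the extension of
`J_e` that is constant in the normal direction (`exists_face_bubbles`), and the elementwise
integration by parts is the divergence theorem on the two half-spaces (`integral_pd_halfSpace`),
with no need of Gauss' theorem on simplices.

Polynomials of bounded degree are determined by finitely many coefficients. Equivalence of norms
(`exists_pos_mul_sq_le_integral`, `exists_bound_polyFun`) and scaling give constants that do not
depend on the mesh, and allow the norm over an element or face to be replaced by one over a ball in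
it. The diameter of `Ω` bounds `h_T`, so that the lower order derivatives of `v` in the full
`H¹`-norm of `div v` are absorbed.
-/

namespace StokesFEM

/-! ### Square integrable functions -/

section L2

variable {α F : Type*} [MeasurableSpace α] [NormedAddCommGroup F] {μ : Measure α}

theorem lpNorm_two_sq {f : α → F} (hf : AEStronglyMeasurable f μ) :
    lpNorm f 2 μ ^ 2 = ∫ x, ‖f x‖ ^ 2 ∂μ := by
  rw [lpNorm_eq_integral_norm_rpow_toReal (by simp) (by simp) hf]
  have h0 : 0 ≤ ∫ x, ‖f x‖ ^ 2 ∂μ := integral_nonneg fun x => by positivity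
  simp only [ENNReal.toReal_ofNat, Real.rpow_ofNat]
  rw [← Real.rpow_natCast, ← Real.rpow_mul h0]
  norm_num

theorem abs_integral_mul_le_lpNorm_mul_lpNorm {f g : α → ℝ} (hf : MemLp f 2 μ)
    (hg : MemLp g 2 μ) : |∫ x, f x * g x ∂μ| ≤ lpNorm f 2 μ * lpNorm g 2 μ := by
  have hpq : (2 : ℝ).HolderConjugate 2 := by constructor <;> norm_num
  have h2 : ENNReal.ofReal 2 = 2 := by norm_num
  have h := integral_mul_le_Lp_mul_Lq_of_nonneg (μ := μ) hpq (f := fun x => ‖f x‖)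
    (g := fun x => ‖g x‖) (ae_of_all _ fun _ => norm_nonneg _) (ae_of_all _ fun _ => norm_nonneg _)
    (by rw [h2]; exact hf.norm) (by rw [h2]; exact hg.norm)
  rw [lpNorm_eq_integral_norm_rpow_toReal (by simp) (by simp) hf.1,
    lpNorm_eq_integral_norm_rpow_toReal (by simp) (by simp) hg.1]
  refine (norm_integral_le_integral_norm (μ := μ) (fun x => f x * g x)).trans ?_
  simp only [norm_mul, ENNReal.toReal_ofNat, ← one_div]
  exact h

theorem lpNorm_two_le_of_integral_le {f : α → F} (hf : AEStronglyMeasurable f μ) {B : ℝ}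
    (hB : 0 ≤ B) (h : ∫ x, ‖f x‖ ^ 2 ∂μ ≤ B ^ 2) : lpNorm f 2 μ ≤ B := by
  rw [← lpNorm_two_sq hf] at h
  exact (pow_le_pow_iff_left₀ lpNorm_nonneg hB two_ne_zero).1 h

/-- A function bounded by `K` and vanishing outside a set of measure at most `W²` has `L²` norm
at most `K W`. -/
theorem lpNorm_two_le_of_bounded {f : α → F} {s : Set α} (hs : MeasurableSet s)
    (hμs : μ s ≠ ⊤) (hf : AEStronglyMeasurable f μ) {K W : ℝ} (hK : 0 ≤ K) (hW : 0 ≤ W)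
    (hsW : μ.real s ≤ W ^ 2) (hb : ∀ x, ‖f x‖ ≤ K) (hz : ∀ x ∉ s, f x = 0) :
    lpNorm f 2 μ ≤ K * W := by
  refine lpNorm_two_le_of_integral_le hf (by positivity) ?_
  have h1 : ∫ x, ‖f x‖ ^ 2 ∂μ ≤ ∫ x, s.indicator (fun _ => K ^ 2) x ∂μ := by
    refine integral_mono_of_nonneg (ae_of_all _ fun x => by positivity) ?_ (ae_of_all _ fun x => ?_)
    · exact (integrable_indicator_iff hs).2 (integrableOn_const hμs)
    · by_cases hx : x ∈ s
      · simpa [hx] using pow_le_pow_left₀ (norm_nonneg _) (hb x) 2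
      · simp [hx, hz x hx]
  refine h1.trans ?_
  rw [integral_indicator hs, setIntegral_const, smul_eq_mul, mul_pow, mul_comm]
  exact mul_le_mul_of_nonneg_left hsW (by positivity)

end L2

/-! ### Test functions and weak derivatives -/

section TestFunctions

variable {d : ℕ}

/-- The classical partial derivative `∂ᵢf`. -/
noncomputable def pd (i : Fin d) (f : Space d → ℝ) : Space d → ℝ :=
  fun x => fderiv ℝ f x (EuclideanSpace.single i 1)

theorem _root_.ContDiff.pd {f : Space d → ℝ} (hf : ContDiff ℝ ∞ f) (i : Fin d) :
    ContDiff ℝ ∞ (pd i f) :=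
  (hf.fderiv_right (m := ∞) (by simp)).clm_apply contDiff_const

theorem pd_add {f g : Space d → ℝ} (hf : ContDiff ℝ ∞ f) (hg : ContDiff ℝ ∞ g) (i : Fin d)
    (x : Space d) : pd i (fun x => f x + g x) x = pd i f x + pd i g x := by
  unfold pd
  rw [fderiv_fun_add (hf.differentiable (by simp) x) (hg.differentiable (by simp) x)]
  rfl

theorem pd_mul {f g : Space d → ℝ} (hf : ContDiff ℝ ∞ f) (hg : ContDiff ℝ ∞ g) (i : Fin d)
    (x : Space d) : pd i (fun x => f x * g x) x = pd i f x * g x + f x * pd i g x := by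
  unfold pd
  rw [fderiv_fun_mul (hf.differentiable (by simp) x) (hg.differentiable (by simp) x)]
  simp; ring

theorem pd_sum {ι : Type*} (s : Finset ι) {f : ι → Space d → ℝ} (hf : ∀ a, ContDiff ℝ ∞ (f a))
    (i : Fin d) : pd i (fun x => ∑ a ∈ s, f a x) = fun x => ∑ a ∈ s, pd i (f a) x := by
  funext x
  unfold pd
  rw [fderiv_fun_sum fun a _ => (hf a).differentiable (by simp) x]
  simp

theorem pd_const_mul {f : Space d → ℝ} (hf : ContDiff ℝ ∞ f) (c : ℝ) (i : Fin d) :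
    pd i (fun x => c * f x) = fun x => c * pd i f x := by
  funext x
  unfold pd
  rw [fderiv_const_mul (hf.differentiable (by simp) x)]
  simp

theorem tsupport_pd_subset (f : Space d → ℝ) (i : Fin d) : tsupport (pd i f) ⊆ tsupport f :=
  tsupport_fderiv_apply_subset ℝ _

namespace IsTestFunction

variable {U V : Set (Space d)} {φ ψ : Space d → ℝ}

theorem pd (h : IsTestFunction U φ) (i : Fin d) : IsTestFunction U (pd i φ) :=
  ⟨h.1.pd i, h.2.1.fderiv_apply ℝ _, (tsupport_pd_subset φ i).trans h.2.2⟩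

theorem mono (h : IsTestFunction U φ) (hUV : U ⊆ V) : IsTestFunction V φ :=
  ⟨h.1, h.2.1, h.2.2.trans hUV⟩

theorem mul_left (h : IsTestFunction U φ) {g : Space d → ℝ} (hg : ContDiff ℝ ∞ g) :
    IsTestFunction U (fun x => g x * φ x) :=
  ⟨hg.mul h.1, h.2.1.mul_left, (closure_mono (Function.support_mul_subset_right g φ)).trans h.2.2⟩

theorem zero : IsTestFunction U (fun _ => 0) :=
  ⟨contDiff_const, HasCompactSupport.zero, by
    rw [show (fun _ : Space d => (0 : ℝ)) = 0 from rfl, tsupport_zero]; exact Set.empty_subset _⟩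

theorem add (h : IsTestFunction U φ) (h' : IsTestFunction U ψ) :
    IsTestFunction U (fun x => φ x + ψ x) :=
  ⟨h.1.add h'.1, h.2.1.add h'.2.1,
    (tsupport_add φ ψ).trans (Set.union_subset h.2.2 h'.2.2)⟩

theorem sum {ι : Type*} (s : Finset ι) {f : ι → Space d → ℝ}
    (h : ∀ a, IsTestFunction U (f a)) : IsTestFunction U (fun x => ∑ a ∈ s, f a x) := by
  classical
  induction s using Finset.induction with
  | empty => simpa using zero
  | insert a s ha ih => simpa [Finset.sum_insert ha] using (h a).add ih

theorem memLp (h : IsTestFunction U φ) (p : ENNReal) (μ : Measure (Space d))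
    [IsFiniteMeasureOnCompacts μ] : MemLp φ p μ :=
  h.1.continuous.memLp_of_hasCompactSupport h.2.1

theorem eq_zero_of_notMem (h : IsTestFunction U φ) {x : Space d} (hx : x ∉ U) : φ x = 0 :=
  image_eq_zero_of_notMem_tsupport fun hx' => hx (h.2.2 hx')

theorem setIntegral_mul_eq_of_subset (h : IsTestFunction U φ) (hUV : U ⊆ V)
    (hV : MeasurableSet V) (g : Space d → ℝ) :
    ∫ x in V, g x * φ x = ∫ x in U, g x * φ x :=
  setIntegral_eq_of_subset_of_forall_sdiff_eq_zero hV hUV fun x hx => by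
    rw [h.eq_zero_of_notMem hx.2, mul_zero]

theorem setIntegral_mul_eq_integral (h : IsTestFunction U φ) (g : Space d → ℝ) :
    ∫ x in U, g x * φ x = ∫ x, g x * φ x :=
  setIntegral_eq_integral_of_forall_compl_eq_zero fun x hx => by
    rw [h.eq_zero_of_notMem hx, mul_zero]

/-- A smooth function has its classical partial derivatives as weak ones. -/
theorem integral_mul_pd (h : IsTestFunction U φ) {g : Space d → ℝ} (hg : ContDiff ℝ ∞ g)
    (i : Fin d) : ∫ x in U, g x * StokesFEM.pd i φ x = -∫ x in U, StokesFEM.pd i g x * φ x := by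
  rw [(h.pd i).setIntegral_mul_eq_integral, h.setIntegral_mul_eq_integral]
  refine integral_mul_fderiv_eq_neg_fderiv_mul_of_integrable ?_ ?_ ?_ ?_ ?_
  · exact ((hg.pd i).continuous.mul h.1.continuous).integrable_of_hasCompactSupport h.2.1.mul_left
  · exact (hg.continuous.mul (h.pd i).1.continuous).integrable_of_hasCompactSupport
      (h.pd i).2.1.mul_left
  · exact (hg.continuous.mul h.1.continuous).integrable_of_hasCompactSupport h.2.1.mul_left
  · exact fun x _ => hg.differentiable (by simp) x
  · exact fun x _ => h.1.differentiable (by simp) x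

end IsTestFunction

variable {U V Ω : Set (Space d)}

/-- Locally integrable functions with the same integrals against test functions agree. -/
theorem ae_eq_of_integral_mul_test {f g : Space d → ℝ} (hV : IsOpen V)
    (hf : LocallyIntegrableOn f V) (hg : LocallyIntegrableOn g V)
    (h : ∀ φ, IsTestFunction V φ → ∫ x in V, f x * φ x = ∫ x in V, g x * φ x) :
    ∀ᵐ x ∂(volume.restrict V), f x = g x := by
  rw [ae_restrict_iff' hV.measurableSet]
  have key := hV.ae_eq_zero_of_integral_contDiff_smul_eq_zero (hf.sub hg) ?_
  · filter_upwards [key] with x hx hxV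
    exact sub_eq_zero.1 (hx hxV)
  · intro φ h1 h2 h3
    have hφ : IsTestFunction V φ := ⟨h1, h2, h3⟩
    have int : ∀ f : Space d → ℝ, LocallyIntegrableOn f V → Integrable (fun x => f x * φ x) := by
      intro f hf
      have h4 : IntegrableOn (fun x => f x * φ x) (tsupport φ) :=
        (hf.integrableOn_compact_subset h3 h2).mul_continuousOn h1.continuous.continuousOn h2
      refine (integrableOn_iff_integrable_of_support_subset ?_).1 h4
      exact (Function.support_mul_subset_right f φ).trans (subset_tsupport φ)
    have e : ∀ x, φ x • (f - g) x = f x * φ x - g x * φ x := by intro x; simp; ring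
    simp_rw [e]
    rw [integral_sub (int f hf) (int g hg), ← hφ.setIntegral_mul_eq_integral f,
      ← hφ.setIntegral_mul_eq_integral g, h φ hφ, sub_self]

theorem MemH1.hasWeakPartial {u : Space d → ℝ} (hu : MemH1 Ω u) (i : Fin d) :
    HasWeakPartial Ω i u (weakPartial Ω i u) := by
  unfold weakPartial
  rw [dif_pos (hu.2 i)]
  exact (hu.2 i).choose_spec

theorem locallyIntegrableOn_of_memLp {f : Space d → ℝ} (hΩ : IsOpen Ω) (hVΩ : V ⊆ Ω)
    (hf : MemLp f 2 (volume.restrict Ω)) : LocallyIntegrableOn f V := by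
  have h1 : LocallyIntegrable f (volume.restrict Ω) := hf.locallyIntegrable (by norm_num)
  have h2 : LocallyIntegrableOn f Ω := by
    intro x hx
    obtain ⟨s, hs, hs'⟩ := h1 x
    refine ⟨s ∩ Ω, ?_, ?_⟩
    · exact Filter.inter_mem (mem_nhdsWithin_of_mem_nhds hs) self_mem_nhdsWithin
    · rw [IntegrableOn, Measure.restrict_restrict' hΩ.measurableSet] at hs'
      exact hs'
  exact h2.mono_set hVΩ

/-- On an open set on which `u` coincides with a smooth function, its weak partial derivative is
the classical one. -/
theorem MemH1.weakPartial_ae_eq_pd {u g : Space d → ℝ} (hΩ : IsOpen Ω) (hV : IsOpen V)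
    (hVΩ : V ⊆ Ω) (hu : MemH1 Ω u) (hg : ContDiff ℝ ∞ g) (hug : ∀ x ∈ V, u x = g x) (i : Fin d) :
    ∀ᵐ x ∂(volume.restrict V), weakPartial Ω i u x = pd i g x := by
  refine ae_eq_of_integral_mul_test hV (locallyIntegrableOn_of_memLp hΩ hVΩ (hu.hasWeakPartial i).1)
    ((hg.pd i).continuous.locallyIntegrable.locallyIntegrableOn _) fun φ hφ => ?_
  have h1 := (hu.hasWeakPartial i).2 φ (hφ.mono hVΩ)
  rw [hφ.setIntegral_mul_eq_of_subset hVΩ hΩ.measurableSet] at h1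
  have h2 := (hφ.pd i).setIntegral_mul_eq_of_subset hVΩ hΩ.measurableSet u
  have h3 : ∫ x in V, u x * pd i φ x = ∫ x in V, g x * pd i φ x :=
    setIntegral_congr_fun hV.measurableSet fun x hx => by simp only [hug x hx]
  have h4 := hφ.integral_mul_pd hg i
  change ∫ x in Ω, u x * pd i φ x = _ at h1
  linarith

theorem IsTestFunction.memH1 {φ : Space d → ℝ} (h : IsTestFunction Ω φ) : MemH1 Ω φ :=
  ⟨h.memLp 2 _, fun i => ⟨StokesFEM.pd i φ, (h.pd i).memLp 2 _, fun _ hψ => hψ.integral_mul_pd h.1 i⟩⟩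

theorem IsTestFunction.weakPartial_ae_eq {φ : Space d → ℝ} (hΩ : IsOpen Ω)
    (h : IsTestFunction Ω φ) (i : Fin d) :
    weakPartial Ω i φ =ᵐ[volume.restrict Ω] StokesFEM.pd i φ :=
  h.memH1.weakPartial_ae_eq_pd hΩ hΩ subset_rfl h.1 (fun _ _ => rfl) i

theorem lpNorm_two_congr {α : Type*} [MeasurableSpace α] {μ : Measure α} {f g : α → ℝ}
    (h : f =ᵐ[μ] g) : lpNorm f 2 μ = lpNorm g 2 μ := by
  by_cases hf : AEStronglyMeasurable f μ
  · rw [← toReal_eLpNorm hf, ← toReal_eLpNorm (hf.congr h), eLpNorm_congr_ae h]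
  · rw [lpNorm_of_not_aestronglyMeasurable hf,
      lpNorm_of_not_aestronglyMeasurable fun hg => hf (hg.congr h.symm)]

theorem IsTestFunction.h1Norm_eq {φ : Space d → ℝ} (hΩ : IsOpen Ω) (h : IsTestFunction Ω φ) :
    h1Norm Ω φ = Real.sqrt (l2Norm Ω φ ^ 2 + ∑ i, l2Norm Ω (StokesFEM.pd i φ) ^ 2) := by
  unfold h1Norm l2Norm
  simp_rw [lpNorm_two_congr (h.weakPartial_ae_eq hΩ _)]

theorem IsTestFunction.memH10 {φ : Space d → ℝ} (hΩ : IsOpen Ω) (h : IsTestFunction Ω φ) :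
    MemH10 Ω φ := by
  refine ⟨h.memH1, fun ε hε => ⟨φ, h, ?_⟩⟩
  have h0 : IsTestFunction Ω (φ - φ) := by rw [sub_self]; exact IsTestFunction.zero
  have hz : ∀ i : Fin d, StokesFEM.pd i (0 : Space d → ℝ) = 0 := by
    intro i; funext x; simp [StokesFEM.pd]
  rw [h0.h1Norm_eq hΩ, sub_self]
  simpa [l2Norm, hz] using hε

end TestFunctions

/-! ### The dual norm and the residual functional -/

section Residual

variable {d : ℕ} {U Ω : Set (Space d)}

theorem h1Norm_nonneg (U : Set (Space d)) (u : Space d → ℝ) : 0 ≤ h1Norm U u :=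
  Real.sqrt_nonneg _

theorem l2Norm_le_h1Norm (u : Space d → ℝ) : l2Norm U u ≤ h1Norm U u := by
  unfold h1Norm
  refine Real.le_sqrt_of_sq_le ?_
  have : 0 ≤ ∑ i, l2Norm U (weakPartial U i u) ^ 2 := Finset.sum_nonneg fun _ _ => sq_nonneg _
  linarith

theorem le_hNegOneNorm {p q : Space d → ℝ} (hp : MemLp p 2 (volume.restrict U))
    (hq : MemH10 U q) (hq0 : 0 < h1Norm U q) :
    (∫ x in U, p x * q x) / h1Norm U q ≤ hNegOneNorm U p := by
  refine le_csSup ⟨l2Norm U p, ?_⟩ ⟨q, hq, hq0, rfl⟩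
  rintro r ⟨q, hq, hq0, rfl⟩
  rw [div_le_iff₀ hq0]
  calc ∫ x in U, p x * q x ≤ |∫ x in U, p x * q x| := le_abs_self _
    _ ≤ l2Norm U p * l2Norm U q := abs_integral_mul_le_lpNorm_mul_lpNorm hp hq.1.1
    _ ≤ l2Norm U p * h1Norm U q :=
      mul_le_mul_of_nonneg_left (l2Norm_le_h1Norm q) lpNorm_nonneg

theorem IsTestFunction.neg {φ : Space d → ℝ} (h : IsTestFunction U φ) :
    IsTestFunction U (fun x => -φ x) := by
  simpa using h.mul_left (contDiff_const (c := (-1 : ℝ)))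

theorem IsTestFunction.h1Norm_neg {φ : Space d → ℝ} (hU : IsOpen U) (h : IsTestFunction U φ) :
    h1Norm U (fun x => -φ x) = h1Norm U φ := by
  rw [h.h1Norm_eq hU, h.neg.h1Norm_eq hU]
  have e : ∀ i : Fin d, StokesFEM.pd i (fun x => -φ x) = -StokesFEM.pd i φ := by
    intro i; funext x; simp [StokesFEM.pd, fderiv_fun_neg]
  have e' : (fun x => -φ x) = -φ := rfl
  simp only [l2Norm, e]
  rw [e', lpNorm_neg]
  simp

theorem IsTestFunction.abs_integral_mul_le {p q : Space d → ℝ} (hU : IsOpen U)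
    (hp : MemLp p 2 (volume.restrict U)) (hq : IsTestFunction U q) :
    |∫ x in U, p x * q x| ≤ hNegOneNorm U p * h1Norm U q := by
  rcases (h1Norm_nonneg U q).eq_or_lt with h0 | h0
  · have h1 := abs_integral_mul_le_lpNorm_mul_lpNorm hp (hq.memLp 2 _)
    have h2 : lpNorm q 2 (volume.restrict U) = 0 :=
      le_antisymm ((l2Norm_le_h1Norm q).trans h0.symm.le) lpNorm_nonneg
    rw [h2, mul_zero] at h1
    rwa [← h0, mul_zero]
  · have h1 := le_hNegOneNorm hp (hq.memH10 hU) h0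
    have h2 := le_hNegOneNorm hp (hq.neg.memH10 hU) (by rwa [hq.h1Norm_neg hU])
    rw [hq.h1Norm_neg hU] at h2
    simp only [mul_neg, integral_neg] at h2
    rw [div_le_iff₀ h0] at h1 h2
    exact abs_le'.2 ⟨h1, h2⟩

theorem hNegOneNorm_nonneg {p : Space d → ℝ} (hU : IsOpen U)
    (hp : MemLp p 2 (volume.restrict U)) : 0 ≤ hNegOneNorm U p := by
  by_cases h : ∃ q, IsTestFunction U q ∧ 0 < h1Norm U q
  · obtain ⟨q, hq, h0⟩ := h
    exact nonneg_of_mul_nonneg_left ((abs_nonneg _).trans (hq.abs_integral_mul_le hU hp)) h0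
  · -- Then every element of `H¹₀(U)` has norm zero, and the supremum is over the empty set.
    push Not at h
    rcases U.eq_empty_or_nonempty with rfl | ⟨c, hc⟩
    · unfold hNegOneNorm
      refine Real.sSup_nonneg ?_
      rintro r ⟨q, -, -, rfl⟩
      simp
    · exfalso
      obtain ⟨f, hfU, hfc, hf, -, hf1⟩ := exists_contDiff_tsupport_subset (n := (⊤ : ℕ∞))
        (hU.mem_nhds hc)
      have hft : IsTestFunction U f := ⟨hf, hfc, hfU⟩
      have h0 : lpNorm f 2 (volume.restrict U) = 0 :=
        le_antisymm ((l2Norm_le_h1Norm f).trans (h f hft)) lpNorm_nonneg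
      have h1 := lpNorm_two_sq (hft.memLp 2 (volume.restrict U)).1
      have h2 : ∀ x, ‖f x‖ ^ 2 = f x * f x := fun x => by rw [Real.norm_eq_abs, sq_abs, sq]
      simp_rw [h2] at h1
      rw [h0, hft.setIntegral_mul_eq_integral, zero_pow two_ne_zero, eq_comm,
        integral_eq_zero_iff_of_nonneg (fun x => mul_self_nonneg _)
          ((hf.continuous.mul hf.continuous).integrable_of_hasCompactSupport hfc.mul_left)] at h1
      have h3 := congrFun (Continuous.ae_eq_iff_eq volume (f := fun x => f x * f x)
        (hf.continuous.mul hf.continuous) continuous_const |>.1 h1) c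
      rw [hf1] at h3
      exact one_ne_zero ((mul_one (1 : ℝ)).symm.trans h3)

/-- The residual `(∇u_h, ∇v) - (div v, p_h)` at a smooth test field `v`. -/
noncomputable def residual (Ω : Set (Space d)) (uh : Space d → Space d) (ph : Space d → ℝ)
    (v : Fin d → Space d → ℝ) : ℝ :=
  (∑ i, ∑ j, ∫ x in Ω, weakPartial Ω j (comp uh i) x * pd j (v i) x) -
    ∫ x in Ω, ph x * ∑ i, pd i (v i) x

theorem memLp_of_comp {μ : Measure (Space d)} {f : Space d → Space d}
    (h : ∀ i, MemLp (comp f i) 2 μ) : MemLp f 2 μ :=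
  MemLp.of_eval_piLp h

theorem lpNorm_comp_le {μ : Measure (Space d)} {f : Space d → Space d} (hf : MemLp f 2 μ)
    (i : Fin d) : lpNorm (comp f i) 2 μ ≤ lpNorm f 2 μ := by
  have h1 := lpNorm_mono_real (f := comp f i) hf.norm fun x => PiLp.norm_apply_le (f x) i
  rwa [lpNorm_norm hf.1] at h1

/-- Testing the Stokes equations with a smooth field and integrating by parts once more moves all
derivatives from the errors `u - u_h` and `p - p_h` to the test field. -/
theorem IsStokesSolution.residual_eq {Eg u uh : Space d → Space d} {p ph : Space d → ℝ}
    (hsol : IsStokesSolution Ω Eg u p) (hΩ : IsOpen Ω) (hUΩ : U ⊆ Ω)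
    (huh : VecMemH1 Ω uh) (hph : MemLp ph 2 (volume.restrict Ω)) {v : Fin d → Space d → ℝ}
    (hv : ∀ i, IsTestFunction U (v i)) :
    residual Ω uh ph v =
      (∑ i, ∫ x in U, comp (u - uh) i x * ∑ j, pd j (pd j (v i)) x) +
        ∫ x in U, (p - ph) x * ∑ i, pd i (v i) x := by
  have hvΩ : ∀ i, IsTestFunction Ω (v i) := fun i => (hv i).mono hUΩ
  have hm := hsol.momentum (fun x => WithLp.toLp 2 fun i => v i x) fun i => (hvΩ i).memH10 hΩ
  have hdiv : IsTestFunction U (fun x => ∑ i, pd i (v i) x) :=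
    IsTestFunction.sum _ fun i => (hv i).pd i
  -- integration by parts in the two gradient forms
  have hparts : ∀ {w : Space d → Space d}, VecMemH1 Ω w → ∀ i j,
      ∫ x in Ω, weakPartial Ω j (comp w i) x * pd j (v i) x =
        -∫ x in Ω, comp w i x * pd j (pd j (v i)) x := by
    intro w hw i j
    rw [eq_neg_iff_add_eq_zero, ← neg_eq_iff_add_eq_zero, eq_comm]
    exact ((hw i).hasWeakPartial j).2 _ ((hvΩ i).pd j)
  have hgrad : gradForm Ω u (fun x => WithLp.toLp 2 fun i => v i x) =
      ∑ i, ∑ j, -∫ x in Ω, comp u i x * pd j (pd j (v i)) x := by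
    unfold gradForm
    refine Finset.sum_congr rfl fun i _ => Finset.sum_congr rfl fun j _ => ?_
    rw [← hparts hsol.velocity_mem]
    refine integral_congr_ae ?_
    filter_upwards [(hvΩ i).weakPartial_ae_eq hΩ j] with x hx
    exact congrArg _ hx
  have hdivf : divForm Ω (fun x => WithLp.toLp 2 fun i => v i x) p =
      ∫ x in Ω, p x * ∑ i, pd i (v i) x := by
    unfold divForm weakDiv
    refine integral_congr_ae ?_
    filter_upwards [ae_all_iff.2 fun i => (hvΩ i).weakPartial_ae_eq hΩ i] with x hx
    rw [mul_comm]
    exact congrArg _ (Finset.sum_congr rfl fun i _ => hx i)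
  rw [hgrad, hdivf] at hm
  have h1 : ∀ i, ∫ x in U, comp (u - uh) i x * ∑ j, pd j (pd j (v i)) x =
      ∑ j, ((∫ x in Ω, comp u i x * pd j (pd j (v i)) x) -
        ∫ x in Ω, comp uh i x * pd j (pd j (v i)) x) := by
    intro i
    have ht : IsTestFunction U (fun x => ∑ j, pd j (pd j (v i)) x) :=
      IsTestFunction.sum _ fun j => ((hv i).pd j).pd j
    rw [← ht.setIntegral_mul_eq_of_subset hUΩ hΩ.measurableSet]
    simp_rw [Finset.mul_sum]
    have hint : ∀ {w : Space d → Space d}, VecMemH1 Ω w → ∀ j,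
        Integrable (fun x => comp w i x * pd j (pd j (v i)) x) (volume.restrict Ω) :=
      fun hw j => (hw i).1.integrable_mul ((((hvΩ i).pd j).pd j).memLp 2 _)
    have hs : ∀ j x, comp (u - uh) i x * pd j (pd j (v i)) x =
        comp u i x * pd j (pd j (v i)) x - comp uh i x * pd j (pd j (v i)) x := by
      intro j x; simp only [comp, Pi.sub_apply, PiLp.sub_apply]; ring
    simp_rw [hs]
    rw [integral_finsetSum (f := fun j x => comp u i x * pd j (pd j (v i)) x -
      comp uh i x * pd j (pd j (v i)) x) _
      fun j _ => (hint hsol.velocity_mem j).sub (hint huh j)]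
    exact Finset.sum_congr rfl fun j _ => integral_sub (hint hsol.velocity_mem j) (hint huh j)
  have h2 : ∫ x in U, (p - ph) x * ∑ i, pd i (v i) x =
      (∫ x in Ω, p x * ∑ i, pd i (v i) x) - ∫ x in Ω, ph x * ∑ i, pd i (v i) x := by
    rw [← hdiv.setIntegral_mul_eq_of_subset hUΩ hΩ.measurableSet, ← integral_sub]
    · exact integral_congr_ae (ae_of_all _ fun x => by simp only [Pi.sub_apply]; ring)
    · exact hsol.pressure_mem.1.integrable_mul ((hdiv.mono hUΩ).memLp 2 _)
    · exact hph.integrable_mul ((hdiv.mono hUΩ).memLp 2 _)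
  unfold residual
  rw [Finset.sum_congr rfl fun i _ => h1 i, h2,
    Finset.sum_congr rfl fun i _ => Finset.sum_congr rfl fun j _ => hparts huh i j]
  simp only [Finset.sum_sub_distrib, Finset.sum_neg_distrib] at hm ⊢
  linarith

/-- The residual at a test field with derivatives up to second order bounded by `K` and support of
measure at most `W²` is controlled by the local errors. -/
theorem IsStokesSolution.abs_residual_le {Eg u uh : Space d → Space d} {p ph : Space d → ℝ}
    (hsol : IsStokesSolution Ω Eg u p) (hΩ : IsOpen Ω) (hU : IsOpen U) (hUΩ : U ⊆ Ω)
    (huh : VecMemH1 Ω uh) (hph : MemLp ph 2 (volume.restrict Ω)) {v : Fin d → Space d → ℝ}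
    (hv : ∀ i, IsTestFunction U (v i)) {s : Set (Space d)} (hs : MeasurableSet s)
    (hμs : volume s ≠ ⊤) {K W : ℝ} (hK : 0 ≤ K) (hW : 0 ≤ W) (hsW : volume.real s ≤ W ^ 2)
    (hvs : ∀ i, tsupport (v i) ⊆ s)
    (h1 : ∀ i j x, |pd j (v i) x| ≤ K) (h2 : ∀ i j l x, |pd l (pd j (v i)) x| ≤ K) :
    |residual Ω uh ph v| ≤
      (2 * d ^ 2 + d) * K * W * (l2Norm U (u - uh) + hNegOneNorm U (p - ph)) := by
  have hp : MemLp (p - ph) 2 (volume.restrict U) :=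
    (hsol.pressure_mem.1.sub hph).mono_measure (Measure.restrict_mono hUΩ le_rfl)
  have hu : MemLp (u - uh) 2 (volume.restrict U) := by
    refine memLp_of_comp fun i => ?_
    exact ((hsol.velocity_mem i).1.sub (huh i).1).mono_measure (Measure.restrict_mono hUΩ le_rfl)
  have hμ : volume.restrict U s ≠ ⊤ ∧ (volume.restrict U).real s ≤ W ^ 2 :=
    ⟨((Measure.restrict_apply_le _ _).trans_lt hμs.lt_top).ne,
      (ENNReal.toReal_mono hμs (Measure.restrict_apply_le _ _)).trans hsW⟩
  have hN := hNegOneNorm_nonneg hU hp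
  have hL : 0 ≤ l2Norm U (u - uh) := lpNorm_nonneg
  have hs1 : ∀ i j, ∀ x ∉ s, pd j (v i) x = 0 := fun i j x hx =>
    image_eq_zero_of_notMem_tsupport fun h => hx (hvs i (tsupport_pd_subset _ j h))
  have hs2 : ∀ i j l, ∀ x ∉ s, pd l (pd j (v i)) x = 0 := fun i j l x hx =>
    image_eq_zero_of_notMem_tsupport fun h =>
      hx (hvs i (tsupport_pd_subset _ j (tsupport_pd_subset _ l h)))
  have hsum : ∀ f : Fin d → ℝ, (∀ i, |f i| ≤ K) → ‖∑ i, f i‖ ≤ d * K := by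
    intro f hf
    refine (norm_sum_le _ _).trans ((Finset.sum_le_sum fun i _ => hf i).trans ?_)
    simp
  have hlap : ∀ i, |∫ x in U, comp (u - uh) i x * ∑ j, pd j (pd j (v i)) x| ≤
      l2Norm U (u - uh) * (d * K * W) := by
    intro i
    have ht : IsTestFunction U (fun x => ∑ j, pd j (pd j (v i)) x) :=
      IsTestFunction.sum _ fun j => ((hv i).pd j).pd j
    refine (abs_integral_mul_le_lpNorm_mul_lpNorm (hu.eval_piLp i) (ht.memLp 2 _)).trans ?_
    refine mul_le_mul (lpNorm_comp_le hu i) ?_ lpNorm_nonneg hL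
    refine lpNorm_two_le_of_bounded hs ?_ (ht.memLp 2 _).1 (by positivity) hW ?_
      (fun x => hsum _ fun j => h2 i j j x) fun x hx => Finset.sum_eq_zero fun j _ => hs2 i j j x hx
    · exact hμ.1
    · exact hμ.2
  have hdiv : IsTestFunction U (fun x => ∑ i, pd i (v i) x) :=
    IsTestFunction.sum _ fun i => (hv i).pd i
  have hh1 : h1Norm U (fun x => ∑ i, pd i (v i) x) ≤ (d + d ^ 2) * K * W := by
    rw [hdiv.h1Norm_eq hU]
    have hb : l2Norm U (fun x => ∑ i, pd i (v i) x) ≤ d * K * W :=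
      lpNorm_two_le_of_bounded hs hμ.1 (hdiv.memLp 2 _).1 (by positivity) hW hμ.2
        (fun x => hsum _ fun j => h1 j j x) fun x hx => Finset.sum_eq_zero fun j _ => hs1 j j x hx
    have hb' : ∀ l, l2Norm U (pd l fun x => ∑ i, pd i (v i) x) ≤ d * K * W := by
      intro l
      refine lpNorm_two_le_of_bounded hs hμ.1 ((hdiv.pd l).memLp 2 _).1 (by positivity) hW hμ.2 ?_ ?_
      · intro x
        rw [pd_sum _ fun i => ((hv i).pd i).1]
        exact hsum _ fun j => h2 j j l x
      · intro x hx
        rw [pd_sum _ fun i => ((hv i).pd i).1]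
        exact Finset.sum_eq_zero fun j _ => hs2 j j l x hx
    refine Real.sqrt_le_iff.2 ⟨by positivity, ?_⟩
    have e1 : l2Norm U (fun x => ∑ i, pd i (v i) x) ^ 2 ≤ (d * K * W) ^ 2 :=
      pow_le_pow_left₀ lpNorm_nonneg hb 2
    have e2 : ∑ l, l2Norm U (pd l fun x => ∑ i, pd i (v i) x) ^ 2 ≤ d * (d * K * W) ^ 2 := by
      refine (Finset.sum_le_sum fun l _ => pow_le_pow_left₀ lpNorm_nonneg (hb' l) 2).trans ?_
      simp
    have e3 : 0 ≤ (d : ℝ) * (d * K * W) ^ 2 := by positivity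
    have e4 : 0 ≤ (d : ℝ) ^ 2 * (d * K * W) ^ 2 := by positivity
    nlinarith
  rw [hsol.residual_eq hΩ hUΩ huh hph hv]
  have f1 := Finset.abs_sum_le_sum_abs
    (fun i => ∫ x in U, comp (u - uh) i x * ∑ j, pd j (pd j (v i)) x) Finset.univ
  have f2 := Finset.sum_le_sum fun i (_ : i ∈ Finset.univ) => hlap i
  simp only [Finset.sum_const, Finset.card_univ, Fintype.card_fin, nsmul_eq_mul] at f2
  have f3 := (hdiv.abs_integral_mul_le hU hp).trans (mul_le_mul_of_nonneg_left hh1 hN)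
  have f4 := abs_add_le (∑ i, ∫ x in U, comp (u - uh) i x * ∑ j, pd j (pd j (v i)) x)
    (∫ x in U, (p - ph) x * ∑ i, pd i (v i) x)
  have f5 : 0 ≤ (d : ℝ) * K * W * l2Norm U (u - uh) := by positivity
  have f6 : 0 ≤ (d : ℝ) ^ 2 * K * W * l2Norm U (u - uh) := by positivity
  have f7 : 0 ≤ (d : ℝ) ^ 2 * K * W * hNegOneNorm U (p - ph) := by positivity
  nlinarith

end Residual

/-! ### Polynomials of bounded degree -/

section Polynomials

variable {d n k : ℕ}

theorem contDiff_eval (P : MvPolynomial (Fin d) ℝ) :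
    ContDiff ℝ ∞ (fun x : Space d => MvPolynomial.eval x.ofLp P) := by
  induction P using MvPolynomial.induction_on with
  | C a => simpa using contDiff_const
  | add p q hp hq => simpa using hp.add hq
  | mul_X p i hp =>
    simp only [map_mul, MvPolynomial.eval_X]
    exact hp.mul (by fun_prop)

theorem pd_eval (P : MvPolynomial (Fin d) ℝ) (i : Fin d) :
    pd i (fun x : Space d => MvPolynomial.eval x.ofLp P) =
      fun x => MvPolynomial.eval x.ofLp (MvPolynomial.pderiv i P) := by
  funext x
  induction P using MvPolynomial.induction_on with
  | C a => simp [pd]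
  | add p q hp hq =>
    simp only [map_add, pd_add (contDiff_eval p) (contDiff_eval q), hp, hq]
  | mul_X p j hp =>
    have hj : ContDiff ℝ ∞ (fun x : Space d => x j) := by fun_prop
    have h2 : pd i (fun x : Space d => x j) x = if j = i then 1 else 0 := by
      have : fderiv ℝ (fun x : Space d => x j) x = EuclideanSpace.proj j :=
        (EuclideanSpace.proj (𝕜 := ℝ) j).fderiv
      simp [pd, this]
    simp only [map_mul, MvPolynomial.eval_X, pd_mul (contDiff_eval p) hj, hp, h2,
      Derivation.leibniz, smul_eq_mul, map_add, MvPolynomial.pderiv_X]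
    by_cases hij : j = i
    · subst hij; simp; ring
    · simp [hij]; ring

theorem totalDegree_pderiv_le (P : MvPolynomial (Fin d) ℝ) (i : Fin d) :
    (MvPolynomial.pderiv i P).totalDegree ≤ P.totalDegree := by
  conv_lhs => rw [P.as_sum, map_sum]
  refine MvPolynomial.totalDegree_finsetSum_le fun s hs => ?_
  rw [MvPolynomial.pderiv_monomial]
  refine (MvPolynomial.totalDegree_monomial_le _ _).trans ?_
  refine le_trans ?_ (MvPolynomial.le_totalDegree hs)
  exact Finsupp.degree_mono tsub_le_self

/-- A polynomial is determined by its values on a nonempty open set. -/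
theorem eq_of_eval_eq_on_open {P Q : MvPolynomial (Fin d) ℝ} {V : Set (Space d)} (hV : IsOpen V)
    (hne : V.Nonempty)
    (h : ∀ x ∈ V, MvPolynomial.eval x.ofLp P = MvPolynomial.eval x.ofLp Q) : P = Q := by
  obtain ⟨c, hc⟩ := hne
  have hW : IsOpen ((WithLp.toLp 2 : (Fin d → ℝ) → Space d) ⁻¹' V) :=
    hV.preimage (PiLp.continuous_toLp 2 _)
  obtain ⟨ε, hε, hball⟩ := Metric.isOpen_iff.1 hW c.ofLp hc
  refine MvPolynomial.funext_set (fun i => Metric.ball (c i) ε) (fun i => ?_) fun x hx => ?_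
  · rw [Real.ball_eq_Ioo]
    exact Set.Ioo_infinite (by linarith)
  · rw [← ball_pi _ hε] at hx
    exact h (WithLp.toLp 2 x) (hball hx)

/-- The monomial with exponents `α`, all at most `k`. -/
noncomputable def monomialFun (α : Fin n → Fin (k + 1)) (y : Space n) : ℝ :=
  ∏ i, y i ^ (α i : ℕ)

/-- The polynomial function with the coefficients `a`, of degree at most `k` in each variable. -/
noncomputable def polyFun (a : (Fin n → Fin (k + 1)) → ℝ) (y : Space n) : ℝ :=
  ∑ α, a α * monomialFun α y

theorem contDiff_monomialFun (α : Fin n → Fin (k + 1)) : ContDiff ℝ ∞ (monomialFun α) := by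
  unfold monomialFun
  exact contDiff_prod fun i _ => by fun_prop

theorem contDiff_polyFun (a : (Fin n → Fin (k + 1)) → ℝ) : ContDiff ℝ ∞ (polyFun a) := by
  unfold polyFun
  exact ContDiff.sum fun α _ => contDiff_const.mul (contDiff_monomialFun α)

theorem eq_zero_of_polyFun_eq_zero {a : (Fin n → Fin (k + 1)) → ℝ} {V : Set (Space n)}
    (hV : IsOpen V) (hne : V.Nonempty) (h : ∀ y ∈ V, polyFun a y = 0) : a = 0 := by
  classical
  let e : (Fin n → Fin (k + 1)) → (Fin n →₀ ℕ) :=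
    fun α => Finsupp.equivFunOnFinite.symm fun i => (α i : ℕ)
  have he : Function.Injective e := by
    intro α β hαβ
    funext i
    exact Fin.ext (DFunLike.congr_fun hαβ i)
  have hP : (∑ α, MvPolynomial.monomial (e α) (a α)) = 0 := by
    refine eq_of_eval_eq_on_open hV hne fun y hy => ?_
    rw [map_sum, map_zero, ← h y hy]
    refine Finset.sum_congr rfl fun α _ => ?_
    rw [MvPolynomial.eval_monomial, Finsupp.prod_fintype _ _ (by simp)]
    rfl
  funext β
  have h2 := congrArg (MvPolynomial.coeff (e β)) hP
  simpa [MvPolynomial.coeff_sum, MvPolynomial.coeff_monomial, he.eq_iff] using h2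

theorem exists_polyFun_eq_eval {P : MvPolynomial (Fin n) ℝ} (hP : P.totalDegree ≤ k) :
    ∃ a : (Fin n → Fin (k + 1)) → ℝ, ∀ y : Space n, MvPolynomial.eval y.ofLp P = polyFun a y := by
  classical
  have hlt : ∀ s ∈ P.support, ∀ i, s i < k + 1 := fun s hs i =>
    Nat.lt_succ_of_le (((Finsupp.le_degree i s).trans (MvPolynomial.le_totalDegree hs)).trans hP)
  refine ⟨fun α => P.coeff (Finsupp.equivFunOnFinite.symm fun i => (α i : ℕ)), fun y => ?_⟩
  rw [MvPolynomial.eval_eq', polyFun]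
  refine Finset.sum_of_injOn (fun s i => if h : s i < k + 1 then ⟨s i, h⟩ else 0) ?_ ?_ ?_ ?_
  · intro s hs t ht hst
    ext i
    have := congrFun hst i
    simpa [hlt s hs i, hlt t ht i] using this
  · intro s _; simp
  · intro α _ hα
    have : Finsupp.equivFunOnFinite.symm (fun i => (α i : ℕ)) ∉ P.support := by
      intro hmem
      refine hα ⟨_, hmem, ?_⟩
      funext i
      have hi := (α i).isLt
      simp [hi]
    simp [MvPolynomial.notMem_support_iff.1 this]
  · intro s hs
    have e : Finsupp.equivFunOnFinite.symm
        (fun i => ((if h : s i < k + 1 then (⟨s i, h⟩ : Fin (k + 1)) else 0 : Fin (k + 1)) : ℕ)) =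
        s := by
      ext i
      have hi := hlt s hs i
      simp only [Finsupp.equivFunOnFinite_symm_apply_apply, dif_pos hi]
    simp only [e, monomialFun]
    congr 1
    exact Finset.prod_congr rfl fun i _ => by simp only [dif_pos (hlt s hs i)]

/-- Polynomials of degree at most `k` pull back to such under affine maps. -/
theorem exists_polyFun_eq_eval_affine {P : MvPolynomial (Fin d) ℝ} (hP : P.totalDegree ≤ k)
    (c : Space d) (L : Space n →ₗ[ℝ] Space d) :
    ∃ a : (Fin n → Fin (k + 1)) → ℝ,
      ∀ y : Space n, MvPolynomial.eval (c + L y).ofLp P = polyFun a y := by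
  classical
  let f : Fin d → MvPolynomial (Fin n) ℝ := fun i =>
    MvPolynomial.C (c i) +
      ∑ j, MvPolynomial.C (L (EuclideanSpace.single j 1) i) * MvPolynomial.X j
  have hf : ∀ i, (f i).totalDegree ≤ 1 := by
    intro i
    refine (MvPolynomial.totalDegree_add _ _).trans (max_le (by simp) ?_)
    refine MvPolynomial.totalDegree_finsetSum_le fun j _ => ?_
    refine (MvPolynomial.totalDegree_mul _ _).trans ?_
    simp
  have hev : ∀ (y : Space n) i, MvPolynomial.eval y.ofLp (f i) = (c + L y) i := by
    intro y i
    have hy : y = ∑ j, y j • EuclideanSpace.single j (1 : ℝ) := by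
      ext l; simp [Pi.single_apply]
    conv_rhs => rw [hy]
    simp [f, mul_comm]
  have hdeg : (MvPolynomial.bind₁ f P).totalDegree ≤ k := by
    conv_lhs => rw [P.as_sum, map_sum]
    refine MvPolynomial.totalDegree_finsetSum_le fun s hs => ?_
    rw [MvPolynomial.bind₁_monomial]
    refine (MvPolynomial.totalDegree_mul _ _).trans ?_
    rw [MvPolynomial.totalDegree_C, zero_add]
    refine (MvPolynomial.totalDegree_finsetProd _ _).trans ?_
    refine le_trans (Finset.sum_le_sum fun i _ => (MvPolynomial.totalDegree_pow _ _).trans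
      (Nat.mul_le_mul_left (s i) (hf i))) ?_
    simpa [Finsupp.sum] using (MvPolynomial.le_totalDegree hs).trans hP
  obtain ⟨a, ha⟩ := exists_polyFun_eq_eval hdeg
  refine ⟨a, fun y => ?_⟩
  rw [← ha y]
  have h3 : (c + L y).ofLp = fun i => MvPolynomial.eval y.ofLp (f i) := by
    funext i; exact (hev y i).symm
  rw [h3]
  exact (MvPolynomial.eval₂Hom_bind₁ _ _ _ _).symm

theorem exists_bound_polyFun (n k : ℕ) (R : ℝ) :
    ∃ C : ℝ, 0 ≤ C ∧ ∀ (a : (Fin n → Fin (k + 1)) → ℝ) (y : Space n), ‖y‖ ≤ R →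
      |polyFun a y| ≤ C * ‖a‖ := by
  have h1 : ∀ α : Fin n → Fin (k + 1), ∃ B, ∀ y ∈ Metric.closedBall (0 : Space n) R,
      ‖monomialFun α y‖ ≤ B := fun α =>
    (isCompact_closedBall _ _).exists_bound_of_continuousOn
      (contDiff_monomialFun α).continuous.continuousOn
  choose B hB using h1
  refine ⟨∑ α, |B α|, Finset.sum_nonneg fun _ _ => abs_nonneg _, fun a y hy => ?_⟩
  refine (Finset.abs_sum_le_sum_abs _ _).trans ?_
  rw [Finset.sum_mul]
  refine Finset.sum_le_sum fun α _ => ?_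
  rw [abs_mul, mul_comm]
  exact mul_le_mul ((hB α y (by simpa using hy)).trans (le_abs_self _)) (norm_le_pi_norm a α)
    (abs_nonneg _) (abs_nonneg _)

/-- A continuous positive function that is homogeneous of degree two is bounded below by the
square of the norm. -/
theorem exists_pos_mul_sq_le {E : Type*} [NormedAddCommGroup E] [NormedSpace ℝ E]
    [FiniteDimensional ℝ E] {q : E → ℝ} (hq : Continuous q)
    (hhom : ∀ (t : ℝ) a, q (t • a) = t ^ 2 * q a) (hpos : ∀ a, a ≠ 0 → 0 < q a) :
    ∃ c : ℝ, 0 < c ∧ ∀ a, c * ‖a‖ ^ 2 ≤ q a := by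
  have hq0 : q 0 = 0 := by simpa using hhom 0 0
  rcases subsingleton_or_nontrivial E with hE | hE
  · exact ⟨1, one_pos, fun a => by simp [Subsingleton.elim a 0, hq0]⟩
  have : ProperSpace E := FiniteDimensional.proper ℝ E
  obtain ⟨b, hb, hmin⟩ := (isCompact_sphere (0 : E) 1).exists_isMinOn
    (NormedSpace.sphere_nonempty.2 zero_le_one) hq.continuousOn
  have hb0 : b ≠ 0 := by
    rintro rfl
    simp at hb
  refine ⟨q b, hpos b hb0, fun a => ?_⟩
  rcases eq_or_ne a 0 with rfl | ha
  · simp [hq0]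
  have hn : ‖a‖ ≠ 0 := norm_ne_zero_iff.2 ha
  have h1 : q b ≤ q (‖a‖⁻¹ • a) := hmin (by simp [norm_smul, hn])
  rw [hhom] at h1
  calc q b * ‖a‖ ^ 2 ≤ ‖a‖⁻¹ ^ 2 * q a * ‖a‖ ^ 2 := by gcongr
    _ = q a := by field_simp

/-- Weighted `L²` norms of polynomials dominate their coefficients. -/
theorem exists_pos_mul_sq_le_integral (k : ℕ) {χ : Space n → ℝ} (hχ : ContDiff ℝ ∞ χ)
    (hχc : HasCompactSupport χ) (hχ0 : ∀ y, 0 ≤ χ y) (hχ1 : 0 < χ 0) :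
    ∃ c : ℝ, 0 < c ∧ ∀ a : (Fin n → Fin (k + 1)) → ℝ,
      c * ‖a‖ ^ 2 ≤ ∫ y, χ y * polyFun a y ^ 2 := by
  have hcont : ∀ a : (Fin n → Fin (k + 1)) → ℝ, Continuous fun y => χ y * polyFun a y ^ 2 :=
    fun a => hχ.continuous.mul ((contDiff_polyFun a).continuous.pow 2)
  refine exists_pos_mul_sq_le ?_ ?_ ?_
  · have hexp : ∀ a : (Fin n → Fin (k + 1)) → ℝ, ∫ y, χ y * polyFun a y ^ 2 =
        ∑ α, ∑ β, a α * a β * ∫ y, χ y * (monomialFun α y * monomialFun β y) := by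
      intro a
      have hint : ∀ α β : Fin n → Fin (k + 1), Integrable fun y =>
          a α * a β * (χ y * (monomialFun α y * monomialFun β y)) := fun α β =>
        ((hχ.continuous.mul ((contDiff_monomialFun α).continuous.mul
          (contDiff_monomialFun β).continuous)).integrable_of_hasCompactSupport
            hχc.mul_right).const_mul _
      simp_rw [← integral_const_mul]
      rw [Finset.sum_congr rfl fun α _ => (integral_finsetSum _ fun β _ => hint α β).symm,
        ← integral_finsetSum _ fun α _ => integrable_finsetSum _ fun β _ => hint α β]
      refine integral_congr_ae (ae_of_all _ fun y => ?_)
      simp only [polyFun]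
      rw [sq, Finset.sum_mul_sum]
      simp only [Finset.mul_sum]
      exact Finset.sum_congr rfl fun α _ => Finset.sum_congr rfl fun β _ => by ring
    simp_rw [hexp]
    fun_prop
  · intro t a
    rw [← integral_const_mul]
    refine integral_congr_ae (ae_of_all _ fun y => ?_)
    simp only [polyFun, Pi.smul_apply, smul_eq_mul, mul_assoc, ← Finset.mul_sum]
    ring
  · intro a ha
    by_contra hle
    have hint := (hcont a).integrable_of_hasCompactSupport (μ := volume) hχc.mul_right
    have hnn : ∀ y, 0 ≤ χ y * polyFun a y ^ 2 := fun y => mul_nonneg (hχ0 y) (sq_nonneg _)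
    have h0 := le_antisymm (not_lt.1 hle) (integral_nonneg hnn)
    rw [integral_eq_zero_iff_of_nonneg hnn hint] at h0
    have h1 := Continuous.ae_eq_iff_eq volume (hcont a) continuous_const |>.1 h0
    refine ha (eq_zero_of_polyFun_eq_zero (isOpen_lt continuous_const hχ.continuous) ⟨0, hχ1⟩ ?_)
    intro y hy
    have h2 : χ y * polyFun a y ^ 2 = 0 := congrFun h1 y
    have h3 := (mul_eq_zero.1 h2).resolve_left (ne_of_gt hy)
    exact pow_eq_zero_iff two_ne_zero |>.1 h3

end Polynomials

/-! ### Scaled test functions -/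

section Scaling

variable {d : ℕ}

/-- The combination with coefficients `a` of the functions `ψ α`, transported from the unit scale
at the origin to the scale `ρ` at `c` and rotated by `A`. -/
noncomputable def scaledSum {ι : Type*} [Fintype ι] (ψ : ι → Space d → ℝ)
    (A : Space d ≃ₗᵢ[ℝ] Space d) (c : Space d) (ρ : ℝ) (a : ι → ℝ) (x : Space d) : ℝ :=
  ∑ α, a α * ψ α (ρ⁻¹ • A.symm (x - c))

theorem contDiff_comp_scaling {ψ : Space d → ℝ} (hψ : ContDiff ℝ ∞ ψ)
    (A : Space d ≃ₗᵢ[ℝ] Space d) (c : Space d) (ρ : ℝ) :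
    ContDiff ℝ ∞ fun x => ψ (ρ⁻¹ • A.symm (x - c)) :=
  hψ.comp ((A.symm.contDiff.comp (contDiff_id.sub contDiff_const)).const_smul _)

theorem pd_comp_scaling {ψ : Space d → ℝ} (hψ : ContDiff ℝ ∞ ψ)
    (A : Space d ≃ₗᵢ[ℝ] Space d) (c : Space d) (ρ : ℝ) (j : Fin d) :
    pd j (fun x => ψ (ρ⁻¹ • A.symm (x - c))) = fun x =>
      ρ⁻¹ * ∑ i, A.symm (EuclideanSpace.single j 1) i * pd i ψ (ρ⁻¹ • A.symm (x - c)) := by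
  funext x
  have h1 : HasFDerivAt (fun x : Space d => ρ⁻¹ • A.symm (x - c))
      (ρ⁻¹ • (A.symm.toContinuousLinearEquiv : Space d →L[ℝ] Space d)) x := by
    have h := ((A.symm.toContinuousLinearEquiv.hasFDerivAt).comp x
      ((hasFDerivAt_id x).sub_const c)).const_smul ρ⁻¹
    rw [ContinuousLinearMap.comp_id] at h
    exact h
  have h2 := ((hψ.differentiable (by simp) (ρ⁻¹ • A.symm (x - c))).hasFDerivAt.comp x h1).fderiv
  change fderiv ℝ (ψ ∘ fun x => ρ⁻¹ • A.symm (x - c)) x _ = _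
  have h3 : ∀ w : Space d, w = ∑ i, w i • EuclideanSpace.single i (1 : ℝ) := by
    intro w
    ext l
    simp [Pi.single_apply]
  rw [h2, ContinuousLinearMap.comp_apply, smul_apply, map_smul, smul_eq_mul]
  congr 1
  change fderiv ℝ ψ (ρ⁻¹ • A.symm (x - c)) (A.symm (EuclideanSpace.single j 1)) = _
  conv_lhs => rw [h3 (A.symm (EuclideanSpace.single j 1)), map_sum]
  exact Finset.sum_congr rfl fun i _ => by rw [map_smul, smul_eq_mul]; rfl

theorem contDiff_scaledSum {ι : Type*} [Fintype ι] {ψ : ι → Space d → ℝ}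
    (hψ : ∀ α, ContDiff ℝ ∞ (ψ α)) (A : Space d ≃ₗᵢ[ℝ] Space d) (c : Space d) (ρ : ℝ)
    (a : ι → ℝ) : ContDiff ℝ ∞ (scaledSum ψ A c ρ a) :=
  ContDiff.sum fun α _ => contDiff_const.mul (contDiff_comp_scaling (hψ α) A c ρ)

theorem tsupport_scaledSum_subset {ι : Type*} [Fintype ι] {ψ : ι → Space d → ℝ}
    (hs : ∀ α, ∀ x ∉ Metric.closedBall (0 : Space d) (1 / 2), ψ α x = 0)
    (A : Space d ≃ₗᵢ[ℝ] Space d)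
    (c : Space d) {ρ : ℝ} (hρ : 0 < ρ) (a : ι → ℝ) :
    tsupport (scaledSum ψ A c ρ a) ⊆ Metric.closedBall c (ρ / 2) := by
  refine closure_minimal (fun x hx => ?_) Metric.isClosed_closedBall
  by_contra hxc
  refine hx (Finset.sum_eq_zero fun α _ => ?_)
  rw [hs α, mul_zero]
  rw [Metric.mem_closedBall, dist_eq_norm, not_le] at hxc
  rw [mem_closedBall_zero_iff, norm_smul, norm_inv, Real.norm_eq_abs, abs_of_pos hρ,
    LinearIsometryEquiv.norm_map, not_le]
  rw [inv_mul_eq_div, div_lt_div_iff₀ two_pos hρ]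
  linarith

theorem isTestFunction_scaledSum {ι : Type*} [Fintype ι] {ψ : ι → Space d → ℝ}
    (hψ : ∀ α, ContDiff ℝ ∞ (ψ α))
    (hs : ∀ α, ∀ x ∉ Metric.closedBall (0 : Space d) (1 / 2), ψ α x = 0)
    (A : Space d ≃ₗᵢ[ℝ] Space d) (c : Space d) {ρ : ℝ} (hρ : 0 < ρ) (a : ι → ℝ) :
    IsTestFunction (Metric.ball c ρ) (scaledSum ψ A c ρ a) := by
  have h := tsupport_scaledSum_subset hs A c hρ a
  refine ⟨contDiff_scaledSum hψ A c ρ a, ?_, h.trans (Metric.closedBall_subset_ball (by linarith))⟩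
  exact (isCompact_closedBall c (ρ / 2)).of_isClosed_subset (isClosed_tsupport _) h

theorem exists_bound_comp_scaling {ψ : Space d → ℝ} (hψ : ContDiff ℝ ∞ ψ)
    (hc : HasCompactSupport ψ) :
    ∃ B : ℝ, 0 ≤ B ∧ ∀ (A : Space d ≃ₗᵢ[ℝ] Space d) (c : Space d) (ρ : ℝ), 0 < ρ →
      ∀ x, |ψ (ρ⁻¹ • A.symm (x - c))| ≤ B ∧
        (∀ j, |pd j (fun x => ψ (ρ⁻¹ • A.symm (x - c))) x| ≤ B * ρ⁻¹) ∧
        ∀ j l, |pd l (pd j (fun x => ψ (ρ⁻¹ • A.symm (x - c)))) x| ≤ B * ρ⁻¹ ^ 2 := by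
  obtain ⟨B0, hB0⟩ := hc.exists_bound_of_continuous hψ.continuous
  have hc1 : ∀ i : Fin d, HasCompactSupport (pd i ψ) := fun i => hc.fderiv_apply ℝ _
  choose B1 hB1 using fun i => (hc1 i).exists_bound_of_continuous (hψ.pd i).continuous
  choose B2 hB2 using fun i l : Fin d => HasCompactSupport.exists_bound_of_continuous
    (f := pd l (pd i ψ)) ((hc1 i).fderiv_apply ℝ _) ((hψ.pd i).pd l).continuous
  have h0 := (norm_nonneg _).trans (hB0 0)
  have h1 : 0 ≤ ∑ i, B1 i := Finset.sum_nonneg fun i _ => (norm_nonneg _).trans (hB1 i 0)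
  have h2 : 0 ≤ ∑ i, ∑ l, B2 i l := Finset.sum_nonneg fun i _ => Finset.sum_nonneg fun l _ =>
    (norm_nonneg _).trans (hB2 i l 0)
  refine ⟨B0 + ∑ i, B1 i + ∑ i, ∑ l, B2 i l, by positivity, fun A c ρ hρ x => ?_⟩
  have hA : ∀ i j, |A.symm (EuclideanSpace.single j (1 : ℝ)) i| ≤ 1 := fun i j => by
    simpa using PiLp.norm_apply_le (A.symm (EuclideanSpace.single j (1 : ℝ))) i
  have hi : 0 < ρ⁻¹ := inv_pos.2 hρ
  have hsum : ∀ (j : Fin d) (f b : Fin d → ℝ), (∀ i, |f i| ≤ b i) →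
      |ρ⁻¹ * ∑ i, A.symm (EuclideanSpace.single j 1) i * f i| ≤ (∑ i, b i) * ρ⁻¹ := by
    intro j f b hf
    rw [abs_mul, abs_of_pos hi, mul_comm]
    refine mul_le_mul_of_nonneg_right ?_ hi.le
    refine (Finset.abs_sum_le_sum_abs _ _).trans (Finset.sum_le_sum fun i _ => ?_)
    rw [abs_mul]
    exact (mul_le_of_le_one_left (abs_nonneg _) (hA i j)).trans (hf i)
  refine ⟨(hB0 _).trans (by linarith), fun j => ?_, fun j l => ?_⟩
  · rw [pd_comp_scaling hψ]
    refine (hsum j _ B1 fun i => hB1 i _).trans ?_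
    exact mul_le_mul_of_nonneg_right (by linarith) hi.le
  · have hg := fun i => contDiff_comp_scaling (hψ.pd i) A c ρ
    rw [pd_comp_scaling hψ, pd_const_mul (ContDiff.sum fun i _ => contDiff_const.mul (hg i)),
      pd_sum _ fun i => contDiff_const.mul (hg i)]
    simp_rw [pd_const_mul (hg _), pd_comp_scaling (hψ.pd _)]
    refine (hsum j _ (fun i => (∑ m, B2 i m) * ρ⁻¹) fun i => hsum l _ (B2 i) fun m =>
      hB2 i m _).trans ?_
    rw [← Finset.sum_mul, mul_assoc, ← sq]
    exact mul_le_mul_of_nonneg_right (by linarith) (by positivity)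

/-- The scaled test functions and their derivatives up to second order are bounded uniformly in the
position and the rotation, with the natural powers of the scale. -/
theorem exists_bound_scaledSum {ι : Type*} [Fintype ι] {ψ : ι → Space d → ℝ}
    (hψ : ∀ α, ContDiff ℝ ∞ (ψ α)) (hc : ∀ α, HasCompactSupport (ψ α)) :
    ∃ K : ℝ, 0 ≤ K ∧ ∀ (A : Space d ≃ₗᵢ[ℝ] Space d) (c : Space d) (ρ : ℝ), 0 < ρ →
      ∀ (a : ι → ℝ) (x : Space d), |scaledSum ψ A c ρ a x| ≤ K * ‖a‖ ∧
        (∀ j, |pd j (scaledSum ψ A c ρ a) x| ≤ K * ρ⁻¹ * ‖a‖) ∧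
        ∀ j l, |pd l (pd j (scaledSum ψ A c ρ a)) x| ≤ K * ρ⁻¹ ^ 2 * ‖a‖ := by
  choose B hB0 hB using fun α => exists_bound_comp_scaling (hψ α) (hc α)
  refine ⟨∑ α, B α, Finset.sum_nonneg fun α _ => hB0 α, fun A c ρ hρ a x => ?_⟩
  have hsum : ∀ (f : ι → ℝ) (t : ℝ), 0 ≤ t → (∀ α, |f α| ≤ B α * t) →
      |∑ α, a α * f α| ≤ (∑ α, B α) * t * ‖a‖ := by
    intro f t ht hf
    refine (Finset.abs_sum_le_sum_abs _ _).trans ?_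
    rw [Finset.sum_mul, Finset.sum_mul]
    refine Finset.sum_le_sum fun α _ => ?_
    rw [abs_mul, mul_comm]
    exact mul_le_mul (hf α) (norm_le_pi_norm a α) (abs_nonneg _) (mul_nonneg (hB0 α) ht)
  have hg : ∀ α, ContDiff ℝ ∞ fun x => ψ α (ρ⁻¹ • A.symm (x - c)) := fun α =>
    contDiff_comp_scaling (hψ α) A c ρ
  have hpd : ∀ j, pd j (scaledSum ψ A c ρ a) =
      fun x => ∑ α, a α * pd j (fun x => ψ α (ρ⁻¹ • A.symm (x - c))) x := by
    intro j
    unfold scaledSum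
    rw [pd_sum _ fun α => contDiff_const.mul (hg α)]
    simp_rw [pd_const_mul (hg _)]
  refine ⟨?_, fun j => ?_, fun j l => ?_⟩
  · have h := hsum (fun α => ψ α (ρ⁻¹ • A.symm (x - c))) 1 zero_le_one fun α => by
      rw [mul_one]; exact (hB α A c ρ hρ x).1
    rwa [mul_one] at h
  · rw [hpd]
    exact hsum _ _ (inv_nonneg.2 hρ.le) fun α => (hB α A c ρ hρ x).2.1 j
  · rw [hpd, pd_sum _ fun α => contDiff_const.mul ((hg α).pd j)]
    simp_rw [pd_const_mul ((hg _).pd j)]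
    exact hsum _ _ (by positivity) fun α => (hB α A c ρ hρ x).2.2 j l

/-- A smooth cut-off function that is `1` near the origin and vanishes outside the ball of
radius `1/2`. -/
noncomputable def cutoff (n : ℕ) : ContDiffBump (0 : Space n) where
  rIn := 1 / 4
  rOut := 1 / 2
  rIn_pos := by norm_num
  rIn_lt_rOut := by norm_num

theorem cutoff_eq_zero {n : ℕ} {x : Space n} (hx : x ∉ Metric.closedBall (0 : Space n) (1 / 2)) :
    cutoff n x = 0 :=
  (cutoff n).zero_of_le_dist (not_le.1 hx).le

theorem cutoff_zero (n : ℕ) : cutoff n 0 = 1 :=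
  (cutoff n).one_of_mem_closedBall (by simp [cutoff])

end Scaling

/-! ### The polynomials on an element -/

section LocalPolynomials

variable {d k : ℕ} {T : Finset (Space d)}

theorem localPoly_spec {u : Space d → ℝ} (hT : (interior (hull T)).Nonempty)
    (h : ∃ P : MvPolynomial (Fin d) ℝ, P.totalDegree ≤ k ∧
      ∀ x ∈ interior (hull T), u x = MvPolynomial.eval x.ofLp P) :
    (localPoly T u).totalDegree ≤ k ∧
      ∀ x ∈ interior (hull T), u x = MvPolynomial.eval x.ofLp (localPoly T u) := by
  obtain ⟨P, hP, hu⟩ := h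
  have h' : ∃ P : MvPolynomial (Fin d) ℝ, ∀ x ∈ interior (hull T),
      u x = MvPolynomial.eval x.ofLp P := ⟨P, hu⟩
  have hs : ∀ x ∈ interior (hull T), u x = MvPolynomial.eval x.ofLp (localPoly T u) := by
    unfold localPoly
    rw [dif_pos h']
    exact h'.choose_spec
  refine ⟨?_, hs⟩
  rwa [eq_of_eval_eq_on_open isOpen_interior hT fun x hx => (hs x hx).symm.trans (hu x hx)]

/-- The components of the element residual, as polynomials. -/
noncomputable def residualPoly (T : Finset (Space d)) (uh : Space d → Space d) (ph : Space d → ℝ)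
    (i : Fin d) : MvPolynomial (Fin d) ℝ :=
  -(∑ j, MvPolynomial.pderiv j (MvPolynomial.pderiv j (localPoly T (comp uh i)))) +
    MvPolynomial.pderiv i (localPoly T ph)

/-- The divergence on an element, as a polynomial. -/
noncomputable def divPoly (T : Finset (Space d)) (uh : Space d → Space d) :
    MvPolynomial (Fin d) ℝ :=
  ∑ i, MvPolynomial.pderiv i (localPoly T (comp uh i))

/-- The components of the normal flux in the direction `n`, as polynomials. -/
noncomputable def fluxPoly (T : Finset (Space d)) (n : Space d) (uh : Space d → Space d)
    (ph : Space d → ℝ) (i : Fin d) : MvPolynomial (Fin d) ℝ :=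
  (∑ j, MvPolynomial.C (n j) * MvPolynomial.pderiv j (localPoly T (comp uh i))) -
    localPoly T ph * MvPolynomial.C (n i)

theorem elemResidual_apply (uh : Space d → Space d) (ph : Space d → ℝ) (x : Space d) (i : Fin d) :
    elemResidual T uh ph x i = MvPolynomial.eval x.ofLp (residualPoly T uh ph i) := by
  simp [elemResidual, residualPoly]

theorem elemDiv_apply (uh : Space d → Space d) (x : Space d) :
    elemDiv T uh x = MvPolynomial.eval x.ofLp (divPoly T uh) := by
  simp [elemDiv, divPoly]

theorem normalFlux_apply (e : Finset (Space d)) (uh : Space d → Space d) (ph : Space d → ℝ)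
    (x : Space d) (i : Fin d) :
    normalFlux T e uh ph x i =
      MvPolynomial.eval x.ofLp (fluxPoly T (outwardNormal T e) uh ph i) := by
  simp [normalFlux, fluxPoly]

variable {uh : Space d → Space d} {ph : Space d → ℝ}

theorem totalDegree_divPoly_le (hu : ∀ i, (localPoly T (comp uh i)).totalDegree ≤ k) :
    (divPoly T uh).totalDegree ≤ k :=
  MvPolynomial.totalDegree_finsetSum_le fun i _ => (totalDegree_pderiv_le _ _).trans (hu i)

theorem totalDegree_residualPoly_le (hu : ∀ i, (localPoly T (comp uh i)).totalDegree ≤ k)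
    (hp : (localPoly T ph).totalDegree ≤ k) (i : Fin d) :
    (residualPoly T uh ph i).totalDegree ≤ k := by
  refine (MvPolynomial.totalDegree_add _ _).trans (max_le ?_ ((totalDegree_pderiv_le _ _).trans hp))
  rw [MvPolynomial.totalDegree_neg]
  exact MvPolynomial.totalDegree_finsetSum_le fun j _ =>
    (totalDegree_pderiv_le _ _).trans ((totalDegree_pderiv_le _ _).trans (hu i))

theorem totalDegree_fluxPoly_le (hu : ∀ i, (localPoly T (comp uh i)).totalDegree ≤ k)
    (hp : (localPoly T ph).totalDegree ≤ k) (n : Space d) (i : Fin d) :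
    (fluxPoly T n uh ph i).totalDegree ≤ k := by
  refine (MvPolynomial.totalDegree_sub _ _).trans (max_le ?_ ?_)
  · refine MvPolynomial.totalDegree_finsetSum_le fun j _ =>
      (MvPolynomial.totalDegree_mul _ _).trans ?_
    rw [MvPolynomial.totalDegree_C, zero_add]
    exact (totalDegree_pderiv_le _ _).trans (hu i)
  · refine (MvPolynomial.totalDegree_mul _ _).trans ?_
    rw [MvPolynomial.totalDegree_C, add_zero]
    exact hp

end LocalPolynomials

/-! ### Simplices and barycentric coordinates -/

section Simplex

variable {d : ℕ} {T e : Finset (Space d)}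

theorem exists_affineBasis_vertices (hcard : T.card = d + 1)
    (hind : AffineIndependent ℝ ((↑) : T → Space d)) :
    ∃ b : AffineBasis T ℝ (Space d), ∀ v : T, b v = v := by
  refine ⟨⟨(↑), hind, ?_⟩, fun v => rfl⟩
  rw [hind.affineSpan_eq_top_iff_card_eq_finrank_add_one]
  simp [hcard]

theorem isBounded_hull (T : Finset (Space d)) : Bornology.IsBounded (hull T) :=
  (T.finite_toSet.isCompact_convexHull ℝ).isBounded

theorem isClosed_hull (T : Finset (Space d)) : IsClosed (hull T) :=
  (T.finite_toSet.isCompact_convexHull ℝ).isClosed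

theorem dist_le_elemDiam {x y : Space d} (hx : x ∈ hull T) (hy : y ∈ hull T) :
    dist x y ≤ elemDiam T :=
  Metric.dist_le_diam_of_mem (isBounded_hull T) hx hy

theorem vertex_mem_hull {v : Space d} (hv : v ∈ T) : v ∈ hull T :=
  subset_convexHull ℝ _ hv

variable {b : AffineBasis T ℝ (Space d)} (hb : ∀ v : T, b v = v)

include hb

theorem hull_eq_nonneg_coord : hull T = {x | ∀ v, 0 ≤ b.coord v x} := by
  rw [← b.convexHull_eq_nonneg_coord]
  rw [show ⇑b = ((↑) : T → Space d) from funext hb, Subtype.range_coe]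
  rfl

theorem coord_le_one {x : Space d} (hx : x ∈ hull T) (v : T) : b.coord v x ≤ 1 := by
  rw [hull_eq_nonneg_coord hb] at hx
  rw [← b.sum_coord_apply_eq_one x]
  exact Finset.single_le_sum (f := fun v => b.coord v x) (fun w _ => hx w) (Finset.mem_univ v)

/-- A vertex of a simplex is an extreme point. -/
theorem vertex_mem_of_mem_convexHull {S : Set (Space d)} (hS : S ⊆ hull T) (v : T)
    (hv : (v : Space d) ∈ convexHull ℝ S) : (v : Space d) ∈ S := by
  by_contra hvS
  have hlt : S ⊆ {x | b.coord v x < 1} := by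
    intro x hx
    refine lt_of_le_of_ne (coord_le_one hb (hS hx) v) fun h1 => hvS ?_
    have hx' := hS hx
    rw [hull_eq_nonneg_coord hb] at hx'
    have hzero : ∀ w, w ≠ v → b.coord w x = 0 := by
      intro w hw
      have h2 := Finset.add_le_sum (f := fun v => b.coord v x) (fun u _ => hx' u)
        (Finset.mem_univ v) (Finset.mem_univ w) hw.symm
      rw [b.sum_coord_apply_eq_one x, h1] at h2
      exact le_antisymm (by linarith) (hx' w)
    have h3 : x = v := by
      refine b.ext_elem fun w => ?_
      rw [← hb v]
      by_cases hw : w = v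
      · rw [hw, h1, b.coord_apply_eq]
      · rw [hzero w hw, b.coord_apply_ne hw]
    exact h3 ▸ hx
  have hconv : Convex ℝ {x | b.coord v x < 1} :=
    (convex_Iio (1 : ℝ)).affine_preimage (b.coord v)
  have h4 : b.coord v (v : Space d) < 1 := convexHull_min hlt hconv hv
  rw [← hb v, b.coord_apply_eq] at h4
  exact lt_irrefl _ h4

/-- The gradients of the barycentric coordinates of a simplex that contains a ball of radius `r`
are bounded by `1 / (2r)`. -/
theorem abs_coord_sub_le {c : Space d} {r : ℝ} (hr : 0 < r)
    (hball : Metric.closedBall c r ⊆ hull T) (v : T) (x y : Space d) :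
    |b.coord v x - b.coord v y| ≤ ‖x - y‖ / (2 * r) := by
  rcases eq_or_ne x y with rfl | hxy
  · simp
  have hn : 0 < ‖x - y‖ := norm_pos_iff.2 (sub_ne_zero.2 hxy)
  set z := (r / ‖x - y‖) • (x - y) with hz
  have hzn : ‖z‖ = r := by
    rw [hz, norm_smul, Real.norm_eq_abs, abs_of_pos (by positivity)]
    field_simp
  have h1 : c + z ∈ hull T := hball (by simp [hzn])
  have h2 : c - z ∈ hull T := hball (by simp [hzn])
  have hlin : ∀ p q : Space d, b.coord v p - b.coord v q = (b.coord v).linear (p - q) := by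
    intro p q
    rw [← vsub_eq_sub, ← vsub_eq_sub, AffineMap.linearMap_vsub]
  have h3 : b.coord v (c + z) - b.coord v (c - z) =
      2 * (r / ‖x - y‖) * (b.coord v x - b.coord v y) := by
    rw [hlin, hlin, show c + z - (c - z) = (2 * (r / ‖x - y‖)) • (x - y) by
      rw [mul_smul, ← hz]; module, map_smul, smul_eq_mul]
  have b1 := coord_le_one hb h1 v
  have b2 := coord_le_one hb h2 v
  rw [hull_eq_nonneg_coord hb] at h1 h2
  have b3 := h1 v
  have b4 := h2 v
  have h4 : |2 * (r / ‖x - y‖) * (b.coord v x - b.coord v y)| ≤ 1 := by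
    rw [← h3, abs_le]; constructor <;> linarith
  rw [abs_mul, abs_of_pos (by positivity)] at h4
  rw [le_div_iff₀ (by positivity)]
  calc |b.coord v x - b.coord v y| * (2 * r)
      = 2 * (r / ‖x - y‖) * |b.coord v x - b.coord v y| * ‖x - y‖ := by field_simp
    _ ≤ 1 * ‖x - y‖ := by gcongr
    _ = ‖x - y‖ := one_mul _

/-- All edges of a simplex are at least as long as the diameter of any ball inside it. -/
theorem two_mul_le_dist_vertices {c : Space d} {r : ℝ} (hr : 0 < r)
    (hball : Metric.closedBall c r ⊆ hull T) {v w : Space d} (hv : v ∈ T) (hw : w ∈ T)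
    (hvw : v ≠ w) : 2 * r ≤ dist v w := by
  have h := abs_coord_sub_le hb hr hball ⟨v, hv⟩ v w
  have h1 : b.coord ⟨v, hv⟩ v = 1 := by
    have := b.coord_apply_eq ⟨v, hv⟩
    rwa [hb] at this
  have h2 : b.coord ⟨v, hv⟩ w = 0 := by
    have := b.coord_apply_ne (i := ⟨v, hv⟩) (j := ⟨w, hw⟩) fun h => hvw (congrArg Subtype.val h)
    rwa [hb] at this
  rw [h1, h2, sub_zero, abs_one, one_le_div (by positivity)] at h
  rwa [dist_eq_norm]

omit hb

/-- The barycentre of a facet. -/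
noncomputable def faceCenter (e : Finset (Space d)) : Space d := (d : ℝ)⁻¹ • ∑ w ∈ e, w

theorem sub_faceCenter (hd : 0 < d) (he : e.card = d) (w : Space d) :
    w - faceCenter e = (d : ℝ)⁻¹ • ∑ u ∈ e, (w - u) := by
  have hd' : (d : ℝ) ≠ 0 := by positivity
  rw [Finset.sum_sub_distrib, Finset.sum_const, he, smul_sub, ← Nat.cast_smul_eq_nsmul ℝ,
    smul_smul, inv_mul_cancel₀ hd', one_smul, faceCenter]

theorem affineMap_faceCenter (hd : 0 < d) (he : e.card = d) (f : Space d →ᵃ[ℝ] ℝ) :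
    f (faceCenter e) = (d : ℝ)⁻¹ * ∑ w ∈ e, f w := by
  have hd' : (d : ℝ) ≠ 0 := by positivity
  have h : ∀ x, f x = f.linear x + f 0 := fun x => by
    conv_lhs => rw [AffineMap.decomp f]
    simp
  rw [h, Finset.sum_congr rfl fun w _ => h w, Finset.sum_add_distrib, faceCenter, map_smul,
    map_sum, Finset.sum_const, he, smul_eq_mul, nsmul_eq_mul, mul_add, inv_mul_cancel_left₀ hd']

theorem faceCenter_mem_hull (hd : 0 < d) (he : e.card = d) : faceCenter e ∈ hull e := by
  have h : faceCenter e = e.centerMass (fun _ => (1 : ℝ)) id := by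
    simp [Finset.centerMass, faceCenter, he]
  rw [h]
  refine Finset.centerMass_mem_convexHull _ (fun _ _ => zero_le_one) ?_ fun x hx => hx
  simp [he, hd]

theorem hull_mono (he : e ⊆ T) : hull e ⊆ hull T :=
  convexHull_mono (by exact_mod_cast he)

theorem exists_opposite_vertex (hcard : T.card = d + 1) (heT : e ⊆ T) (he : e.card = d) :
    ∃ v ∈ T, v ∉ e ∧ ∀ w ∈ T, w ≠ v → w ∈ e := by
  classical
  have h1 : (T \ e).card = 1 := by rw [Finset.card_sdiff_of_subset heT, hcard, he]; omega
  obtain ⟨v, hv⟩ := Finset.card_eq_one.1 h1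
  have hm : ∀ w, w ∈ T ∧ w ∉ e ↔ w = v := fun w => by
    rw [← Finset.mem_sdiff, hv, Finset.mem_singleton]
  refine ⟨v, ((hm v).2 rfl).1, ((hm v).2 rfl).2, fun w hw hwv => ?_⟩
  by_contra hwe
  exact hwv ((hm w).1 ⟨hw, hwe⟩)

/-- `n` is the exterior unit normal of the simplex `T` on its facet `e`. -/
def IsOutwardNormal (T e : Finset (Space d)) (n : Space d) : Prop :=
  ‖n‖ = 1 ∧ (∀ x ∈ e, ∀ y ∈ e, inner ℝ n (x - y) = 0) ∧
    ∀ x ∈ e, ∀ v ∈ T, v ∉ e → inner ℝ n (v - x) < 0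

include hb

theorem coord_vertex_ne {v w : Space d} (hv : v ∈ T) (hw : w ∈ T) (hvw : v ≠ w) :
    b.coord ⟨v, hv⟩ w = 0 := by
  have := b.coord_apply_ne (i := ⟨v, hv⟩) (j := ⟨w, hw⟩) fun h => hvw (congrArg Subtype.val h)
  rwa [hb] at this

theorem coord_vertex_self {v : Space d} (hv : v ∈ T) : b.coord ⟨v, hv⟩ v = 1 := by
  have := b.coord_apply_eq ⟨v, hv⟩
  rwa [hb] at this

theorem exists_isOutwardNormal (hd : 0 < d) (heT : e ⊆ T) (he : e.card = d) {v : Space d}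
    (hv : v ∈ T) (hve : v ∉ e) (hvw : ∀ w ∈ T, w ≠ v → w ∈ e) :
    ∃ n, IsOutwardNormal T e n := by
  -- the normal is opposite to the gradient `g` of the coordinate of `v`
  set ℓ : Space d →L[ℝ] ℝ := LinearMap.toContinuousLinearMap (b.coord ⟨v, hv⟩).linear with hℓ
  set g := (InnerProductSpace.toDual ℝ (Space d)).symm ℓ with hg
  have hgi : ∀ x y : Space d, inner ℝ g (x - y) = b.coord ⟨v, hv⟩ x - b.coord ⟨v, hv⟩ y := by
    intro x y
    rw [hg, InnerProductSpace.toDual_symm_apply, hℓ, LinearMap.coe_toContinuousLinearMap',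
      ← vsub_eq_sub, ← vsub_eq_sub, AffineMap.linearMap_vsub]
  have h0 : ∀ w ∈ e, b.coord ⟨v, hv⟩ w = 0 := fun w hw =>
    coord_vertex_ne hb hv (heT hw) fun h => hve (h ▸ hw)
  have hg0 : g ≠ 0 := by
    obtain ⟨w, hw⟩ := Finset.card_pos.1 (he.symm ▸ hd)
    intro h
    have := hgi v w
    rw [h, inner_zero_left, h0 w hw, coord_vertex_self hb hv] at this
    norm_num at this
  have hgn : 0 < ‖g‖ := norm_pos_iff.2 hg0
  refine ⟨(-‖g‖⁻¹) • g, ?_, fun x hx y hy => ?_, fun x hx w hw hwe => ?_⟩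
  · rw [norm_smul, norm_neg, norm_inv, norm_norm, inv_mul_cancel₀ hgn.ne']
  · rw [inner_smul_left, hgi, h0 x hx, h0 y hy]; simp
  · have hwv : w = v := by
      by_contra h
      exact hwe (hvw w hw h)
    rw [inner_smul_left, hgi, hwv, h0 x hx, coord_vertex_self hb hv]
    simpa using hgn

/-- A linear functional constant on a facet is, relative to the barycentre of the facet, a multiple
of the barycentric coordinate of the opposite vertex. -/
theorem inner_sub_faceCenter (hd : 0 < d) (he : e.card = d) {v : Space d}
    (hv : v ∈ T) (hvw : ∀ w ∈ T, w ≠ v → w ∈ e) {n : Space d}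
    (hn : ∀ x ∈ e, ∀ y ∈ e, inner ℝ n (x - y) = 0) (y : Space d) :
    inner ℝ n (y - faceCenter e) = inner ℝ n (v - faceCenter e) * b.coord ⟨v, hv⟩ y := by
  have hw0 : ∀ w ∈ e, inner ℝ n (w - faceCenter e) = 0 := by
    intro w hw
    rw [sub_faceCenter hd he, inner_smul_right, inner_sum, Finset.sum_eq_zero fun u hu => hn w hw u hu, mul_zero]
  have h2 : y - faceCenter e = ∑ w : T, b.coord w y • ((w : Space d) - faceCenter e) := by
    have h3 := b.linear_combination_coord_eq_self y
    simp only [hb] at h3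
    simp only [smul_sub, Finset.sum_sub_distrib]
    rw [h3, ← Finset.sum_smul, b.sum_coord_apply_eq_one, one_smul]
  rw [h2, inner_sum, Finset.sum_eq_single ⟨v, hv⟩]
  · rw [inner_smul_right, mul_comm]
  · intro w _ hw
    rw [inner_smul_right, hw0 w (hvw w w.2 fun h => hw (Subtype.ext h)), mul_zero]
  · simp

/-- Near the barycentre of a facet the simplex fills the half ball on the inner side. -/
theorem mem_hull_of_inner_nonpos (hd : 0 < d) (heT : e ⊆ T) (he : e.card = d) {v : Space d}
    (hv : v ∈ T) (hve : v ∉ e) (hvw : ∀ w ∈ T, w ≠ v → w ∈ e) {n : Space d}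
    (hn : IsOutwardNormal T e n) {c : Space d} {r : ℝ} (hr : 0 < r)
    (hball : Metric.closedBall c r ⊆ hull T) {y : Space d}
    (hy : ‖y - faceCenter e‖ ≤ 2 * r / d) (hin : inner ℝ n (y - faceCenter e) ≤ 0) :
    y ∈ hull T := by
  rw [hull_eq_nonneg_coord hb]
  rintro ⟨w, hw⟩
  by_cases hwv : w = v
  · subst hwv
    have h1 := inner_sub_faceCenter hb hd he hw hvw hn.2.1 y
    have h2 : inner ℝ n (w - faceCenter e) < 0 := by
      rw [sub_faceCenter hd he, inner_smul_right, inner_sum]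
      refine mul_neg_of_pos_of_neg (by positivity) (Finset.sum_neg (fun u hu =>
        hn.2.2 u hu w hw hve) (Finset.card_pos.1 (he.symm ▸ hd)))
    rw [h1] at hin
    exact nonneg_of_mul_nonpos_right hin h2
  · have hwe := hvw w hw hwv
    have h1 := abs_coord_sub_le hb hr hball ⟨w, hw⟩ y (faceCenter e)
    have h2 : b.coord ⟨w, hw⟩ (faceCenter e) = (d : ℝ)⁻¹ := by
      rw [affineMap_faceCenter hd he, Finset.sum_eq_single w, coord_vertex_self hb hw, mul_one]
      · exact fun u hu huw => coord_vertex_ne hb hw (heT hu) huw.symm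
      · exact fun h => absurd hwe h
    have h3 : ‖y - faceCenter e‖ / (2 * r) ≤ (d : ℝ)⁻¹ := by
      rw [div_le_iff₀ (by positivity), inv_mul_eq_div]; exact hy
    have h4 := (abs_le.1 (h1.trans h3)).1
    rw [h2] at h4
    linarith

omit hb

theorem isOutwardNormal_outwardNormal (h : ∃ n, IsOutwardNormal T e n) :
    IsOutwardNormal T e (outwardNormal T e) := by
  have h' : ∃ n : Space d, ‖n‖ = 1 ∧ (∀ x ∈ e, ∀ y ∈ e, inner ℝ n (x - y) = 0) ∧
      ∀ x ∈ e, ∀ v ∈ T, v ∉ e → inner ℝ n (v - x) < 0 := h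
  unfold outwardNormal
  rw [dif_pos h']
  exact h'.choose_spec

end Simplex

/-! ### Elements, patches and interior faces -/

section MeshGeometry

variable {d : ℕ} {Ω : Set (Space d)} {M : Mesh d Ω} {T T' e : Finset (Space d)}

theorem Mesh.hull_subset_closure (hT : T ∈ M.elems) : hull T ⊆ closure Ω := by
  rw [← M.covers]
  exact Set.subset_biUnion_of_mem hT

theorem Mesh.patch_subset (hΩ : interior (closure Ω) = Ω) : M.patch T ⊆ Ω := by
  classical
  conv_rhs => rw [← hΩ]
  refine interior_mono (Set.iUnion₂_subset fun T' hT' => ?_)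
  exact Mesh.hull_subset_closure (Finset.mem_filter.1 hT').1

theorem Mesh.interior_hull_subset (hΩ : interior (closure Ω) = Ω) (hT : T ∈ M.elems) :
    interior (hull T) ⊆ Ω := by
  conv_rhs => rw [← hΩ]
  exact interior_mono (Mesh.hull_subset_closure hT)

theorem Mesh.subset_patch {V : Set (Space d)} (hV : IsOpen V) (hT : T ∈ M.elems)
    (hT' : T' ∈ M.elems) (hmeet : (hull T' ∩ hull T).Nonempty) (h : V ⊆ hull T ∪ hull T') :
    V ⊆ M.patch T := by
  classical
  refine interior_maximal (h.trans (Set.union_subset ?_ ?_)) hV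
  · refine Set.subset_biUnion_of_mem (u := fun T' => hull T')
      (Finset.mem_coe.2 (Finset.mem_filter.2 ⟨hT, ?_⟩))
    exact hmeet.mono fun x hx => ⟨hx.2, hx.2⟩
  · exact Set.subset_biUnion_of_mem (u := fun T' => hull T')
      (Finset.mem_coe.2 (Finset.mem_filter.2 ⟨hT', hmeet⟩))

theorem Mesh.elemDiam_pos (hd : 0 < d) (hT : T ∈ M.elems) : 0 < elemDiam T := by
  obtain ⟨v, hv, w, hw, hvw⟩ := Finset.one_lt_card.1 (by rw [M.card_eq T hT]; omega)
  exact (dist_pos.2 hvw).trans_le (dist_le_elemDiam (vertex_mem_hull hv) (vertex_mem_hull hw))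

theorem Mesh.elemDiam_le (hΩ : Bornology.IsBounded Ω) (hT : T ∈ M.elems) :
    elemDiam T ≤ Metric.diam Ω := by
  rw [← Metric.diam_closure Ω]
  exact Metric.diam_mono (Mesh.hull_subset_closure hT) hΩ.closure

theorem Mesh.ShapeRegular.exists_ball {σ : ℝ} (hM : M.ShapeRegular σ) (hd : 0 < d)
    (hT : T ∈ M.elems) : ∃ (c : Space d) (r : ℝ), 0 < r ∧ Metric.closedBall c r ⊆ hull T ∧
      elemDiam T ≤ σ * (2 * r) := by
  obtain ⟨c, r, hr, hball, h⟩ := hM T hT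
  refine ⟨c, r, lt_of_le_of_ne hr ?_, hball, h⟩
  rintro rfl
  have := M.elemDiam_pos hd hT
  simp at h
  linarith

theorem Mesh.exists_basis (M : Mesh d Ω) (hT : T ∈ M.elems) :
    ∃ b : AffineBasis T ℝ (Space d), ∀ v : T, b v = v :=
  exists_affineBasis_vertices (M.card_eq T hT) (M.indep T hT)

theorem Mesh.isOutwardNormal (hd : 0 < d) (hT : T ∈ M.elems) (heT : e ⊆ T) (he : e.card = d) :
    IsOutwardNormal T e (outwardNormal T e) := by
  obtain ⟨b, hb⟩ := M.exists_basis hT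
  obtain ⟨v, hv, hve, hvw⟩ := exists_opposite_vertex (M.card_eq T hT) heT he
  exact isOutwardNormal_outwardNormal (exists_isOutwardNormal hb hd heT he hv hve hvw)

/-- The half ball at the barycentre of a facet, on the inner side, lies in the element. -/
theorem Mesh.mem_hull_of_inner_nonpos (hd : 0 < d) (hT : T ∈ M.elems) (heT : e ⊆ T)
    (he : e.card = d) {c : Space d} {r : ℝ} (hr : 0 < r) (hball : Metric.closedBall c r ⊆ hull T)
    {y : Space d} (hy : ‖y - faceCenter e‖ ≤ 2 * r / d)
    (hin : inner ℝ (outwardNormal T e) (y - faceCenter e) ≤ 0) : y ∈ hull T := by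
  obtain ⟨b, hb⟩ := M.exists_basis hT
  obtain ⟨v, hv, hve, hvw⟩ := exists_opposite_vertex (M.card_eq T hT) heT he
  exact StokesFEM.mem_hull_of_inner_nonpos hb hd heT he hv hve hvw
    (Mesh.isOutwardNormal hd hT heT he) hr hball hy hin

/-- Vectors orthogonal to a facet are multiples of its normal. -/
theorem Mesh.inner_sub_faceCenter_eq_zero (hd : 0 < d) (hT : T ∈ M.elems) (heT : e ⊆ T)
    (he : e.card = d) {n : Space d} (hn : ∀ x ∈ e, ∀ y ∈ e, inner ℝ n (x - y) = 0) {x : Space d}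
    (hx : x ∈ hull e) : inner ℝ n (x - faceCenter e) = 0 := by
  obtain ⟨b, hb⟩ := M.exists_basis hT
  obtain ⟨v, hv, hve, hvw⟩ := exists_opposite_vertex (M.card_eq T hT) heT he
  rw [inner_sub_faceCenter hb hd he hv hvw hn]
  have hconv : Convex ℝ {x | b.coord ⟨v, hv⟩ x = 0} :=
    (convex_singleton (0 : ℝ)).affine_preimage (b.coord ⟨v, hv⟩)
  have h0 : b.coord ⟨v, hv⟩ x = 0 := convexHull_min (fun w hw =>
    coord_vertex_ne hb hv (heT hw) fun h => hve (h ▸ hw)) hconv hx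
  rw [h0, mul_zero]

theorem Mesh.outwardNormal_eq_neg (hd : 0 < d) {σ : ℝ} (hM : M.ShapeRegular σ)
    (hT : T ∈ M.elems) (hT' : T' ∈ M.elems) (hne : T ≠ T') (heT : e ⊆ T) (heT' : e ⊆ T')
    (he : e.card = d) : outwardNormal T' e = -outwardNormal T e := by
  classical
  obtain ⟨b, hb⟩ := M.exists_basis hT
  obtain ⟨v, hv, hve, hvw⟩ := exists_opposite_vertex (M.card_eq T hT) heT he
  obtain ⟨c, r, hr, hball, -⟩ := hM.exists_ball hd hT
  obtain ⟨c', r', hr', hball', -⟩ := hM.exists_ball hd hT'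
  have hn := Mesh.isOutwardNormal hd hT heT he
  have hn' := Mesh.isOutwardNormal hd hT' heT' he
  set n := outwardNormal T e
  set n' := outwardNormal T' e
  set κ := inner ℝ n (v - faceCenter e) with hκ
  set κ' := inner ℝ n' (v - faceCenter e) with hκ'
  have h1 := inner_sub_faceCenter hb hd he hv hvw hn.2.1
  have h2 := inner_sub_faceCenter hb hd he hv hvw hn'.2.1
  have hκ0 : κ ≠ 0 := by
    intro h0
    have h3 := h1 (faceCenter e + n)
    rw [← hκ, h0, add_sub_cancel_left, real_inner_self_eq_norm_sq, hn.1] at h3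
    norm_num at h3
  have h4 : n' = (κ' / κ) • n := by
    refine ext_inner_right ℝ fun z => ?_
    have e1 := h1 (faceCenter e + z)
    have e2 := h2 (faceCenter e + z)
    rw [add_sub_cancel_left] at e1 e2
    rw [inner_smul_left, e1, e2, ← hκ, ← hκ']
    simp only [conj_trivial]
    field_simp
  have h5 : |κ' / κ| = 1 := by
    have := hn'.1
    rwa [h4, norm_smul, hn.1, mul_one, Real.norm_eq_abs] at this
  rcases (abs_eq zero_le_one).1 h5 with h6 | h6
  · -- if both elements were on the same side, they would share a point off the face
    exfalso
    rw [h6, one_smul] at h4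
    set t := min (2 * r / d) (2 * r' / d) with ht
    have htpos : 0 < t := lt_min (by positivity) (by positivity)
    set y := faceCenter e - t • n with hy
    have hyn : ‖y - faceCenter e‖ = t := by
      rw [hy, sub_sub_cancel_left, norm_neg, norm_smul, hn.1, mul_one, Real.norm_eq_abs,
        abs_of_pos htpos]
    have hyi : inner ℝ n (y - faceCenter e) = -t := by
      rw [hy, sub_sub_cancel_left, inner_neg_right, inner_smul_right, real_inner_self_eq_norm_sq,
        hn.1]
      ring
    have hyT : y ∈ hull T := Mesh.mem_hull_of_inner_nonpos hd hT heT he hr hball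
      (hyn.le.trans (min_le_left _ _)) (hyi.le.trans (by linarith))
    have hyT' : y ∈ hull T' := by
      refine Mesh.mem_hull_of_inner_nonpos hd hT' heT' he hr' hball'
        (hyn.le.trans (min_le_right _ _)) ?_
      change inner ℝ n' _ ≤ 0
      rw [h4, hyi]
      linarith
    have hinter : T ∩ T' = e := by
      refine (Finset.eq_of_subset_of_card_le (Finset.subset_inter heT heT') ?_).symm
      rw [he, ← Nat.lt_succ_iff]
      refine lt_of_lt_of_eq ?_ (M.card_eq T hT)
      refine Finset.card_lt_card (Finset.ssubset_iff_subset_ne.2 ⟨Finset.inter_subset_left, ?_⟩)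
      intro h
      refine hne (Finset.eq_of_subset_of_card_le (Finset.inter_eq_left.1 h) ?_)
      rw [M.card_eq T hT, M.card_eq T' hT']
    have hye : y ∈ hull e := by
      have := M.conforming T hT T' hT'
      rw [← Finset.coe_inter, hinter] at this
      exact this.subset ⟨hyT, hyT'⟩
    have h7 := Mesh.inner_sub_faceCenter_eq_zero hd hT heT he hn.2.1 hye
    rw [hyi] at h7
    linarith
  · rw [h4, h6, neg_one_smul]

/-- An interior face of `T` belongs to exactly two elements, `T` and another one. -/
theorem Mesh.exists_neighbour (hd : 0 < d) {σ : ℝ} (hM : M.ShapeRegular σ)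
    (hT : T ∈ M.elems) (heT : e ∈ M.interiorFaces T) :
    e ⊆ T ∧ e.card = d ∧ ∃ T' ∈ M.elems, T' ≠ T ∧ e ⊆ T' ∧
      ∀ S ∈ M.elems, e ⊆ S → S = T ∨ S = T' := by
  classical
  obtain ⟨h1, -, Tp, hTp, Tm, hTm, hne, hface⟩ := Finset.mem_filter.1 heT
  obtain ⟨heT, he⟩ := Finset.mem_powersetCard.1 h1
  refine ⟨heT, he, ?_⟩
  have hconf := M.conforming Tp hTp Tm hTm
  obtain ⟨b, hb⟩ := M.exists_basis hT
  have hsub : ∀ w ∈ e, w ∈ Tp ∧ w ∈ Tm := by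
    intro w hw
    have h2 : w ∈ convexHull ℝ ((Tp : Set (Space d)) ∩ Tm) := by
      rw [← hconf, hface]; exact vertex_mem_hull hw
    have h3 := vertex_mem_of_mem_convexHull hb (S := (Tp : Set (Space d)) ∩ Tm) ?_
      ⟨w, heT hw⟩ h2
    · exact h3
    · refine (subset_convexHull ℝ _).trans ?_
      rw [← hconf, hface]
      exact hull_mono heT
  have hep : e ⊆ Tp := fun w hw => (hsub w hw).1
  have hem : e ⊆ Tm := fun w hw => (hsub w hw).2
  -- three different elements cannot share a face, as their normals are pairwise opposite
  have hthree : ∀ A ∈ M.elems, ∀ B ∈ M.elems, ∀ C ∈ M.elems, e ⊆ A → e ⊆ B → e ⊆ C → A ≠ B →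
      C = A ∨ C = B := by
    intro A hA B hB C hC hAe hBe hCe hAB
    by_contra! h
    have n1 := Mesh.outwardNormal_eq_neg hd hM hA hB hAB hAe hBe he
    have n2 := Mesh.outwardNormal_eq_neg hd hM hA hC h.1.symm hAe hCe he
    have n3 := Mesh.outwardNormal_eq_neg hd hM hB hC h.2.symm hBe hCe he
    rw [n1, n2, neg_neg] at n3
    have n4 : (2 : ℝ) • outwardNormal A e = 0 := by
      rw [two_smul]; nth_rewrite 1 [← n3]; exact neg_add_cancel _
    have := (Mesh.isOutwardNormal hd hA hAe he).1
    rw [(smul_eq_zero.1 n4).resolve_left two_ne_zero, norm_zero] at this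
    exact zero_ne_one this
  have key : ∀ T' ∈ M.elems, e ⊆ T' → T' ≠ T → ∃ T' ∈ M.elems, T' ≠ T ∧ e ⊆ T' ∧
      ∀ S ∈ M.elems, e ⊆ S → S = T ∨ S = T' := fun T' hT' he' hn =>
    ⟨T', hT', hn, he', fun S hS hSe => hthree T hT T' hT' S hS heT he' hSe hn.symm⟩
  by_cases h : Tp = T
  · exact key Tm hTm hem fun h' => hne (h.trans h'.symm)
  · exact key Tp hTp hep h

/-- Neighbouring elements of a shape regular mesh have comparable diameters. -/
theorem Mesh.elemDiam_le_mul_of_common_edge (hd : 2 ≤ d) {σ : ℝ} (hM : M.ShapeRegular σ)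
    (hT : T ∈ M.elems) (he : e.card = d) (heT : e ⊆ T) (heT' : e ⊆ T') :
    elemDiam T ≤ σ * elemDiam T' := by
  obtain ⟨b, hb⟩ := M.exists_basis hT
  obtain ⟨c, r, hr, hball, h⟩ := hM.exists_ball (by omega) hT
  have hσ : 0 < σ := by
    have := M.elemDiam_pos (by omega) hT
    exact pos_of_mul_pos_left (this.trans_le h) (by positivity)
  obtain ⟨v, hv, w, hw, hvw⟩ := Finset.one_lt_card.1 (by omega : 1 < e.card)
  refine h.trans (mul_le_mul_of_nonneg_left ?_ hσ.le)
  exact (two_mul_le_dist_vertices hb hr hball (heT hv) (heT hw) hvw).trans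
    (dist_le_elemDiam (vertex_mem_hull (heT' hv)) (vertex_mem_hull (heT' hw)))

end MeshGeometry

/-! ### The divergence theorem on half spaces -/

section HalfSpace

variable {m : ℕ}

/-- The embedding of `ℝᵐ` as the coordinate hyperplane `x₀ = 0` of `ℝᵐ⁺¹`. -/
noncomputable def hyperplaneIncl (m : ℕ) : Space m →ₗᵢ[ℝ] Space (m + 1) where
  toFun y := WithLp.toLp 2 (Fin.cons 0 y.ofLp)
  map_add' x y := by
    ext i
    refine Fin.cases ?_ (fun j => ?_) i <;> simp
  map_smul' t y := by
    ext i
    refine Fin.cases ?_ (fun j => ?_) i <;> simp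
  norm_map' y := by
    simp [EuclideanSpace.norm_eq, Fin.sum_univ_succ]

@[simp] theorem hyperplaneIncl_zero_apply (y : Space m) : hyperplaneIncl m y 0 = 0 := rfl

@[simp] theorem hyperplaneIncl_succ_apply (y : Space m) (i : Fin m) :
    hyperplaneIncl m y i.succ = y i := rfl

theorem integral_fderiv_coordinate_halfSpace {f : Space (m + 1) → ℝ} (hf : ContDiff ℝ ∞ f)
    (hc : HasCompactSupport f) (w : Space (m + 1)) :
    ∫ x in {x : Space (m + 1) | x 0 ≤ 0}, fderiv ℝ f x w =
      w 0 * ∫ y : Space m, f (hyperplaneIncl m y) := by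
  obtain ⟨R, hR⟩ := hc.isCompact.isBounded.subset_ball (0 : Space (m + 1))
  have hR0 : ∀ x, R ≤ ‖x‖ → x ∉ tsupport f := fun x hx h => by
    have := hR h
    rw [mem_ball_zero_iff] at this
    linarith
  wlog hRpos : 0 < R generalizing R
  · exact this 1 (hR.trans (Metric.ball_subset_ball (by linarith)))
      (fun x hx => hR0 x (by linarith)) one_pos
  have hcoord : ∀ (x : Space (m + 1)) i, |x i| = R → f x = 0 := fun x i h =>
    image_eq_zero_of_notMem_tsupport (hR0 x (h ▸ PiLp.norm_apply_le x i))
  -- apply the divergence theorem to the field `f w` on the box `[-R, 0] × [-R, R]ᵐ`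
  let a : Fin (m + 1) → ℝ := fun _ => -R
  let b : Fin (m + 1) → ℝ := Fin.cons 0 fun _ => R
  have hab : a ≤ b := by
    intro i
    refine Fin.cases ?_ (fun j => ?_) i <;> simp [a, b] <;> linarith
  let L : (Fin (m + 1) → ℝ) →L[ℝ] Space (m + 1) :=
    (PiLp.continuousLinearEquiv 2 ℝ (fun _ : Fin (m + 1) => ℝ)).symm
  have hL : ∀ x, L x = WithLp.toLp 2 x := fun x => rfl
  have hfd : ∀ x : Fin (m + 1) → ℝ, HasFDerivAt (fun x => f (L x)) ((fderiv ℝ f (L x)).comp L) x :=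
    fun x => ((hf.differentiable (by simp) (L x)).hasFDerivAt).comp x L.hasFDerivAt
  have hdiv : ∀ x : Fin (m + 1) → ℝ, ∑ i, (ContinuousLinearMap.pi fun i =>
      w i • (fderiv ℝ f (L x)).comp L) (Pi.single i 1) i = fderiv ℝ f (L x) w := by
    intro x
    have hw : w = ∑ i, w i • L (Pi.single i 1) := by
      ext l
      simp [hL, Pi.single_apply]
    conv_rhs => rw [hw, map_sum]
    simp
  have hcont : Continuous fun x : Fin (m + 1) → ℝ => fderiv ℝ f (L x) w :=
    ((hf.continuous_fderiv (by simp)).comp L.continuous).clm_apply continuous_const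
  have key := integral_divergence_of_hasFDerivAt_off_countable a b hab
    (fun x i => w i * f (L x))
    (fun x => ContinuousLinearMap.pi fun i => w i • (fderiv ℝ f (L x)).comp L) ∅
    Set.countable_empty
    (continuous_pi fun i => continuous_const.mul (hf.continuous.comp L.continuous)).continuousOn
    (fun x _ => hasFDerivAt_pi.2 fun i => (hfd x).const_mul (w i))
    (by simp_rw [hdiv]; exact hcont.continuousOn.integrableOn_compact isCompact_Icc)
  simp_rw [hdiv] at key
  have hlhs : ∫ x in {x : Space (m + 1) | x 0 ≤ 0}, fderiv ℝ f x w =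
      ∫ x in Set.Icc a b, fderiv ℝ f (L x) w := by
    have h1 := (PiLp.volume_preserving_toLp (Fin (m + 1))).setIntegral_preimage_emb
      (MeasurableEquiv.toLp 2 _).measurableEmbedding
      (fun x : Space (m + 1) => fderiv ℝ f x w) {x | x 0 ≤ 0}
    rw [← h1]
    refine setIntegral_eq_of_subset_of_forall_sdiff_eq_zero ?_ ?_ ?_
    · exact measurableSet_le (measurable_pi_apply 0) measurable_const
    · intro x hx
      have := hx.2 0
      simpa [b] using this
    · rintro x ⟨hx0, hx⟩
      have hx0' : x 0 ≤ 0 := hx0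
      have h2 : WithLp.toLp 2 x ∉ tsupport f := by
        intro hmem
        refine hx ⟨fun i => ?_, fun i => ?_⟩
        · by_contra hlt
          refine hR0 _ ?_ hmem
          refine le_trans ?_ (PiLp.norm_apply_le (WithLp.toLp 2 x) i)
          simp only [a, not_le] at hlt
          change R ≤ |x i|
          rw [le_abs]; right; linarith
        · by_contra hlt
          refine hR0 _ ?_ hmem
          refine le_trans ?_ (PiLp.norm_apply_le (WithLp.toLp 2 x) i)
          change R ≤ |x i|
          rw [le_abs]; left
          revert hlt
          refine Fin.cases (fun h => ?_) (fun j h => ?_) i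
          · simp only [b, Fin.cons_zero] at h
            exact absurd hx0' h
          · simp only [b, Fin.cons_succ, not_le] at h
            exact h.le
      have h3 : fderiv ℝ f (WithLp.toLp 2 x) = 0 :=
        image_eq_zero_of_notMem_tsupport fun h => h2 (tsupport_fderiv_subset ℝ h)
      rw [h3]; rfl
  rw [hlhs, key, Fin.sum_univ_succ]
  have hzero : ∀ j : Fin m, ∀ t : ℝ, |t| = R → ∀ y : Fin m → ℝ,
      w j.succ * f (L (j.succ.insertNth t y)) = 0 := by
    intro j t ht y
    rw [hcoord (L (j.succ.insertNth t y)) j.succ, mul_zero]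
    rw [hL]
    simpa using ht
  have hzero' : ∀ y : Fin m → ℝ, w 0 * f (L ((0 : Fin (m + 1)).insertNth (-R) y)) = 0 := by
    intro y
    rw [hcoord (L ((0 : Fin (m + 1)).insertNth (-R) y)) 0, mul_zero]
    rw [hL]
    simp [abs_of_pos hRpos]
  have hb1 : ∀ j : Fin m, |b j.succ| = R := fun j => by simp [b, abs_of_pos hRpos]
  have ha1 : ∀ j, |a j| = R := fun j => by simp [a, abs_of_pos hRpos]
  rw [Finset.sum_eq_zero fun j _ => by
    simp_rw [hzero j _ (hb1 j), hzero j _ (ha1 j.succ)]; simp, add_zero]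
  simp_rw [show a 0 = -R from rfl, hzero']
  rw [integral_zero, sub_zero, show b 0 = 0 from rfl, integral_const_mul]
  congr 1
  rw [← (PiLp.volume_preserving_toLp (Fin m)).integral_comp
    (MeasurableEquiv.toLp 2 _).measurableEmbedding]
  have hsame : ∀ y : Fin m → ℝ, f (L ((0 : Fin (m + 1)).insertNth 0 y)) =
      f (hyperplaneIncl m (WithLp.toLp 2 y)) := by
    intro y
    rw [Fin.insertNth_zero']
    rfl
  simp_rw [hsame]
  refine setIntegral_eq_integral_of_forall_compl_eq_zero fun y hy => ?_
  refine image_eq_zero_of_notMem_tsupport fun hmem => hy ?_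
  have hn : ∀ i, |y i| ≤ R := fun i => by
    by_contra h
    refine hR0 _ ?_ hmem
    have := PiLp.norm_apply_le (hyperplaneIncl m (WithLp.toLp 2 y)) i.succ
    rw [hyperplaneIncl_succ_apply] at this
    exact (not_le.1 h).le.trans this
  refine ⟨fun i => ?_, fun i => ?_⟩
  · simpa [a] using (abs_le.1 (hn i)).1
  · simpa [b] using (abs_le.1 (hn i)).2

/-- The isometric parametrization by `ℝᵐ` of the hyperplane through `c` orthogonal to the image of
the zeroth unit vector under `A`. -/
noncomputable def hyperplaneMap (A : Space (m + 1) ≃ₗᵢ[ℝ] Space (m + 1)) (c : Space (m + 1))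
    (y : Space m) : Space (m + 1) := c + A (hyperplaneIncl m y)

theorem isometry_hyperplaneMap (A : Space (m + 1) ≃ₗᵢ[ℝ] Space (m + 1)) (c : Space (m + 1)) :
    Isometry (hyperplaneMap A c) :=
  (IsometryEquiv.addLeft c).isometry.comp (A.isometry.comp (hyperplaneIncl m).isometry)

theorem exists_rotation {n : Space (m + 1)} (hn : ‖n‖ = 1) :
    ∃ A : Space (m + 1) ≃ₗᵢ[ℝ] Space (m + 1), A (EuclideanSpace.single 0 1) = n :=
  ⟨_, Submodule.reflection_sub (by simp [hn])⟩

theorem inner_rotation {n : Space (m + 1)} {A : Space (m + 1) ≃ₗᵢ[ℝ] Space (m + 1)}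
    (hA : A (EuclideanSpace.single 0 1) = n) (z : Space (m + 1)) : inner ℝ n (A z) = z 0 := by
  rw [← hA, LinearIsometryEquiv.inner_map_map]
  simp [EuclideanSpace.inner_single_left]

/-- The closed half space through `c` with exterior normal `n`. -/
def halfSpace (n c : Space (m + 1)) : Set (Space (m + 1)) := {x | inner ℝ n (x - c) ≤ 0}

theorem measurableSet_halfSpace (n c : Space (m + 1)) : MeasurableSet (halfSpace n c) :=
  (isClosed_le (by fun_prop) continuous_const).measurableSet

theorem integral_pd_halfSpace {n : Space (m + 1)} {A : Space (m + 1) ≃ₗᵢ[ℝ] Space (m + 1)}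
    (hA : A (EuclideanSpace.single 0 1) = n) (c : Space (m + 1)) {f : Space (m + 1) → ℝ}
    (hf : ContDiff ℝ ∞ f) (hc : HasCompactSupport f) (j : Fin (m + 1)) :
    ∫ x in halfSpace n c, pd j f x = n j * ∫ y, f (hyperplaneMap A c y) := by
  let G : Space (m + 1) ≃ᵢ Space (m + 1) := A.toIsometryEquiv.trans (IsometryEquiv.addLeft c)
  have hG : ∀ z, G z = c + A z := fun z => rfl
  have hmp : MeasurePreserving G volume volume :=
    (measurePreserving_add_left volume c).comp A.measurePreserving
  have hpre : G ⁻¹' halfSpace n c = {z : Space (m + 1) | z 0 ≤ 0} := by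
    ext z
    simp only [Set.mem_preimage, halfSpace, Set.mem_ofPred_eq, hG, add_sub_cancel_left,
      inner_rotation hA]
  have hfG : ContDiff ℝ ∞ fun z => f (c + A z) :=
    hf.comp (contDiff_const.add A.contDiff)
  have h1 := integral_fderiv_coordinate_halfSpace hfG
    (hc.comp_isClosedEmbedding G.toHomeomorph.isClosedEmbedding)
    (A.symm (EuclideanSpace.single j 1))
  have h2 : ∀ z, fderiv ℝ (fun z => f (c + A z)) z (A.symm (EuclideanSpace.single j 1)) =
      pd j f (G z) := by
    intro z
    have h3 : HasFDerivAt (fun z => c + A z)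
        (A.toContinuousLinearEquiv : Space (m + 1) →L[ℝ] Space (m + 1)) z :=
      (A.toContinuousLinearEquiv.hasFDerivAt).const_add c
    have h4 := ((hf.differentiable (by simp) (c + A z)).hasFDerivAt.comp z h3).fderiv
    change fderiv ℝ (f ∘ fun z => c + A z) z _ = _
    rw [h4, pd, hG]
    simp
  have h5 : A.symm (EuclideanSpace.single j 1) 0 = n j := by
    rw [← inner_rotation hA, LinearIsometryEquiv.apply_symm_apply]
    simp [EuclideanSpace.inner_single_right]
  simp_rw [h2, h5] at h1
  rw [← hpre, hmp.setIntegral_preimage_emb G.toHomeomorph.measurableEmbedding] at h1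
  exact h1

theorem integral_pd_eq_zero {d : ℕ} {f : Space d → ℝ} (hf : ContDiff ℝ ∞ f)
    (hc : HasCompactSupport f) (j : Fin d) : ∫ x, pd j f x = 0 := by
  have h := IsTestFunction.integral_mul_pd (U := Set.univ) (φ := f) ⟨hf, hc, Set.subset_univ _⟩
    (g := fun _ => 1) contDiff_const j
  simpa [pd] using h

theorem integral_pd_compl_halfSpace {n : Space (m + 1)}
    {A : Space (m + 1) ≃ₗᵢ[ℝ] Space (m + 1)} (hA : A (EuclideanSpace.single 0 1) = n)
    (c : Space (m + 1)) {f : Space (m + 1) → ℝ} (hf : ContDiff ℝ ∞ f) (hc : HasCompactSupport f)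
    (j : Fin (m + 1)) :
    ∫ x in (halfSpace n c)ᶜ, pd j f x = (-n) j * ∫ y, f (hyperplaneMap A c y) := by
  have h1 := integral_add_compl (measurableSet_halfSpace n c)
    (((hf.pd j).continuous).integrable_of_hasCompactSupport (μ := volume) (hc.fderiv_apply ℝ _))
  rw [integral_pd_eq_zero hf hc, integral_pd_halfSpace hA c hf hc] at h1
  simp only [PiLp.neg_apply]
  linarith

end HalfSpace

/-! ### Elementwise integration by parts -/

section Parts

variable {d k : ℕ} {Ω B D : Set (Space d)} {T : Finset (Space d)} {uh : Space d → Space d}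
  {ph : Space d → ℝ}

/-- The pair `(u_h, p_h)` is given on the interior of `T` by polynomials of degree at most `k`. -/
def IsPolyOn (k : ℕ) (T : Finset (Space d)) (uh : Space d → Space d) (ph : Space d → ℝ) : Prop :=
  (∀ i, (localPoly T (comp uh i)).totalDegree ≤ k ∧ ∀ x ∈ interior (hull T),
    comp uh i x = MvPolynomial.eval x.ofLp (localPoly T (comp uh i))) ∧
  (localPoly T ph).totalDegree ≤ k ∧ ∀ x ∈ interior (hull T),
    ph x = MvPolynomial.eval x.ofLp (localPoly T ph)

/-- The contribution of the region `D` to the residual. -/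
noncomputable def residualOn (Ω D : Set (Space d)) (uh : Space d → Space d) (ph : Space d → ℝ)
    (v : Fin d → Space d → ℝ) : ℝ :=
  (∑ i, ∑ j, ∫ x in D, weakPartial Ω j (comp uh i) x * pd j (v i) x) -
    ∫ x in D, ph x * ∑ i, pd i (v i) x

theorem residual_eq_residualOn_univ {v : Fin d → Space d → ℝ}
    (hv : ∀ i, IsTestFunction Ω (v i)) :
    residual Ω uh ph v = residualOn Ω Set.univ uh ph v := by
  have hdiv : IsTestFunction Ω (fun x => ∑ i, pd i (v i) x) :=
    IsTestFunction.sum _ fun i => (hv i).pd i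
  unfold residual residualOn
  rw [hdiv.setIntegral_mul_eq_integral ph, setIntegral_univ]
  simp_rw [((hv _).pd _).setIntegral_mul_eq_integral, setIntegral_univ]

theorem IsTestFunction.integrable_mul {φ g : Space d → ℝ}
    (hφ : IsTestFunction Ω φ)
    (hg : MemLp g 2 (volume.restrict Ω)) : Integrable fun x => g x * φ x := by
  have h1 : IntegrableOn (fun x => g x * φ x) Ω := hg.integrable_mul (hφ.memLp 2 _)
  refine (integrableOn_iff_integrable_of_support_subset ?_).1 h1
  exact (Function.support_mul_subset_right g φ).trans ((subset_tsupport φ).trans hφ.2.2)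

theorem residual_eq_add_compl (hD : MeasurableSet D) (huh : VecMemH1 Ω uh)
    (hph : MemLp ph 2 (volume.restrict Ω)) {v : Fin d → Space d → ℝ}
    (hv : ∀ i, IsTestFunction Ω (v i)) :
    residual Ω uh ph v = residualOn Ω D uh ph v + residualOn Ω Dᶜ uh ph v := by
  have hdiv : IsTestFunction Ω (fun x => ∑ i, pd i (v i) x) :=
    IsTestFunction.sum _ fun i => (hv i).pd i
  rw [residual_eq_residualOn_univ hv]
  unfold residualOn
  simp_rw [setIntegral_univ]
  rw [← integral_add_compl hD (hdiv.integrable_mul hph),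
    Finset.sum_congr rfl fun i _ => Finset.sum_congr rfl fun j _ => (integral_add_compl hD
      (((hv i).pd j).integrable_mul ((huh i).hasWeakPartial j).1)).symm]
  simp_rw [Finset.sum_add_distrib]
  ring

/-- Where `D` meets the support of the test field inside `T`, the weak derivatives in the residual
are derivatives of polynomials. -/
theorem residualOn_eq_polynomial (hΩ : IsOpen Ω) (huh : VecMemH1 Ω uh) (hpoly : IsPolyOn k T uh ph)
    (hTΩ : interior (hull T) ⊆ Ω) (hDB : D ∩ B ⊆ hull T) {v : Fin d → Space d → ℝ}
    (hD : MeasurableSet D) (hv : ∀ i, IsTestFunction B (v i)) :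
    residualOn Ω D uh ph v =
      (∑ i, ∑ j, ∫ x in D, MvPolynomial.eval x.ofLp
        (MvPolynomial.pderiv j (localPoly T (comp uh i))) * pd j (v i) x) -
      ∫ x in D, MvPolynomial.eval x.ofLp (localPoly T ph) * ∑ i, pd i (v i) x := by
  have hdiv : IsTestFunction B (fun x => ∑ i, pd i (v i) x) :=
    IsTestFunction.sum _ fun i => (hv i).pd i
  -- the boundary of the convex set `hull T` is a null set
  have hint : ∀ᵐ x, x ∈ hull T → x ∈ interior (hull T) := by
    have h1 := (convex_convexHull ℝ (T : Set (Space d))).addHaar_frontier volume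
    filter_upwards [measure_eq_zero_iff_ae_notMem.1 h1] with x hx hxT
    by_contra h
    exact hx ⟨subset_closure hxT, h⟩
  unfold residualOn
  congr 1
  · refine Finset.sum_congr rfl fun i _ => Finset.sum_congr rfl fun j _ => ?_
    have h2 := (huh i).weakPartial_ae_eq_pd hΩ isOpen_interior hTΩ (contDiff_eval _)
      (hpoly.1 i).2 j
    rw [pd_eval, ae_restrict_iff' isOpen_interior.measurableSet] at h2
    refine setIntegral_congr_ae hD ?_
    filter_upwards [h2, hint] with x hx hxT hxD
    by_cases hxB : x ∈ B
    · rw [hx (hxT (hDB ⟨hxD, hxB⟩))]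
    · rw [((hv i).pd j).eq_zero_of_notMem hxB, mul_zero, mul_zero]
  · refine setIntegral_congr_ae hD ?_
    filter_upwards [hint] with x hxT hxD
    by_cases hxB : x ∈ B
    · rw [hpoly.2.2 x (hxT (hDB ⟨hxD, hxB⟩))]
    · rw [hdiv.eq_zero_of_notMem hxB, mul_zero, mul_zero]

theorem setIntegral_eval_mul_pd {μB : Measure (Space d)} {ν : Space d}
    (hμB : ∀ f : Space d → ℝ, ContDiff ℝ ∞ f → HasCompactSupport f → ∀ j,
      ∫ x in D, pd j f x = ν j * ∫ x, f x ∂μB)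
    (g : MvPolynomial (Fin d) ℝ) {φ : Space d → ℝ} (hφ : ContDiff ℝ ∞ φ)
    (hc : HasCompactSupport φ) (j : Fin d) :
    ∫ x in D, MvPolynomial.eval x.ofLp g * pd j φ x =
      ν j * ∫ x, MvPolynomial.eval x.ofLp g * φ x ∂μB -
        ∫ x in D, MvPolynomial.eval x.ofLp (MvPolynomial.pderiv j g) * φ x := by
  have h1 := hμB (fun x => MvPolynomial.eval x.ofLp g * φ x) ((contDiff_eval g).mul hφ)
    hc.mul_left j
  simp_rw [pd_mul (contDiff_eval g) hφ, pd_eval] at h1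
  rw [integral_add] at h1
  · linarith
  · exact (((contDiff_eval _).continuous.mul hφ.continuous).integrable_of_hasCompactSupport
      hc.mul_left).integrableOn
  · exact (((contDiff_eval _).continuous.mul (hφ.pd j).continuous).integrable_of_hasCompactSupport
      (HasCompactSupport.mul_left (f' := pd j φ) (hc.fderiv_apply ℝ _))).integrableOn

/-- Green's formula on a region `D` with boundary measure `μB` and constant exterior normal `ν`. -/
theorem residualOn_eq (hΩ : IsOpen Ω) (huh : VecMemH1 Ω uh) (hpoly : IsPolyOn k T uh ph)
    (hTΩ : interior (hull T) ⊆ Ω) (hDB : D ∩ B ⊆ hull T) {v : Fin d → Space d → ℝ}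
    (hD : MeasurableSet D) (hv : ∀ i, IsTestFunction B (v i)) {μB : Measure (Space d)}
    {ν : Space d}
    (hμB : ∀ f : Space d → ℝ, ContDiff ℝ ∞ f → HasCompactSupport f → ∀ j,
      ∫ x in D, pd j f x = ν j * ∫ x, f x ∂μB)
    (hint : ∀ f : Space d → ℝ, Continuous f → HasCompactSupport f → Integrable f μB) :
    residualOn Ω D uh ph v =
      (∑ i, ∫ x in D, MvPolynomial.eval x.ofLp (residualPoly T uh ph i) * v i x) +
        ∑ i, ∫ x, MvPolynomial.eval x.ofLp (fluxPoly T ν uh ph i) * v i x ∂μB := by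
  rw [residualOn_eq_polynomial hΩ huh hpoly hTΩ hDB hD hv]
  have hiD : ∀ (g : MvPolynomial (Fin d) ℝ) i,
      IntegrableOn (fun x => MvPolynomial.eval x.ofLp g * v i x) D := fun g i =>
    (((contDiff_eval _).continuous.mul (hv i).1.continuous).integrable_of_hasCompactSupport
      (hv i).2.1.mul_left).integrableOn
  have hiB : ∀ (g : MvPolynomial (Fin d) ℝ) i,
      Integrable (fun x => MvPolynomial.eval x.ofLp g * v i x) μB := fun g i =>
    hint _ ((contDiff_eval _).continuous.mul (hv i).1.continuous) (hv i).2.1.mul_left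
  have hpd : ∀ (g : MvPolynomial (Fin d) ℝ) i j, _ := fun g i j =>
    setIntegral_eval_mul_pd hμB g (hv i).1 (hv i).2.1 j
  have h1 : ∫ x in D, MvPolynomial.eval x.ofLp (localPoly T ph) * ∑ i, pd i (v i) x =
      ∑ i, ∫ x in D, MvPolynomial.eval x.ofLp (localPoly T ph) * pd i (v i) x := by
    simp_rw [Finset.mul_sum]
    refine integral_finsetSum _ fun i _ => ?_
    exact (((contDiff_eval _).continuous.mul
      ((hv i).pd i).1.continuous).integrable_of_hasCompactSupport
      (HasCompactSupport.mul_left ((hv i).pd i).2.1)).integrableOn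
  have h2 : ∀ i, ∫ x in D, MvPolynomial.eval x.ofLp (residualPoly T uh ph i) * v i x =
      -(∑ j, ∫ x in D, MvPolynomial.eval x.ofLp (MvPolynomial.pderiv j
        (MvPolynomial.pderiv j (localPoly T (comp uh i)))) * v i x) +
      ∫ x in D, MvPolynomial.eval x.ofLp (MvPolynomial.pderiv i (localPoly T ph)) * v i x := by
    intro i
    simp only [residualPoly, neg_add_eq_sub, map_sub, map_sum, sub_mul, Finset.sum_mul]
    rw [integral_sub (hiD _ i) (integrable_finsetSum _ fun j _ => hiD _ i),
      integral_finsetSum _ fun j _ => hiD _ i]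
  have h3 : ∀ i, ∫ x, MvPolynomial.eval x.ofLp (fluxPoly T ν uh ph i) * v i x ∂μB =
      (∑ j, ν j * ∫ x, MvPolynomial.eval x.ofLp
        (MvPolynomial.pderiv j (localPoly T (comp uh i))) * v i x ∂μB) -
      ν i * ∫ x, MvPolynomial.eval x.ofLp (localPoly T ph) * v i x ∂μB := by
    intro i
    simp only [fluxPoly, map_sub, map_mul, map_sum, MvPolynomial.eval_C, sub_mul, Finset.sum_mul,
      ← integral_const_mul]
    rw [← integral_finsetSum _ fun j _ => (hiB _ i).const_mul _, ← integral_sub]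
    · refine integral_congr_ae (ae_of_all _ fun x => ?_)
      simp only [mul_assoc]
      ring
    · exact integrable_finsetSum _ fun j _ => (hiB _ i).const_mul _
    · exact (hiB _ i).const_mul _
  rw [h1]
  simp_rw [h2, h3, hpd]
  simp only [Finset.sum_add_distrib, Finset.sum_sub_distrib, Finset.sum_neg_distrib]
  ring

end Parts

/-! ### Bubble functions -/

section Bubbles

variable {d k m : ℕ}

theorem integral_comp_scaling (f : Space d → ℝ) (c : Space d) {ρ : ℝ} (hρ : 0 < ρ) :
    ∫ x, f (ρ⁻¹ • (x - c)) = ρ ^ d * ∫ z, f z := by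
  rw [integral_sub_right_eq_self (fun x => f (ρ⁻¹ • x)) c,
    Measure.integral_comp_inv_smul_of_nonneg _ _ hρ.le]
  simp

theorem norm_le_sqrt_sum_sq {ι E : Type*} [Fintype ι] [SeminormedAddCommGroup E] (a : ι → E)
    (i : ι) : ‖a i‖ ≤ Real.sqrt (∑ i, ‖a i‖ ^ 2) :=
  Real.le_sqrt_of_sq_le (Finset.single_le_sum (f := fun i => ‖a i‖ ^ 2)
    (fun _ _ => sq_nonneg _) (Finset.mem_univ i))

/-- The bubble functions `v i` of polynomials `R i` on a ball of radius `ρ`: smooth functions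
supported in the ball, of size at most a multiple of `N`, and whose products with the polynomials
have integrals adding up to at least a multiple of `ρᵈ N²`. The number `N` is the norm of the
coefficients of the polynomials in the coordinates of the unit ball, and so it also bounds the
polynomials on the concentric ball of radius `ρ τ`. The constants are independent of the ball. -/
theorem exists_interior_bubbles (d k : ℕ) (τ : ℝ) :
    ∃ K c₀ : ℝ, 0 ≤ K ∧ 0 < c₀ ∧ ∀ {ι : Type} [Fintype ι] (c : Space d) (ρ : ℝ), 0 < ρ →
      ∀ R : ι → MvPolynomial (Fin d) ℝ, (∀ i, (R i).totalDegree ≤ k) →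
      ∃ (N : ℝ) (v : ι → Space d → ℝ), 0 ≤ N ∧ (∀ i, IsTestFunction (Metric.ball c ρ) (v i)) ∧
        (∀ i x, |v i x| ≤ K * N) ∧ (∀ i j x, |pd j (v i) x| ≤ K * ρ⁻¹ * N) ∧
        (∀ i j l x, |pd l (pd j (v i)) x| ≤ K * ρ⁻¹ ^ 2 * N) ∧
        c₀ * ρ ^ d * N ^ 2 ≤ ∑ i, ∫ x, MvPolynomial.eval x.ofLp (R i) * v i x ∧
        ∀ i x, ‖x - c‖ ≤ ρ * τ → |MvPolynomial.eval x.ofLp (R i)| ≤ K * N := by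
  set χ := cutoff d
  have hχ : ContDiff ℝ ∞ χ := χ.contDiff
  let ψ : (Fin d → Fin (k + 1)) → Space d → ℝ := fun α x => χ x * monomialFun α x
  have hψ : ∀ α, ContDiff ℝ ∞ (ψ α) := fun α => hχ.mul (contDiff_monomialFun α)
  have hψc : ∀ α, HasCompactSupport (ψ α) := fun α => χ.hasCompactSupport.mul_right
  have hψs : ∀ α, ∀ x ∉ Metric.closedBall (0 : Space d) (1 / 2), ψ α x = 0 := fun α x hx => by
    simp only [ψ, χ, cutoff_eq_zero hx, zero_mul]
  obtain ⟨K₁, hK₁, hb⟩ := exists_bound_scaledSum hψ hψc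
  obtain ⟨K₂, hK₂, hp⟩ := exists_bound_polyFun d k τ
  obtain ⟨c₀, hc₀, hq⟩ := exists_pos_mul_sq_le_integral k hχ χ.hasCompactSupport
    (fun _ => χ.nonneg) (by rw [cutoff_zero]; exact one_pos)
  refine ⟨K₁ + K₂, c₀, by positivity, hc₀, ?_⟩
  intro ι _ c ρ hρ R hR
  choose a ha using fun i => exists_polyFun_eq_eval_affine (hR i) c (ρ • LinearMap.id)
  set N := Real.sqrt (∑ i, ‖a i‖ ^ 2) with hN
  have hN0 : 0 ≤ N := Real.sqrt_nonneg _
  have haN : ∀ i, ‖a i‖ ≤ N := norm_le_sqrt_sum_sq a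
  have hRx : ∀ i x, MvPolynomial.eval x.ofLp (R i) = polyFun (a i) (ρ⁻¹ • (x - c)) := by
    intro i x
    rw [← ha]
    simp [smul_smul, inv_mul_cancel₀ hρ.ne']
  have hv : ∀ i x, scaledSum ψ (LinearIsometryEquiv.refl ℝ _) c ρ (a i) x =
      χ (ρ⁻¹ • (x - c)) * polyFun (a i) (ρ⁻¹ • (x - c)) := by
    intro i x
    have e : (LinearIsometryEquiv.refl ℝ (Space d)).symm (x - c) = x - c := rfl
    simp only [scaledSum, ψ, polyFun, Finset.mul_sum, e]
    exact Finset.sum_congr rfl fun α _ => by ring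
  have hle : ∀ (t : ℝ) i, 0 ≤ t → K₁ * t * ‖a i‖ ≤ (K₁ + K₂) * t * N := fun t i ht =>
    mul_le_mul (mul_le_mul_of_nonneg_right (by linarith) ht) (haN i) (norm_nonneg _)
      (by positivity)
  refine ⟨N, fun i => scaledSum ψ (LinearIsometryEquiv.refl ℝ _) c ρ (a i), hN0,
    fun i => isTestFunction_scaledSum hψ hψs _ c hρ _, fun i x => ?_, fun i j x => ?_,
    fun i j l x => ?_, ?_, fun i x hx => ?_⟩
  · simpa using (hb (LinearIsometryEquiv.refl ℝ _) c ρ hρ (a i) x).1.trans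
      (by simpa using hle 1 i zero_le_one)
  · exact ((hb (LinearIsometryEquiv.refl ℝ _) c ρ hρ (a i) x).2.1 j).trans
      (hle _ i (by positivity))
  · exact ((hb (LinearIsometryEquiv.refl ℝ _) c ρ hρ (a i) x).2.2 j l).trans
      (hle _ i (by positivity))
  · rw [hN, Real.sq_sqrt (Finset.sum_nonneg fun _ _ => sq_nonneg _), Finset.mul_sum]
    refine Finset.sum_le_sum fun i _ => ?_
    have h1 : ∫ x, MvPolynomial.eval x.ofLp (R i) *
        scaledSum ψ (LinearIsometryEquiv.refl ℝ _) c ρ (a i) x =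
        ρ ^ d * ∫ z, χ z * polyFun (a i) z ^ 2 := by
      rw [← integral_comp_scaling _ c hρ]
      refine integral_congr_ae (ae_of_all _ fun x => ?_)
      simp only [hRx, hv]
      ring
    rw [h1, mul_comm c₀, mul_assoc]
    exact mul_le_mul_of_nonneg_left (hq (a i)) (by positivity)
  · rw [hRx]
    refine (hp (a i) _ ?_).trans (mul_le_mul (by linarith) (haN i) (norm_nonneg _) (by positivity))
    rw [norm_smul, norm_inv, Real.norm_eq_abs, abs_of_pos hρ, inv_mul_le_iff₀ hρ]
    exact hx

/-- The bubble functions `v i` of polynomials `J i` on a piece of a hyperplane. They are built from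
the extension of the traces of the `J i` that is constant in the normal direction, so that their
size is controlled by the traces alone. -/
theorem exists_face_bubbles (m k : ℕ) (τ : ℝ) :
    ∃ K c₀ : ℝ, 0 ≤ K ∧ 0 < c₀ ∧ ∀ {ι : Type} [Fintype ι]
      (A : Space (m + 1) ≃ₗᵢ[ℝ] Space (m + 1)) (c : Space (m + 1)) (ρ : ℝ), 0 < ρ →
      ∀ J : ι → MvPolynomial (Fin (m + 1)) ℝ, (∀ i, (J i).totalDegree ≤ k) →
      ∃ (N : ℝ) (v : ι → Space (m + 1) → ℝ), 0 ≤ N ∧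
        (∀ i, IsTestFunction (Metric.ball c ρ) (v i)) ∧
        (∀ i x, |v i x| ≤ K * N) ∧ (∀ i j x, |pd j (v i) x| ≤ K * ρ⁻¹ * N) ∧
        (∀ i j l x, |pd l (pd j (v i)) x| ≤ K * ρ⁻¹ ^ 2 * N) ∧
        c₀ * ρ ^ m * N ^ 2 ≤ ∑ i, ∫ y, MvPolynomial.eval (hyperplaneMap A c y).ofLp (J i) *
          v i (hyperplaneMap A c y) ∧
        ∀ i y, ‖y‖ ≤ ρ * τ → |MvPolynomial.eval (hyperplaneMap A c y).ofLp (J i)| ≤ K * N := by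
  set χ := cutoff (m + 1)
  have hχ : ContDiff ℝ ∞ χ := χ.contDiff
  -- the projection along the zeroth coordinate
  let π : Space (m + 1) →L[ℝ] Space m :=
    LinearMap.toContinuousLinearMap
      { toFun := fun x => WithLp.toLp 2 fun i => x i.succ
        map_add' := fun _ _ => rfl
        map_smul' := fun _ _ => rfl }
  have hπ : ∀ y, π (hyperplaneIncl m y) = y := fun y => rfl
  let ψ : (Fin m → Fin (k + 1)) → Space (m + 1) → ℝ := fun α x => χ x * monomialFun α (π x)
  have hψ : ∀ α, ContDiff ℝ ∞ (ψ α) := fun α =>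
    hχ.mul ((contDiff_monomialFun α).comp π.contDiff)
  have hψc : ∀ α, HasCompactSupport (ψ α) := fun α => χ.hasCompactSupport.mul_right
  have hψs : ∀ α, ∀ x ∉ Metric.closedBall (0 : Space (m + 1)) (1 / 2), ψ α x = 0 :=
    fun α x hx => by simp only [ψ, χ, cutoff_eq_zero hx, zero_mul]
  let χ' : Space m → ℝ := fun y => χ (hyperplaneIncl m y)
  have hχ' : ContDiff ℝ ∞ χ' := hχ.comp (hyperplaneIncl m).contDiff
  have hχc : HasCompactSupport χ' := χ.hasCompactSupport.comp_isClosedEmbedding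
    (hyperplaneIncl m).isometry.isClosedEmbedding
  obtain ⟨K₁, hK₁, hb⟩ := exists_bound_scaledSum hψ hψc
  obtain ⟨K₂, hK₂, hp⟩ := exists_bound_polyFun m k τ
  obtain ⟨c₀, hc₀, hq⟩ := exists_pos_mul_sq_le_integral k hχ' hχc
    (fun _ => χ.nonneg) (by simp only [χ', map_zero, χ, cutoff_zero]; exact one_pos)
  refine ⟨K₁ + K₂, c₀, by positivity, hc₀, ?_⟩
  intro ι _ A c ρ hρ J hJ
  choose a ha using fun i => exists_polyFun_eq_eval_affine (hJ i) c
    (ρ • ((A : Space (m + 1) →ₗ[ℝ] Space (m + 1)) ∘ₗ (hyperplaneIncl m).toLinearMap))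
  set N := Real.sqrt (∑ i, ‖a i‖ ^ 2) with hN
  have hN0 : 0 ≤ N := Real.sqrt_nonneg _
  have haN : ∀ i, ‖a i‖ ≤ N := norm_le_sqrt_sum_sq a
  have hJy : ∀ i y, MvPolynomial.eval (hyperplaneMap A c y).ofLp (J i) =
      polyFun (a i) (ρ⁻¹ • y) := by
    intro i y
    rw [← ha]
    simp [smul_smul, inv_mul_cancel₀ hρ.ne', hyperplaneMap]
  have hv : ∀ i y, scaledSum ψ A c ρ (a i) (hyperplaneMap A c y) =
      χ' (ρ⁻¹ • y) * polyFun (a i) (ρ⁻¹ • y) := by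
    intro i y
    have e : ρ⁻¹ • A.symm (hyperplaneMap A c y - c) = hyperplaneIncl m (ρ⁻¹ • y) := by
      simp [hyperplaneMap]
    simp only [scaledSum, ψ, polyFun, Finset.mul_sum, e, hπ, χ']
    exact Finset.sum_congr rfl fun α _ => by ring
  have hle : ∀ (t : ℝ) i, 0 ≤ t → K₁ * t * ‖a i‖ ≤ (K₁ + K₂) * t * N := fun t i ht =>
    mul_le_mul (mul_le_mul_of_nonneg_right (by linarith) ht) (haN i) (norm_nonneg _)
      (by positivity)
  refine ⟨N, fun i => scaledSum ψ A c ρ (a i), hN0,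
    fun i => isTestFunction_scaledSum hψ hψs _ c hρ _, fun i x => ?_, fun i j x => ?_,
    fun i j l x => ?_, ?_, fun i y hy => ?_⟩
  · exact (hb A c ρ hρ (a i) x).1.trans (by simpa using hle 1 i zero_le_one)
  · exact ((hb A c ρ hρ (a i) x).2.1 j).trans (hle _ i (by positivity))
  · exact ((hb A c ρ hρ (a i) x).2.2 j l).trans (hle _ i (by positivity))
  · rw [hN, Real.sq_sqrt (Finset.sum_nonneg fun _ _ => sq_nonneg _), Finset.mul_sum]
    refine Finset.sum_le_sum fun i _ => ?_
    have h1 : ∫ y, MvPolynomial.eval (hyperplaneMap A c y).ofLp (J i) *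
        scaledSum ψ A c ρ (a i) (hyperplaneMap A c y) =
        ρ ^ m * ∫ z, χ' z * polyFun (a i) z ^ 2 := by
      rw [← integral_comp_scaling _ 0 hρ]
      refine integral_congr_ae (ae_of_all _ fun x => ?_)
      simp only [hJy, hv, sub_zero]
      ring
    rw [h1, mul_comm c₀, mul_assoc]
    exact mul_le_mul_of_nonneg_left (hq (a i)) (by positivity)
  · rw [hJy]
    refine (hp (a i) _ ?_).trans (mul_le_mul (by linarith) (haN i) (norm_nonneg _) (by positivity))
    rw [norm_smul, norm_inv, Real.norm_eq_abs, abs_of_pos hρ, inv_mul_le_iff₀ hρ]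
    exact hy

end Bubbles

/-! ### The element residual and the divergence -/

section LocalBounds

variable {d k : ℕ}

theorem lpNorm_two_restrict_le {α F : Type*} [MeasurableSpace α] [NormedAddCommGroup F]
    {μ : Measure α} {f : α → F} {s : Set α} (hμs : μ s ≠ ⊤)
    (hf : AEStronglyMeasurable f (μ.restrict s)) {K W : ℝ} (hK : 0 ≤ K) (hW : 0 ≤ W)
    (hsW : μ.real s ≤ W ^ 2) (hb : ∀ x ∈ s, ‖f x‖ ≤ K) :
    lpNorm f 2 (μ.restrict s) ≤ K * W := by
  refine lpNorm_two_le_of_integral_le hf (by positivity) ?_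
  refine (le_abs_self _).trans ?_
  have h := norm_setIntegral_le_of_norm_le_const (μ := μ) (f := fun x => ‖f x‖ ^ 2) hμs.lt_top
    (C := K ^ 2) fun x hx => by
      rw [norm_pow, norm_norm]
      exact pow_le_pow_left₀ (norm_nonneg _) (hb x hx) 2
  rw [Real.norm_eq_abs] at h
  rw [mul_pow]
  exact h.trans (mul_le_mul_of_nonneg_left hsW (by positivity))

theorem norm_le_of_abs_apply_le {x : Space d} {K : ℝ} (hK : 0 ≤ K) (h : ∀ i, |x i| ≤ K) :
    ‖x‖ ≤ d * K := by
  refine le_of_sq_le_sq ?_ (by positivity)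
  rw [EuclideanSpace.norm_sq_eq]
  refine (Finset.sum_le_sum fun i _ => pow_le_pow_left₀ (norm_nonneg _) (h i) 2).trans ?_
  rcases Nat.eq_zero_or_pos d with rfl | hd
  · simp
  · have : (1 : ℝ) ≤ d := by exact_mod_cast hd
    simp only [Finset.sum_const, Finset.card_univ, Fintype.card_fin, nsmul_eq_mul]
    rw [mul_pow]
    exact mul_le_mul_of_nonneg_right (by nlinarith) (by positivity)

/-- The volume of the unit ball. -/
noncomputable def unitBallVolume (d : ℕ) : ℝ := volume.real (Metric.ball (0 : Space d) 1)

theorem unitBallVolume_nonneg (d : ℕ) : 0 ≤ unitBallVolume d := measureReal_nonneg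

theorem volume_real_closedBall (c : Space d) {r : ℝ} (hr : 0 ≤ r) :
    volume.real (Metric.closedBall c r) = r ^ d * unitBallVolume d := by
  rw [Measure.addHaar_real_closedBall volume c hr]
  simp [unitBallVolume]

theorem volume_closedBall_ne_top (c : Space d) (r : ℝ) :
    volume (Metric.closedBall c r) ≠ ⊤ :=
  (isCompact_closedBall c r).measure_lt_top.ne

theorem mul_le_of_mul_sq_le {c w N X : ℝ} (hw : 0 < w) (hN : 0 ≤ N) (hX : 0 ≤ X)
    (h : c * w ^ 2 * N ^ 2 ≤ X * w * N) : c * w * N ≤ X := by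
  rcases hN.eq_or_lt with rfl | hN
  · simpa using hX
  · refine le_of_mul_le_mul_right ?_ (mul_pos hw hN)
    linarith

variable {Ω U D B : Set (Space d)} {T : Finset (Space d)}
  {uh : Space d → Space d} {ph : Space d → ℝ}

theorem continuous_elemResidual (T : Finset (Space d)) (uh : Space d → Space d)
    (ph : Space d → ℝ) : Continuous (elemResidual T uh ph) := by
  have h : elemResidual T uh ph = fun x => WithLp.toLp 2 fun i =>
      MvPolynomial.eval x.ofLp (residualPoly T uh ph i) := by
    funext x
    ext i
    exact elemResidual_apply uh ph x i
  rw [h]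
  exact (PiLp.continuous_toLp 2 _).comp
    (continuous_pi fun i => (contDiff_eval (residualPoly T uh ph i)).continuous)

theorem continuous_elemDiv (T : Finset (Space d)) (uh : Space d → Space d) :
    Continuous (elemDiv T uh) := by
  have h : elemDiv T uh = fun x => MvPolynomial.eval x.ofLp (divPoly T uh) :=
    funext fun x => elemDiv_apply uh x
  rw [h]
  exact (contDiff_eval _).continuous

theorem memLp_hull_of_continuous {F : Type*} [NormedAddCommGroup F]
    (T : Finset (Space d)) {f : Space d → F} (hf : Continuous f) :
    MemLp f 2 (volume.restrict (hull T)) := by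
  have hT : IsCompact (hull T) := T.finite_toSet.isCompact_convexHull ℝ
  have : IsFiniteMeasure (volume.restrict (hull T)) := ⟨by simpa using hT.measure_lt_top⟩
  obtain ⟨C, hC⟩ := hT.exists_bound_of_continuousOn hf.continuousOn
  exact MemLp.of_bound hf.aestronglyMeasurable C
    ((ae_restrict_iff' (isClosed_hull T).measurableSet).2 (ae_of_all _ hC))

/-- The integral of a component of the element residual against a test function, over a region
inside the element. -/
theorem abs_setIntegral_residualPoly_mul_le (hD : MeasurableSet D) (hDB : D ∩ B ⊆ hull T)
    {φ : Space d → ℝ} (hφ : IsTestFunction B φ) {s : Set (Space d)} (hs : MeasurableSet s)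
    (hμs : volume s ≠ ⊤) {K W : ℝ} (hK : 0 ≤ K) (hW : 0 ≤ W) (hsW : volume.real s ≤ W ^ 2)
    (hφs : tsupport φ ⊆ s) (hφK : ∀ x, |φ x| ≤ K) (i : Fin d) :
    |∫ x in D, MvPolynomial.eval x.ofLp (residualPoly T uh ph i) * φ x| ≤
      l2Norm (hull T) (elemResidual T uh ph) * (K * W) := by
  have hmem := memLp_hull_of_continuous T (continuous_elemResidual T uh ph)
  have h1 : ∫ x in D, MvPolynomial.eval x.ofLp (residualPoly T uh ph i) * φ x =
      ∫ x in hull T, comp (elemResidual T uh ph) i x * D.indicator φ x := by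
    have h2 : ∀ x, D.indicator
        (fun x => MvPolynomial.eval x.ofLp (residualPoly T uh ph i) * φ x) x =
        comp (elemResidual T uh ph) i x * D.indicator φ x := by
      intro x
      rw [comp, elemResidual_apply]
      by_cases hx : x ∈ D <;> simp [hx]
    rw [← integral_indicator hD, integral_congr_ae (ae_of_all _ h2)]
    refine (setIntegral_eq_integral_of_forall_compl_eq_zero fun x hx => ?_).symm
    by_cases hxD : x ∈ D
    · have hxB : x ∉ B := fun h => hx (hDB ⟨hxD, h⟩)
      rw [Set.indicator_of_mem hxD, hφ.eq_zero_of_notMem hxB, mul_zero]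
    · rw [Set.indicator_of_notMem hxD, mul_zero]
  have hφm : MemLp (D.indicator φ) 2 (volume.restrict (hull T)) := (hφ.memLp 2 _).indicator hD
  rw [h1]
  refine (abs_integral_mul_le_lpNorm_mul_lpNorm (hmem.eval_piLp i) hφm).trans ?_
  refine mul_le_mul (lpNorm_comp_le hmem i) ?_ lpNorm_nonneg lpNorm_nonneg
  refine lpNorm_two_le_of_bounded hs ?_ hφm.1 hK hW ?_ (fun x => ?_) fun x hx => ?_
  · exact ((Measure.restrict_apply_le _ _).trans_lt hμs.lt_top).ne
  · exact (ENNReal.toReal_mono hμs (Measure.restrict_apply_le _ _)).trans hsW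
  · by_cases hxD : x ∈ D
    · rw [Set.indicator_of_mem hxD]; exact hφK x
    · rw [Set.indicator_of_notMem hxD, norm_zero]; exact hK
  · by_cases hxD : x ∈ D
    · rw [Set.indicator_of_mem hxD]
      exact image_eq_zero_of_notMem_tsupport fun h => hx (hφs h)
    · rw [Set.indicator_of_notMem hxD]

theorem inv_le_mul_inv_sq {ρ D : ℝ} (hρ : 0 < ρ) (hD : ρ ≤ D) : ρ⁻¹ ≤ (1 + D) * ρ⁻¹ ^ 2 := by
  have h1 : ρ⁻¹ = ρ * ρ⁻¹ ^ 2 := by field_simp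
  have h2 : 0 ≤ ρ⁻¹ ^ 2 := by positivity
  calc ρ⁻¹ = ρ * ρ⁻¹ ^ 2 := h1
    _ ≤ (1 + D) * ρ⁻¹ ^ 2 := mul_le_mul_of_nonneg_right (by linarith) h2

/-- The residual at bubble functions of size `N` on a ball of radius `ρ`. -/
theorem IsStokesSolution.abs_residual_bubble_le {Eg u : Space d → Space d} {p : Space d → ℝ}
    (hsol : IsStokesSolution Ω Eg u p) (hΩ : IsOpen Ω) (hU : IsOpen U) (hUΩ : U ⊆ Ω)
    (huh : VecMemH1 Ω uh) (hph : MemLp ph 2 (volume.restrict Ω)) {c : Space d} {ρ Δ K N : ℝ}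
    (hρ : 0 < ρ) (hρΔ : ρ ≤ Δ) (hK : 0 ≤ K) (hN : 0 ≤ N) (hBU : Metric.ball c ρ ⊆ U)
    {v : Fin d → Space d → ℝ} (hv : ∀ i, IsTestFunction (Metric.ball c ρ) (v i))
    (h1 : ∀ i j x, |pd j (v i) x| ≤ K * ρ⁻¹ * N)
    (h2 : ∀ i j l x, |pd l (pd j (v i)) x| ≤ K * ρ⁻¹ ^ 2 * N) :
    |residual Ω uh ph v| ≤ (2 * d ^ 2 + d) * (K * ((1 + Δ) * ρ⁻¹ ^ 2) * N) *
      (Real.sqrt (ρ ^ d) * Real.sqrt (unitBallVolume d)) *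
      (l2Norm U (u - uh) + hNegOneNorm U (p - ph)) := by
  have hΔ : 0 ≤ 1 + Δ := by linarith
  refine hsol.abs_residual_le hΩ hU hUΩ huh hph (fun i => (hv i).mono hBU)
    (s := Metric.closedBall c ρ) Metric.isClosed_closedBall.measurableSet
    (volume_closedBall_ne_top c ρ) (by positivity) (by positivity) ?_
    (fun i => (hv i).2.2.trans Metric.ball_subset_closedBall) (fun i j x => ?_)
    fun i j l x => ?_
  · rw [volume_real_closedBall c hρ.le, mul_pow, Real.sq_sqrt (by positivity),
      Real.sq_sqrt (unitBallVolume_nonneg d)]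
  · refine (h1 i j x).trans ?_
    gcongr
    exact inv_le_mul_inv_sq hρ hρΔ
  · refine (h2 i j l x).trans ?_
    have h3 : 0 ≤ ρ⁻¹ ^ 2 := by positivity
    gcongr
    exact le_mul_of_one_le_left h3 (by linarith)

/-- The element residual is bounded by the local error. Here `τ` measures the shape of the element,
and the upper bound `H` for its size is needed since the dual norm is not homogeneous under
scaling. -/
theorem exists_elemResidual_bound (d k : ℕ) {τ H : ℝ} (hτ : 0 < τ) (hH : 0 ≤ H) :
    ∃ C : ℝ, 0 ≤ C ∧ ∀ {Ω U : Set (Space d)} {T : Finset (Space d)} {Eg u uh : Space d → Space d}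
      {p ph : Space d → ℝ}, IsStokesSolution Ω Eg u p → IsOpen Ω → IsOpen U → U ⊆ Ω →
      VecMemH1 Ω uh → MemLp ph 2 (volume.restrict Ω) → IsPolyOn k T uh ph →
      interior (hull T) ⊆ Ω → ∀ {c : Space d} {h : ℝ}, 0 < h → h ≤ H →
      Metric.ball c (τ * h) ⊆ hull T → Metric.ball c (τ * h) ⊆ U →
      hull T ⊆ Metric.closedBall c h →
      h ^ 2 * l2Norm (hull T) (elemResidual T uh ph) ≤
        C * (l2Norm U (u - uh) + hNegOneNorm U (p - ph)) := by
  obtain ⟨K, c₀, hK, hc₀, hbub⟩ := exists_interior_bubbles d k τ⁻¹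
  set κ := Real.sqrt (unitBallVolume d) with hκ
  have hκ0 : 0 ≤ κ := Real.sqrt_nonneg _
  set θ := Real.sqrt (τ⁻¹ ^ d) with hθ
  have hθ0 : 0 ≤ θ := Real.sqrt_nonneg _
  refine ⟨τ⁻¹ ^ 2 * (d * K) * (θ * κ) * ((2 * d ^ 2 + d) * (K * (1 + τ * H)) * κ / c₀),
    by positivity, ?_⟩
  intro Ω U T Eg u uh p ph hsol hΩ hU hUΩ huh hph hpoly hTΩ c h hh hhH hball hballU hTc
  set ρ := τ * h with hρdef
  have hρ : 0 < ρ := by positivity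
  have hhρ : h = τ⁻¹ * ρ := by rw [hρdef]; field_simp
  set S := l2Norm U (u - uh) + hNegOneNorm U (p - ph) with hS
  have hS0 : 0 ≤ S := add_nonneg lpNorm_nonneg (hNegOneNorm_nonneg hU
    ((hsol.pressure_mem.1.sub hph).mono_measure (Measure.restrict_mono hUΩ le_rfl)))
  obtain ⟨N, v, hN, hv, -, hv1, hv2, hlow, hup⟩ := hbub c ρ hρ (residualPoly T uh ph)
    (totalDegree_residualPoly_le (fun i => (hpoly.1 i).1) hpoly.2.1)
  set w := Real.sqrt (ρ ^ d) with hw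
  have hw0 : 0 < w := Real.sqrt_pos.2 (by positivity)
  have hw2 : w ^ 2 = ρ ^ d := Real.sq_sqrt (by positivity)
  have hres : residual Ω uh ph v =
      ∑ i, ∫ x, MvPolynomial.eval x.ofLp (residualPoly T uh ph i) * v i x := by
    rw [residual_eq_residualOn_univ fun i => (hv i).mono (hballU.trans hUΩ),
      residualOn_eq (μB := 0) (ν := 0) hΩ huh hpoly hTΩ (Set.inter_subset_right.trans hball)
        MeasurableSet.univ hv (fun f hf hc j => by
          rw [setIntegral_univ, integral_pd_eq_zero hf hc]; simp)
        (fun f _ _ => integrable_zero_measure)]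
    simp
  have h1 := (le_abs_self _).trans (hsol.abs_residual_bubble_le hΩ hU hUΩ huh hph hρ
    (mul_le_mul_of_nonneg_left hhH hτ.le) hK hN hballU hv hv1 hv2)
  rw [hres] at h1
  have h2 : c₀ * w * N ≤ (2 * d ^ 2 + d) * (K * (1 + τ * H)) * κ * S * ρ⁻¹ ^ 2 := by
    refine mul_le_of_mul_sq_le hw0 hN (by positivity) ?_
    rw [hw2]
    refine (hlow.trans h1).trans (le_of_eq ?_)
    ring
  have h3 : l2Norm (hull T) (elemResidual T uh ph) ≤ (d * (K * N)) * (θ * κ * w) := by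
    have hvol : volume.real (hull T) ≤ (θ * κ * w) ^ 2 := by
      refine (measureReal_mono hTc (volume_closedBall_ne_top c h)).trans (le_of_eq ?_)
      rw [volume_real_closedBall c hh.le, mul_pow, mul_pow, hw2, hθ, hκ,
        Real.sq_sqrt (by positivity), Real.sq_sqrt (unitBallVolume_nonneg d), hhρ, mul_pow]
      ring
    refine lpNorm_two_restrict_le
      ((T.finite_toSet.isCompact_convexHull ℝ).measure_lt_top.ne)
      (continuous_elemResidual T uh ph).aestronglyMeasurable (by positivity) (by positivity) hvol
      fun x hx => norm_le_of_abs_apply_le (by positivity) fun i => ?_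
    rw [elemResidual_apply]
    refine hup i x ?_
    rw [mul_comm, ← hhρ, ← dist_eq_norm]
    exact hTc hx
  calc h ^ 2 * l2Norm (hull T) (elemResidual T uh ph)
      ≤ (τ⁻¹ * ρ) ^ 2 * ((d * (K * N)) * (θ * κ * w)) := by rw [hhρ]; gcongr
    _ = τ⁻¹ ^ 2 * (d * K) * (θ * κ) * ρ ^ 2 / c₀ * (c₀ * w * N) := by field_simp
    _ ≤ τ⁻¹ ^ 2 * (d * K) * (θ * κ) * ρ ^ 2 / c₀ *
        ((2 * d ^ 2 + d) * (K * (1 + τ * H)) * κ * S * ρ⁻¹ ^ 2) := by gcongr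
    _ = _ := by field_simp

/-- The divergence of the discrete velocity, tested with a smooth function. -/
theorem IsStokesSolution.integral_divPoly_mul_eq {Eg u : Space d → Space d} {p : Space d → ℝ}
    (hsol : IsStokesSolution Ω Eg u p) (hΩ : IsOpen Ω) (hUΩ : U ⊆ Ω)
    (huh : VecMemH1 Ω uh) (hpoly : IsPolyOn k T uh ph) (hTΩ : interior (hull T) ⊆ Ω)
    (hBT : B ⊆ interior (hull T)) (hBU : B ⊆ U) {φ : Space d → ℝ} (hφ : IsTestFunction B φ) :
    ∫ x, MvPolynomial.eval x.ofLp (divPoly T uh) * φ x =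
      ∑ i, ∫ x in U, comp (u - uh) i x * pd i φ x := by
  have hφT := hφ.mono hBT
  have hφU := hφ.mono hBU
  have hφΩ := hφU.mono hUΩ
  have h1 : ∫ x, MvPolynomial.eval x.ofLp (divPoly T uh) * φ x =
      ∫ x in Ω, weakDiv Ω uh x * φ x := by
    rw [hφΩ.setIntegral_mul_eq_integral, ← hφT.setIntegral_mul_eq_integral,
      ← hφT.setIntegral_mul_eq_integral]
    refine integral_congr_ae ?_
    filter_upwards [ae_all_iff.2 fun i => (huh i).weakPartial_ae_eq_pd hΩ isOpen_interior hTΩ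
      (contDiff_eval _) (hpoly.1 i).2 i] with x hx
    simp only [weakDiv, divPoly, map_sum, hx, pd_eval]
  have h2 : ∫ x in Ω, weakDiv Ω u x * φ x = 0 := by
    refine integral_eq_zero_of_ae ?_
    filter_upwards [hsol.incompressible] with x hx
    rw [hx, zero_mul]; rfl
  have h3 : ∀ {z : Space d → Space d}, VecMemH1 Ω z →
      ∫ x in Ω, weakDiv Ω z x * φ x = -∑ i, ∫ x in U, comp z i x * pd i φ x := by
    intro z hz
    simp only [weakDiv, Finset.sum_mul]
    have hint : ∀ i, Integrable (fun x => weakPartial Ω i (comp z i) x * φ x)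
        (volume.restrict Ω) := fun i =>
      ((hz i).hasWeakPartial i).1.integrable_mul (hφΩ.memLp 2 _)
    rw [integral_finsetSum _ fun i _ => hint i, ← Finset.sum_neg_distrib]
    refine Finset.sum_congr rfl fun i _ => ?_
    rw [← (hφU.pd i).setIntegral_mul_eq_of_subset hUΩ hΩ.measurableSet, eq_neg_iff_add_eq_zero,
      add_comm, ← eq_neg_iff_add_eq_zero]
    exact ((hz i).hasWeakPartial i).2 φ hφΩ
  rw [h1, h3 huh]
  rw [h3 hsol.velocity_mem] at h2
  have h4 : ∀ i, ∫ x in U, comp (u - uh) i x * pd i φ x =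
      (∫ x in U, comp u i x * pd i φ x) - ∫ x in U, comp uh i x * pd i φ x := by
    intro i
    have hint : ∀ {z : Space d → Space d}, VecMemH1 Ω z →
        Integrable (fun x => comp z i x * pd i φ x) (volume.restrict U) := fun hz =>
      ((hz i).1.mono_measure (Measure.restrict_mono hUΩ le_rfl)).integrable_mul
        ((hφU.pd i).memLp 2 _)
    rw [← integral_sub (hint hsol.velocity_mem) (hint huh)]
    refine integral_congr_ae (ae_of_all _ fun x => ?_)
    simp only [comp, Pi.sub_apply, PiLp.sub_apply]
    ring
  simp_rw [h4, Finset.sum_sub_distrib]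
  linarith

/-- The divergence of the discrete velocity is bounded by the local velocity error. -/
theorem exists_elemDiv_bound (d k : ℕ) {τ : ℝ} (hτ : 0 < τ) :
    ∃ C : ℝ, 0 ≤ C ∧ ∀ {Ω U : Set (Space d)} {T : Finset (Space d)} {Eg u uh : Space d → Space d}
      {p ph : Space d → ℝ}, IsStokesSolution Ω Eg u p → IsOpen Ω → U ⊆ Ω →
      VecMemH1 Ω uh → IsPolyOn k T uh ph →
      interior (hull T) ⊆ Ω → ∀ {c : Space d} {h : ℝ}, 0 < h →
      Metric.ball c (τ * h) ⊆ hull T → Metric.ball c (τ * h) ⊆ U →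
      hull T ⊆ Metric.closedBall c h →
      h * l2Norm (hull T) (elemDiv T uh) ≤ C * l2Norm U (u - uh) := by
  obtain ⟨K, c₀, hK, hc₀, hbub⟩ := exists_interior_bubbles d k τ⁻¹
  set κ := Real.sqrt (unitBallVolume d) with hκ
  have hκ0 : 0 ≤ κ := Real.sqrt_nonneg _
  set θ := Real.sqrt (τ⁻¹ ^ d) with hθ
  have hθ0 : 0 ≤ θ := Real.sqrt_nonneg _
  refine ⟨τ⁻¹ * K * (θ * κ) * (d * K * κ / c₀), by positivity, ?_⟩
  intro Ω U T Eg u uh p ph hsol hΩ hUΩ huh hpoly hTΩ c h hh hball hballU hTc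
  set ρ := τ * h with hρdef
  have hρ : 0 < ρ := by positivity
  have hhρ : h = τ⁻¹ * ρ := by rw [hρdef]; field_simp
  set S := l2Norm U (u - uh) with hS
  have hS0 : 0 ≤ S := lpNorm_nonneg
  obtain ⟨N, v, hN, hv, -, hv1, -, hlow, hup⟩ := hbub (ι := Unit) c ρ hρ (fun _ => divPoly T uh)
    fun _ => totalDegree_divPoly_le fun i => (hpoly.1 i).1
  have hv := hv ()
  set w := Real.sqrt (ρ ^ d) with hw
  have hw0 : 0 < w := Real.sqrt_pos.2 (by positivity)
  have hw2 : w ^ 2 = ρ ^ d := Real.sq_sqrt (by positivity)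
  have huU : MemLp (u - uh) 2 (volume.restrict U) := memLp_of_comp fun i =>
    ((hsol.velocity_mem i).1.sub (huh i).1).mono_measure (Measure.restrict_mono hUΩ le_rfl)
  have h1 : ∀ i, ∫ x in U, comp (u - uh) i x * pd i (v ()) x ≤
      S * (K * ρ⁻¹ * N * (w * κ)) := by
    intro i
    have hm := ((hv.pd i).memLp 2 (volume.restrict U))
    refine (le_abs_self _).trans ((abs_integral_mul_le_lpNorm_mul_lpNorm
      (huU.eval_piLp i) hm).trans ?_)
    refine mul_le_mul (lpNorm_comp_le huU i) ?_ lpNorm_nonneg hS0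
    refine lpNorm_two_le_of_bounded (s := Metric.closedBall c ρ)
      Metric.isClosed_closedBall.measurableSet ?_ hm.1 (by positivity) (by positivity) ?_
      (fun x => hv1 () i x) fun x hx => ?_
    · exact ((Measure.restrict_apply_le _ _).trans_lt (volume_closedBall_ne_top c ρ).lt_top).ne
    · refine (ENNReal.toReal_mono (volume_closedBall_ne_top c ρ)
        (Measure.restrict_apply_le _ _)).trans ?_
      refine (volume_real_closedBall c hρ.le).le.trans (le_of_eq ?_)
      rw [mul_pow w, hw2, hκ, Real.sq_sqrt (unitBallVolume_nonneg d)]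
    · exact (hv.pd i).eq_zero_of_notMem fun h => hx (Metric.ball_subset_closedBall h)
  have h2 : c₀ * w * N ≤ d * K * κ * S * ρ⁻¹ := by
    refine mul_le_of_mul_sq_le hw0 hN (by positivity) ?_
    rw [hw2]
    refine hlow.trans ?_
    rw [Fintype.sum_unique]
    rw [hsol.integral_divPoly_mul_eq hΩ hUΩ huh hpoly hTΩ
      (interior_maximal hball Metric.isOpen_ball) hballU hv]
    refine (Finset.sum_le_sum fun i _ => h1 i).trans (le_of_eq ?_)
    simp only [Finset.sum_const, Finset.card_univ, Fintype.card_fin, nsmul_eq_mul]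
    ring
  have h3 : l2Norm (hull T) (elemDiv T uh) ≤ K * N * (θ * κ * w) := by
    have hvol : volume.real (hull T) ≤ (θ * κ * w) ^ 2 := by
      refine (measureReal_mono hTc (volume_closedBall_ne_top c h)).trans (le_of_eq ?_)
      rw [volume_real_closedBall c hh.le, mul_pow, mul_pow, hw2, hθ, hκ,
        Real.sq_sqrt (by positivity), Real.sq_sqrt (unitBallVolume_nonneg d), hhρ, mul_pow]
      ring
    refine lpNorm_two_restrict_le
      ((T.finite_toSet.isCompact_convexHull ℝ).measure_lt_top.ne)
      (continuous_elemDiv T uh).aestronglyMeasurable (by positivity) (by positivity) hvol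
      fun x hx => ?_
    rw [elemDiv_apply]
    refine hup () x ?_
    rw [mul_comm, ← hhρ, ← dist_eq_norm]
    exact hTc hx
  calc h * l2Norm (hull T) (elemDiv T uh)
      ≤ (τ⁻¹ * ρ) * (K * N * (θ * κ * w)) := by rw [hhρ]; gcongr
    _ = τ⁻¹ * K * (θ * κ) * ρ / c₀ * (c₀ * w * N) := by field_simp
    _ ≤ τ⁻¹ * K * (θ * κ) * ρ / c₀ * (d * K * κ * S * ρ⁻¹) := by gcongr
    _ = _ := by field_simp

end LocalBounds

/-! ### The jump terms -/

section Faces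

variable {m k : ℕ}

/-- The surface measure of a hyperplane is the Lebesgue measure of an isometric
parametrization. -/
theorem map_hyperplaneMap_volume (A : Space (m + 1) ≃ₗᵢ[ℝ] Space (m + 1)) (c : Space (m + 1)) :
    Measure.map (hyperplaneMap A c) volume =
      (Measure.euclideanHausdorffMeasure m).restrict (Set.range (hyperplaneMap A c)) := by
  rw [← (isometry_hyperplaneMap A c).map_euclideanHausdorffMeasure,
    EuclideanSpace.euclideanHausdorffMeasure_eq_volume]

theorem mem_range_hyperplaneMap {n : Space (m + 1)} {A : Space (m + 1) ≃ₗᵢ[ℝ] Space (m + 1)}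
    (hA : A (EuclideanSpace.single 0 1) = n) {c x : Space (m + 1)}
    (hx : inner ℝ n (x - c) = 0) : x ∈ Set.range (hyperplaneMap A c) := by
  refine ⟨WithLp.toLp 2 fun i => A.symm (x - c) i.succ, ?_⟩
  have h0 : A.symm (x - c) 0 = 0 := by
    rw [← inner_rotation hA, LinearIsometryEquiv.apply_symm_apply, hx]
  have h1 : hyperplaneIncl m (WithLp.toLp 2 fun i => A.symm (x - c) i.succ) = A.symm (x - c) := by
    ext i
    refine Fin.cases ?_ (fun j => ?_) i
    · rw [h0, hyperplaneIncl_zero_apply]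
    · rfl
  rw [hyperplaneMap, h1, LinearIsometryEquiv.apply_symm_apply, add_sub_cancel]

theorem faceNorm_sq_le {n : Space (m + 1)} {A : Space (m + 1) ≃ₗᵢ[ℝ] Space (m + 1)}
    (hA : A (EuclideanSpace.single 0 1) = n) {e : Finset (Space (m + 1))} {c : Space (m + 1)}
    (he : ∀ x ∈ hull e, inner ℝ n (x - c) = 0) {h : ℝ} (hh : 0 ≤ h)
    (heh : ∀ x ∈ hull e, ‖x - c‖ ≤ h) {J : Space (m + 1) → Space (m + 1)} (hJ : Continuous J)
    {B : ℝ} (hB : 0 ≤ B) (hJB : ∀ y, ‖y‖ ≤ h → ‖J (hyperplaneMap A c y)‖ ≤ B) :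
    faceNorm e J ^ 2 ≤ B ^ 2 * (h ^ m * unitBallVolume m) := by
  set g := hyperplaneMap A c
  have hg : Isometry g := isometry_hyperplaneMap A c
  have hnorm : ∀ y, ‖g y - c‖ = ‖y‖ := fun y => by simp [g, hyperplaneMap]
  have hemb : MeasurableEmbedding g := hg.isClosedEmbedding.measurableEmbedding
  have hμ : (Measure.euclideanHausdorffMeasure (m + 1 - 1)).restrict (hull e) =
      (Measure.map g volume).restrict (hull e) := by
    rw [map_hyperplaneMap_volume, Measure.restrict_restrict (isClosed_hull e).measurableSet,
      Set.inter_eq_left.2 fun x hx => mem_range_hyperplaneMap hA (he x hx)]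
    rfl
  unfold faceNorm
  rw [hμ]
  have hsub : g ⁻¹' hull e ⊆ Metric.closedBall 0 h := fun y hy => by
    rw [mem_closedBall_zero_iff, ← hnorm]
    exact heh _ hy
  have hfin : (Measure.map g volume) (hull e) ≠ ⊤ := by
    rw [hemb.map_apply]
    exact ((measure_mono hsub).trans_lt (volume_closedBall_ne_top 0 h).lt_top).ne
  have hreal : (Measure.map g volume).real (hull e) ≤ h ^ m * unitBallVolume m := by
    rw [measureReal_def, hemb.map_apply, ← volume_real_closedBall 0 hh]
    exact measureReal_mono hsub (volume_closedBall_ne_top 0 h)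
  have hκ : 0 ≤ h ^ m * unitBallVolume m :=
    mul_nonneg (pow_nonneg hh m) (unitBallVolume_nonneg m)
  have hle := lpNorm_two_restrict_le (μ := Measure.map g volume) (f := J) (s := hull e) hfin
    hJ.aestronglyMeasurable hB (Real.sqrt_nonneg (h ^ m * unitBallVolume m))
    (by rwa [Real.sq_sqrt hκ]) fun x hx => by
      obtain ⟨y, rfl⟩ := mem_range_hyperplaneMap hA (he x hx)
      exact hJB y (by rw [← hnorm]; exact heh _ hx)
  refine (pow_le_pow_left₀ lpNorm_nonneg hle 2).trans (le_of_eq ?_)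
  rw [mul_pow, Real.sq_sqrt hκ]

/-- The sum of the normal fluxes from the two sides of a face is bounded by the local error, once
the element residuals on both sides are. The two elements enter only through the two halves of a
ball centred on the face that they contain. -/
theorem exists_jump_bound (m k : ℕ) {τ H C₁ : ℝ} (hτ : 0 < τ) (hH : 0 ≤ H) (hC₁ : 0 ≤ C₁) :
    ∃ C : ℝ, 0 ≤ C ∧ ∀ {Ω U : Set (Space (m + 1))} {T T' e : Finset (Space (m + 1))}
      {Eg u uh : Space (m + 1) → Space (m + 1)} {p ph : Space (m + 1) → ℝ},
      IsStokesSolution Ω Eg u p → IsOpen Ω → IsOpen U → U ⊆ Ω →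
      VecMemH1 Ω uh → MemLp ph 2 (volume.restrict Ω) →
      IsPolyOn k T uh ph → IsPolyOn k T' uh ph →
      interior (hull T) ⊆ Ω → interior (hull T') ⊆ Ω →
      ∀ {n c : Space (m + 1)} {h : ℝ}, 0 < h → h ≤ H → ‖n‖ = 1 →
      Metric.ball c (τ * h) ⊆ U →
      halfSpace n c ∩ Metric.ball c (τ * h) ⊆ hull T →
      (halfSpace n c)ᶜ ∩ Metric.ball c (τ * h) ⊆ hull T' →
      (∀ x ∈ hull e, inner ℝ n (x - c) = 0) → (∀ x ∈ hull e, ‖x - c‖ ≤ h) →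
      h ^ 2 * l2Norm (hull T) (elemResidual T uh ph) ≤
        C₁ * (l2Norm U (u - uh) + hNegOneNorm U (p - ph)) →
      h ^ 2 * l2Norm (hull T') (elemResidual T' uh ph) ≤
        C₁ * (l2Norm U (u - uh) + hNegOneNorm U (p - ph)) →
      ∀ {J : Space (m + 1) → Space (m + 1)}, (∀ x i, J x i = MvPolynomial.eval x.ofLp
        (fluxPoly T n uh ph i + fluxPoly T' (-n) uh ph i)) →
      h ^ 3 * faceNorm e J ^ 2 ≤ C * (l2Norm U (u - uh) + hNegOneNorm U (p - ph)) ^ 2 := by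
  obtain ⟨K, c₀, hK, hc₀, hbub⟩ := exists_face_bubbles m k τ⁻¹
  set d := m + 1 with hd
  set κ := Real.sqrt (unitBallVolume d) with hκ
  have hκ0 : 0 ≤ κ := Real.sqrt_nonneg _
  have hκ'0 := unitBallVolume_nonneg m
  -- the two summands of `Y` come from the residual functional and from the element residuals
  set Y := (2 * d ^ 2 + d) * (K * (1 + τ * H)) + 2 * d * K * C₁ * τ ^ 2 with hY
  have hY0 : 0 ≤ Y := by positivity
  refine ⟨τ⁻¹ ^ 3 * (d * K) ^ 2 * (τ⁻¹ ^ m * unitBallVolume m) * (Y * κ / c₀) ^ 2,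
    by positivity, ?_⟩
  intro Ω U T T' e Eg u uh p ph hsol hΩ hU hUΩ huh hph hpoly hpoly' hTΩ hTΩ' n c h hh hhH hn
    hballU hballT hballT' hen heh hR hR' J hJ
  obtain ⟨A, hA⟩ := exists_rotation hn
  set ρ := τ * h with hρdef
  have hρ : 0 < ρ := by positivity
  have hhρ : h = τ⁻¹ * ρ := by rw [hρdef]; field_simp
  set S := l2Norm U (u - uh) + hNegOneNorm U (p - ph) with hS
  have hS0 : 0 ≤ S := add_nonneg lpNorm_nonneg (hNegOneNorm_nonneg hU
    ((hsol.pressure_mem.1.sub hph).mono_measure (Measure.restrict_mono hUΩ le_rfl)))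
  obtain ⟨N, v, hN, hv, hv0, hv1, hv2, hlow, hup⟩ := hbub A c ρ hρ
    (fun i => fluxPoly T n uh ph i + fluxPoly T' (-n) uh ph i) fun i =>
      (MvPolynomial.totalDegree_add _ _).trans (max_le
        (totalDegree_fluxPoly_le (fun i => (hpoly.1 i).1) hpoly.2.1 _ _)
        (totalDegree_fluxPoly_le (fun i => (hpoly'.1 i).1) hpoly'.2.1 _ _))
  set w := Real.sqrt (ρ ^ m) with hw
  have hw0 : 0 < w := Real.sqrt_pos.2 (by positivity)
  have hw2 : w ^ 2 = ρ ^ m := Real.sq_sqrt (by positivity)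
  set s := Real.sqrt ρ with hs
  have hs0 : 0 ≤ s := Real.sqrt_nonneg _
  have hs2 : s ^ 2 = ρ := Real.sq_sqrt hρ.le
  have hws : Real.sqrt (ρ ^ d) = w * s := by
    rw [hd, pow_succ, Real.sqrt_mul (by positivity)]
  -- the surface measure on the hyperplane of the face
  set μB := Measure.map (hyperplaneMap A c) volume with hμB
  have hemb := (isometry_hyperplaneMap A c).isClosedEmbedding
  have hmap : ∀ f : Space d → ℝ, ∫ x, f x ∂μB = ∫ y, f (hyperplaneMap A c y) := fun f =>
    hemb.measurableEmbedding.integral_map f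
  have hint : ∀ f : Space d → ℝ, Continuous f → HasCompactSupport f → Integrable f μB := by
    intro f hf hc
    rw [hμB, hemb.measurableEmbedding.integrable_map_iff]
    exact (hf.comp hemb.continuous).integrable_of_hasCompactSupport
      (hc.comp_isClosedEmbedding hemb)
  have hvΩ : ∀ i, IsTestFunction Ω (v i) := fun i => (hv i).mono (hballU.trans hUΩ)
  -- the elementwise Green formulas on the two half-spaces add up to the jump on the hyperplane
  have hres : residual Ω uh ph v =
      (∑ i, ∫ x in halfSpace n c, MvPolynomial.eval x.ofLp (residualPoly T uh ph i) * v i x) +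
      (∑ i, ∫ x in (halfSpace n c)ᶜ,
        MvPolynomial.eval x.ofLp (residualPoly T' uh ph i) * v i x) +
      ∑ i, ∫ y, MvPolynomial.eval (hyperplaneMap A c y).ofLp
        (fluxPoly T n uh ph i + fluxPoly T' (-n) uh ph i) * v i (hyperplaneMap A c y) := by
    rw [residual_eq_add_compl (measurableSet_halfSpace n c) huh hph hvΩ,
      residualOn_eq (μB := μB) (ν := n) hΩ huh hpoly hTΩ hballT (measurableSet_halfSpace n c) hv
        (fun f hf hc j => by rw [hmap]; exact integral_pd_halfSpace hA c hf hc j) hint,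
      residualOn_eq (μB := μB) (ν := -n) hΩ huh hpoly' hTΩ' hballT'
        (measurableSet_halfSpace n c).compl hv
        (fun f hf hc j => by rw [hmap]; exact integral_pd_compl_halfSpace hA c hf hc j) hint]
    have hadd : ∀ i, ∫ y, MvPolynomial.eval (hyperplaneMap A c y).ofLp
        (fluxPoly T n uh ph i + fluxPoly T' (-n) uh ph i) * v i (hyperplaneMap A c y) =
        (∫ x, MvPolynomial.eval x.ofLp (fluxPoly T n uh ph i) * v i x ∂μB) +
        ∫ x, MvPolynomial.eval x.ofLp (fluxPoly T' (-n) uh ph i) * v i x ∂μB := by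
      intro i
      have hi : ∀ P : MvPolynomial (Fin d) ℝ,
          Integrable (fun x => MvPolynomial.eval x.ofLp P * v i x) μB := fun P =>
        hint _ ((contDiff_eval P).continuous.mul (hv i).1.continuous) (hv i).2.1.mul_left
      rw [← integral_add (hi _) (hi _), hmap]
      exact integral_congr_ae (ae_of_all _ fun y => by simp only [map_add, add_mul])
    simp_rw [hadd, Finset.sum_add_distrib]
    ring
  have hvol : volume.real (Metric.closedBall c ρ) ≤ (w * s * κ) ^ 2 := by
    rw [volume_real_closedBall c hρ.le, ← hws, mul_pow (Real.sqrt (ρ ^ d)),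
      Real.sq_sqrt (by positivity), hκ,
      Real.sq_sqrt (unitBallVolume_nonneg d)]
  have hhalf : ∀ {D : Set (Space d)} {T : Finset (Space d)}, MeasurableSet D →
      D ∩ Metric.ball c ρ ⊆ hull T →
      h ^ 2 * l2Norm (hull T) (elemResidual T uh ph) ≤ C₁ * S → ∀ i,
      |∫ x in D, MvPolynomial.eval x.ofLp (residualPoly T uh ph i) * v i x| ≤
        C₁ * S * τ ^ 2 * ρ⁻¹ ^ 2 * (K * N * (w * s * κ)) := by
    intro D T hD hDT hRT i
    refine (abs_setIntegral_residualPoly_mul_le hD hDT (hv i)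
      (s := Metric.closedBall c ρ) Metric.isClosed_closedBall.measurableSet
      (volume_closedBall_ne_top c ρ) (by positivity) (by positivity) hvol
      ((hv i).2.2.trans Metric.ball_subset_closedBall) (hv0 i) i).trans ?_
    refine mul_le_mul_of_nonneg_right ?_ (by positivity)
    rw [hhρ] at hRT
    calc l2Norm (hull T) (elemResidual T uh ph)
        = (τ⁻¹ * ρ) ^ 2 * l2Norm (hull T) (elemResidual T uh ph) * (τ ^ 2 * ρ⁻¹ ^ 2) := by
          field_simp
      _ ≤ C₁ * S * (τ ^ 2 * ρ⁻¹ ^ 2) := mul_le_mul_of_nonneg_right hRT (by positivity)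
      _ = _ := by ring
  have hG := hsol.abs_residual_bubble_le hΩ hU hUΩ huh hph hρ
    (mul_le_mul_of_nonneg_left hhH hτ.le) hK hN hballU hv hv1 hv2
  rw [hws] at hG
  have hsumle : ∀ f : Fin d → ℝ, (∀ i, |f i| ≤ C₁ * S * τ ^ 2 * ρ⁻¹ ^ 2 * (K * N * (w * s * κ))) →
      |∑ i, f i| ≤ d * (C₁ * S * τ ^ 2 * ρ⁻¹ ^ 2 * (K * N * (w * s * κ))) := by
    intro f hf
    refine (Finset.abs_sum_le_sum_abs _ _).trans ((Finset.sum_le_sum fun i _ => hf i).trans ?_)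
    simp
  have hI1 := hsumle _ (hhalf (measurableSet_halfSpace n c) hballT hR)
  have hI2 := hsumle _ (hhalf (measurableSet_halfSpace n c).compl hballT' hR')
  -- the lower bound for the bubbles is quadratic in `N`, the upper bounds are linear
  have h2 : c₀ * w * N ≤ Y * κ * S * (s * ρ⁻¹ ^ 2) := by
    refine mul_le_of_mul_sq_le hw0 hN (by positivity) ?_
    rw [hw2]
    refine hlow.trans ?_
    have e1 : (2 * (d : ℝ) ^ 2 + d) * (K * ((1 + τ * H) * ρ⁻¹ ^ 2) * N) * (w * s * κ) * S +
        2 * (d * (C₁ * S * τ ^ 2 * ρ⁻¹ ^ 2 * (K * N * (w * s * κ)))) =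
        Y * κ * S * (s * ρ⁻¹ ^ 2) * w * N := by
      rw [hY]; ring
    rw [← e1]
    have := (abs_le.1 hG).2
    rw [hres] at this
    linarith [(abs_le.1 hI1).1, (abs_le.1 hI2).1]
  have hJc : Continuous J := by
    have : J = fun x => WithLp.toLp 2 fun i => MvPolynomial.eval x.ofLp
        (fluxPoly T n uh ph i + fluxPoly T' (-n) uh ph i) := by
      funext x; ext i; exact hJ x i
    rw [this]
    exact (PiLp.continuous_toLp 2 _).comp
      (continuous_pi fun i => (contDiff_eval _).continuous)
  have h3 : faceNorm e J ^ 2 ≤ (d * (K * N)) ^ 2 * (h ^ m * unitBallVolume m) := by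
    refine faceNorm_sq_le hA hen hh.le heh hJc (by positivity) fun y hy =>
      norm_le_of_abs_apply_le (by positivity) fun i => ?_
    rw [hJ]
    refine hup i y ?_
    rwa [mul_comm, ← hhρ]
  have h4 : (c₀ * w * N) ^ 2 ≤ (Y * κ * S * (s * ρ⁻¹ ^ 2)) ^ 2 :=
    pow_le_pow_left₀ (by positivity) h2 2
  calc h ^ 3 * faceNorm e J ^ 2
      ≤ (τ⁻¹ * ρ) ^ 3 * ((d * (K * N)) ^ 2 * ((τ⁻¹ * ρ) ^ m * unitBallVolume m)) := by
        rw [← hhρ]; gcongr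
    _ = τ⁻¹ ^ 3 * (d * K) ^ 2 * (τ⁻¹ ^ m * unitBallVolume m) * ρ ^ 3 / c₀ ^ 2 *
        (c₀ * w * N) ^ 2 := by
        rw [mul_pow τ⁻¹ ρ m, ← hw2]; field_simp
    _ ≤ τ⁻¹ ^ 3 * (d * K) ^ 2 * (τ⁻¹ ^ m * unitBallVolume m) * ρ ^ 3 / c₀ ^ 2 *
        (Y * κ * S * (s * ρ⁻¹ ^ 2)) ^ 2 := by gcongr
    _ = τ⁻¹ ^ 3 * (d * K) ^ 2 * (τ⁻¹ ^ m * unitBallVolume m) * (Y * κ / c₀) ^ 2 * S ^ 2 *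
        (ρ ^ 3 * s ^ 2 * ρ⁻¹ ^ 4) := by ring
    _ = _ := by rw [hs2]; field_simp

end Faces

/-! ### The error indicator of an element -/

section Efficiency

variable {d : ℕ} {Ω : Set (Space d)} {M : Mesh d Ω} {T T' e : Finset (Space d)} {σ : ℝ}

theorem Mesh.ShapeRegular.mono {σ' : ℝ} (hM : M.ShapeRegular σ) (h : σ ≤ σ') :
    M.ShapeRegular σ' := fun T hT => by
  obtain ⟨c, r, hr, hball, hσ⟩ := hM T hT
  exact ⟨c, r, hr, hball, hσ.trans (mul_le_mul_of_nonneg_right h (by positivity))⟩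

/-- An element contains a ball, and lies in a concentric ball, of radius comparable with its
diameter. -/
theorem Mesh.ShapeRegular.exists_ball_subset_hull (hM : M.ShapeRegular σ) (hσ : 0 < σ)
    (hd : 0 < d) (hT : T ∈ M.elems) : ∃ c : Space d,
      Metric.ball c ((2 * σ)⁻¹ * elemDiam T) ⊆ hull T ∧
      hull T ⊆ Metric.closedBall c (elemDiam T) := by
  obtain ⟨c, r, hr, hball, h⟩ := hM.exists_ball hd hT
  refine ⟨c, fun x hx => hball ?_, fun x hx =>
    dist_le_elemDiam hx (hball (Metric.mem_closedBall_self hr.le))⟩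
  refine (Metric.mem_ball.1 hx).le.trans ?_
  rw [inv_mul_le_iff₀ (by positivity)]
  linarith

/-- Near the barycentre of a facet, an element coincides with a half-space on a ball of radius
comparable with the diameter of any element sharing the facet. -/
theorem Mesh.ShapeRegular.mem_hull_of_inner_nonpos (hM : M.ShapeRegular σ) (hσ : 0 < σ)
    (hd : 2 ≤ d) (hT : T ∈ M.elems) (hT' : T' ∈ M.elems) (he : e.card = d) (heT : e ⊆ T)
    (heT' : e ⊆ T') {y : Space d}
    (hy : y ∈ Metric.ball (faceCenter e) ((d * σ ^ 2)⁻¹ * elemDiam T))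
    (hin : inner ℝ (outwardNormal T' e) (y - faceCenter e) ≤ 0) : y ∈ hull T' := by
  obtain ⟨c, r, hr, hball, h⟩ := hM.exists_ball (by omega) hT'
  have hd0 : (0 : ℝ) < d := by exact_mod_cast (by omega : 0 < d)
  refine Mesh.mem_hull_of_inner_nonpos (by omega) hT' heT' he hr hball ?_ hin
  rw [Metric.mem_ball, dist_eq_norm] at hy
  refine hy.le.trans ?_
  have h1 := M.elemDiam_le_mul_of_common_edge hd hM hT he heT heT'
  have h2 : elemDiam T ≤ σ * (σ * (2 * r)) := h1.trans (mul_le_mul_of_nonneg_left h hσ.le)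
  rw [inv_mul_le_iff₀ (by positivity)]
  refine h2.trans (le_of_eq ?_)
  field_simp

theorem Mesh.isPolyOn {k : ℕ} {uh : Space d → Space d} {ph : Space d → ℝ}
    (hu : ∀ i, M.IsPiecewisePoly k (comp uh i)) (hp : M.IsPiecewisePoly k ph)
    (hT : T ∈ M.elems) (hint : (interior (hull T)).Nonempty) : IsPolyOn k T uh ph :=
  ⟨fun i => localPoly_spec hint (hu i T hT), localPoly_spec hint (hp T hT)⟩

theorem Mesh.jump_apply (hT : T ∈ M.elems) (hT' : T' ∈ M.elems) (hne : T' ≠ T) (heT : e ⊆ T)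
    (heT' : e ⊆ T') (h : ∀ S ∈ M.elems, e ⊆ S → S = T ∨ S = T') (uh : Space d → Space d)
    (ph : Space d → ℝ) (x : Space d) :
    M.jump e uh ph x = normalFlux T e uh ph x + normalFlux T' e uh ph x := by
  classical
  have hfilter : M.elems.filter (fun S => e ⊆ S) = {T, T'} := by
    ext S
    simp only [Finset.mem_filter, Finset.mem_insert, Finset.mem_singleton]
    refine ⟨fun hS => h S hS.1 hS.2, ?_⟩
    rintro (rfl | rfl)
    exacts [⟨hT, heT⟩, ⟨hT', heT'⟩]
  rw [← Finset.sum_pair (f := fun S => normalFlux S e uh ph x) hne.symm, ← hfilter, Mesh.jump]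

theorem Mesh.card_interiorFaces_le (hT : T ∈ M.elems) : (M.interiorFaces T).card ≤ d + 1 := by
  classical
  refine (Finset.card_filter_le _ _).trans ?_
  rw [Finset.card_powersetCard, M.card_eq T hT, Nat.choose_succ_self_right]

end Efficiency

/-- The local efficiency of the error indicator on a bounded domain, for a shape regularity
constant that is at least one. -/
theorem exists_indicator_bound {m : ℕ} (hm : 1 ≤ m) {Ω : Set (Space (m + 1))}
    (hΩ_bdd : Bornology.IsBounded Ω) (hΩ : interior (closure Ω) = Ω) {σ : ℝ} (hσ : 1 ≤ σ) (k : ℕ) :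
    ∃ C : ℝ, 0 < C ∧ ∀ {M : Mesh (m + 1) Ω}, M.ShapeRegular σ →
      ∀ {Eg u uh : Space (m + 1) → Space (m + 1)} {p ph : Space (m + 1) → ℝ},
      IsStokesSolution Ω Eg u p → VecMemH1 Ω uh → (∀ i, M.IsPiecewisePoly k (comp uh i)) →
      MemLp ph 2 (volume.restrict Ω) → M.IsPiecewisePoly k ph → ∀ {T}, T ∈ M.elems →
      M.indicator T uh ph ≤
        C * (l2Norm (M.patch T) (u - uh) + hNegOneNorm (M.patch T) (p - ph)) := by
  have hσ0 : 0 < σ := by linarith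
  have hΩo : IsOpen Ω := hΩ ▸ isOpen_interior
  have hτ : 0 < (2 * σ)⁻¹ := by positivity
  have hτ' : 0 < (((m + 1 : ℕ) : ℝ) * σ ^ 2)⁻¹ := by positivity
  have hH : 0 ≤ Metric.diam Ω := Metric.diam_nonneg
  obtain ⟨C₁, hC₁, hres⟩ := exists_elemResidual_bound (m + 1) k hτ hH
  obtain ⟨C₂, hC₂, hdiv⟩ := exists_elemDiv_bound (m + 1) k hτ
  obtain ⟨C₃, hC₃, hjump⟩ := exists_jump_bound m k hτ' hH (by positivity : 0 ≤ σ ^ 2 * C₁)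
  refine ⟨C₁ ^ 2 + C₂ ^ 2 + (m + 2) * C₃ + 1, by positivity, ?_⟩
  intro M hM Eg u uh p ph hsol huh hupoly hph hppoly T hT
  have hd : 2 ≤ m + 1 := by omega
  have hd0 : 0 < m + 1 := by omega
  set U := M.patch T with hU
  have hUo : IsOpen U := isOpen_interior
  have hUΩ : U ⊆ Ω := Mesh.patch_subset hΩ
  set S := l2Norm U (u - uh) + hNegOneNorm U (p - ph) with hS
  have hneg : 0 ≤ hNegOneNorm U (p - ph) := hNegOneNorm_nonneg hUo
    ((hsol.pressure_mem.1.sub hph).mono_measure (Measure.restrict_mono hUΩ le_rfl))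
  have hS0 : 0 ≤ S := add_nonneg lpNorm_nonneg hneg
  have hpoly : ∀ T' ∈ M.elems, IsPolyOn k T' uh ph := by
    intro T' hT'
    obtain ⟨c, hc, -⟩ := hM.exists_ball_subset_hull hσ0 hd0 hT'
    refine Mesh.isPolyOn hupoly hppoly hT' ⟨c, interior_maximal hc Metric.isOpen_ball
      (Metric.mem_ball_self (mul_pos hτ (M.elemDiam_pos hd0 hT')))⟩
  have hself : (hull T ∩ hull T).Nonempty := by
    obtain ⟨v, hv⟩ := Finset.card_pos.1 (by rw [M.card_eq T hT]; omega : 0 < T.card)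
    exact ⟨v, vertex_mem_hull hv, vertex_mem_hull hv⟩
  have hR : ∀ T' ∈ M.elems, (hull T' ∩ hull T).Nonempty →
      elemDiam T' ^ 2 * l2Norm (hull T') (elemResidual T' uh ph) ≤ C₁ * S := by
    intro T' hT' hmeet
    obtain ⟨c, hc, hc'⟩ := hM.exists_ball_subset_hull hσ0 hd0 hT'
    exact hres hsol hΩo hUo hUΩ huh hph (hpoly T' hT') (Mesh.interior_hull_subset hΩ hT')
      (M.elemDiam_pos hd0 hT') (Mesh.elemDiam_le hΩ_bdd hT') hc
      (Mesh.subset_patch Metric.isOpen_ball hT hT' hmeet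
        (hc.trans Set.subset_union_right)) hc'
  have hD : elemDiam T * l2Norm (hull T) (elemDiv T uh) ≤ C₂ * S := by
    obtain ⟨c, hc, hc'⟩ := hM.exists_ball_subset_hull hσ0 hd0 hT
    refine (hdiv hsol hΩo hUΩ huh (hpoly T hT) (Mesh.interior_hull_subset hΩ hT)
      (M.elemDiam_pos hd0 hT) hc
      (Mesh.subset_patch Metric.isOpen_ball hT hT hself
        (hc.trans Set.subset_union_right)) hc').trans ?_
    exact mul_le_mul_of_nonneg_left (le_add_of_nonneg_right hneg) hC₂
  have hJ : ∀ e ∈ M.interiorFaces T,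
      elemDiam T ^ 3 * faceNorm e (M.jump e uh ph) ^ 2 ≤ C₃ * S ^ 2 := by
    intro e heF
    obtain ⟨heT, he, T', hT', hne, heT', hcases⟩ := Mesh.exists_neighbour hd0 hM hT heF
    have hn := Mesh.isOutwardNormal hd0 hT heT he
    have hneg := Mesh.outwardNormal_eq_neg hd0 hM hT hT' hne.symm heT heT' he
    have hcT := hull_mono heT (faceCenter_mem_hull hd0 he)
    have hmeet : (hull T' ∩ hull T).Nonempty :=
      ⟨_, hull_mono heT' (faceCenter_mem_hull hd0 he), hcT⟩
    have hin : halfSpace (outwardNormal T e) (faceCenter e) ∩ Metric.ball (faceCenter e)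
        ((((m + 1 : ℕ) : ℝ) * σ ^ 2)⁻¹ * elemDiam T) ⊆ hull T := fun y hy =>
      hM.mem_hull_of_inner_nonpos hσ0 hd hT hT he heT heT hy.2 hy.1
    have hout : (halfSpace (outwardNormal T e) (faceCenter e))ᶜ ∩ Metric.ball (faceCenter e)
        ((((m + 1 : ℕ) : ℝ) * σ ^ 2)⁻¹ * elemDiam T) ⊆ hull T' := fun y hy =>
      hM.mem_hull_of_inner_nonpos hσ0 hd hT hT' he heT heT' hy.2 (by
        rw [hneg, inner_neg_left, neg_nonpos]
        exact (not_le.1 fun h => hy.1 h).le)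
    have hball : Metric.ball (faceCenter e)
        ((((m + 1 : ℕ) : ℝ) * σ ^ 2)⁻¹ * elemDiam T) ⊆ U :=
      Mesh.subset_patch Metric.isOpen_ball hT hT' hmeet fun y hy =>
        (em (y ∈ halfSpace (outwardNormal T e) (faceCenter e))).imp
          (fun h => hin ⟨h, hy⟩) fun h => hout ⟨h, hy⟩
    -- the residual of either element, weighted with the diameter of `T`
    have hscale : ∀ T'' ∈ M.elems, e ⊆ T'' → (hull T'' ∩ hull T).Nonempty →
        elemDiam T ^ 2 * l2Norm (hull T'') (elemResidual T'' uh ph) ≤ σ ^ 2 * C₁ * S := by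
      intro T'' hT'' heT'' hmeet
      have h1 := M.elemDiam_le_mul_of_common_edge hd hM hT he heT heT''
      calc elemDiam T ^ 2 * l2Norm (hull T'') (elemResidual T'' uh ph)
          ≤ (σ * elemDiam T'') ^ 2 * l2Norm (hull T'') (elemResidual T'' uh ph) :=
            mul_le_mul_of_nonneg_right
              (pow_le_pow_left₀ (M.elemDiam_pos hd0 hT).le h1 2) lpNorm_nonneg
        _ = σ ^ 2 * (elemDiam T'' ^ 2 * l2Norm (hull T'') (elemResidual T'' uh ph)) := by ring
        _ ≤ σ ^ 2 * (C₁ * S) := mul_le_mul_of_nonneg_left (hR T'' hT'' hmeet) (by positivity)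
        _ = σ ^ 2 * C₁ * S := by ring
    refine hjump hsol hΩo hUo hUΩ huh hph (hpoly T hT) (hpoly T' hT')
      (Mesh.interior_hull_subset hΩ hT) (Mesh.interior_hull_subset hΩ hT')
      (M.elemDiam_pos hd0 hT) (Mesh.elemDiam_le hΩ_bdd hT) hn.1 hball hin hout
      (fun x hx => Mesh.inner_sub_faceCenter_eq_zero hd0 hT heT he hn.2.1 hx)
      (fun x hx => ?_) (hscale T hT heT hself) (hscale T' hT' heT' hmeet) fun x i => ?_
    · rw [← dist_eq_norm]
      exact dist_le_elemDiam (hull_mono heT hx) hcT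
    · rw [Mesh.jump_apply hT hT' hne heT heT' hcases, PiLp.add_apply, normalFlux_apply,
        normalFlux_apply, hneg, map_add]
  have hh := (M.elemDiam_pos hd0 hT).le
  have h1 : (elemDiam T ^ 2 * l2Norm (hull T) (elemResidual T uh ph)) ^ 2 ≤ (C₁ * S) ^ 2 :=
    pow_le_pow_left₀ (mul_nonneg (sq_nonneg _) lpNorm_nonneg) (hR T hT hself) 2
  have h2 : (elemDiam T * l2Norm (hull T) (elemDiv T uh)) ^ 2 ≤ (C₂ * S) ^ 2 :=
    pow_le_pow_left₀ (mul_nonneg hh lpNorm_nonneg) hD 2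
  have h3 : ∑ e ∈ M.interiorFaces T, elemDiam T ^ 3 * faceNorm e (M.jump e uh ph) ^ 2 ≤
      (m + 2) * (C₃ * S ^ 2) := by
    refine (Finset.sum_le_card_nsmul _ _ _ hJ).trans ?_
    rw [nsmul_eq_mul]
    refine mul_le_mul_of_nonneg_right ?_ (by positivity)
    have := Mesh.card_interiorFaces_le hT
    have h4 : ((M.interiorFaces T).card : ℝ) ≤ ((m + 1 + 1 : ℕ) : ℝ) := by exact_mod_cast this
    refine h4.trans (le_of_eq ?_)
    push_cast
    ring
  set B := C₁ ^ 2 + C₂ ^ 2 + (m + 2) * C₃ with hB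
  have hB0 : 0 ≤ B := by positivity
  refine Real.sqrt_le_iff.2 ⟨by positivity, ?_⟩
  have h5 : 0 ≤ (m + 2) * (C₃ * S ^ 2) := by positivity
  calc elemDiam T ^ 4 * l2Norm (hull T) (elemResidual T uh ph) ^ 2 +
      elemDiam T ^ 2 * l2Norm (hull T) (elemDiv T uh) ^ 2 +
      1 / 2 * ∑ e ∈ M.interiorFaces T, elemDiam T ^ 3 * faceNorm e (M.jump e uh ph) ^ 2
      = (elemDiam T ^ 2 * l2Norm (hull T) (elemResidual T uh ph)) ^ 2 +
        (elemDiam T * l2Norm (hull T) (elemDiv T uh)) ^ 2 +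
        1 / 2 * ∑ e ∈ M.interiorFaces T, elemDiam T ^ 3 * faceNorm e (M.jump e uh ph) ^ 2 := by
        ring
    _ ≤ (C₁ * S) ^ 2 + (C₂ * S) ^ 2 + (m + 2) * (C₃ * S ^ 2) := by linarith
    _ = B * S ^ 2 := by ring
    _ ≤ (B + 1) ^ 2 * S ^ 2 := mul_le_mul_of_nonneg_right (by nlinarith) (sq_nonneg S)
    _ = ((B + 1) * S) ^ 2 := by ring

end StokesFEM

open StokesFEM
theorem mainTheorem6 (d : ℕ) (hd : d = 2 ∨ d = 3)
    (Ω : Set (Space d)) (hΩ_bdd : Bornology.IsBounded Ω) (hΩ : interior (closure Ω) = Ω)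
    (σ : ℝ) (k : ℕ) :
    ∃ C : ℝ, 0 < C ∧
      ∀ M : Mesh d Ω, M.ShapeRegular σ →
      ∀ (W : Submodule ℝ (Space d → Space d)) (Q : Submodule ℝ (Space d → ℝ)),
        M.IsVelocitySpace k W → M.IsPressureSpace k Q →
      ∀ Eg ∈ W, ∀ (u : Space d → Space d) (p : Space d → ℝ), IsStokesSolution Ω Eg u p →
      ∀ (uh : Space d → Space d) (ph : Space d → ℝ), IsDiscreteSolution Ω W Q Eg uh ph →
      ∀ T ∈ M.elems,
        M.indicator T uh ph ≤
          C * (l2Norm (M.patch T) (u - uh) + hNegOneNorm (M.patch T) (p - ph)) := by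
  obtain ⟨m, rfl⟩ : ∃ m, d = m + 1 := ⟨d - 1, by omega⟩
  obtain ⟨C, hC, h⟩ := exists_indicator_bound (by omega : 1 ≤ m) hΩ_bdd hΩ (le_max_right σ 1) k
  refine ⟨C, hC, fun M hM W Q hW hQ Eg _ u p hsol uh ph hdisc T hT => ?_⟩
  obtain ⟨hu, hupoly⟩ := hW uh hdisc.velocity_mem
  obtain ⟨hp, hppoly⟩ := hQ ph hdisc.pressure_mem
  exact h (hM.mono (le_max_left σ 1)) hsol hu hupoly hp.1 hppoly hT
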